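/- Let $\mathbb{K}$ be a field and let $(S,\le,\mathfrak b)$ be a poset with bonds. That is, $S$ is a finite poset with a least element $\mathsf 0$ and a greatest element $\mathsf 1$. It is graded: any two complete (saturated) chains with the same end points have the same number of elements. Finally $\mathfrak b$ assigns to each pair $(\sigma,\tau)$ with $\tau$ covering $\sigma$ a positive integer, in such a way that the greatest common divisor of the bonds along a complete chain from $\sigma$ to $\tau$ depends only on $\sigma$ and $\tau$; this gcd extends $\mathfrak b$ to all pairs $\sigma<\tau$. An LS-path of degree $r\in\mathbb N$ is a function $\pi:S\to\mathbb Q_{\ge 0}$ whose support $\{\sigma_1<\dots<\sigma_n\}$ is a chain, with $\mathfrak b(\sigma_j,\sigma_{j+1})\sum_{i\le j}\pi(\sigma_i)\in\mathbb N$ for $1\le j<n$ and $\sum_{\sigma\in S}\pi(\sigma)=r$. Let $\mathrm{LS}_r$ be the set of LS-paths of degree $r$. A monomial $\pi_1\cdots\pi_r$ with $\pi_h\in\mathrm{LS}_1$ is standard if $\max\operatorname{supp}\pi_h\le\min\operatorname{supp}\pi_{h+1}$ for all $h$; the canonical form of an LS-path $\pi$ of degree $r$ is the standard monomial $\pi_1\cdots\pi_r$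 with $\pi=\pi_1+\dots+\pi_r$ as functions. Let $A$ be a commutative graded $\mathbb K$-algebra with an injection $j:\mathrm{LS}_1\to A_1$, extended to all LS-paths by $j(\pi)=j(\pi_1)\cdots j(\pi_r)$, where $\pi_1\cdots\pi_r$ is the canonical form of $\pi$. The pair $(A,j)$ is an LS algebra over $(S,\le,\mathfrak b)$ if the following hold. - The elements $j(\pi)$, for $\pi$ an LS-path, form a $\mathbb K$-basis of $A$, and $A_r$ is spanned by $j(\mathrm{LS}_r)$ for every $r$. - If $\pi_1\pi_2$ is a non-standard monomial of degree $2$ and $j(\pi_1)j(\pi_2)=\sum_\pi c_\pi j(\pi)$, then for each $\pi$ with $c_\pi\ne0$ and each total order $\le^t$ on $S$ refining $\le$ one has $\pi_1+\pi_2=\pi$ or $(\pi_1+\pi_2)(\sigma)<\pi(\sigma)$ at the $\le^t$-largest $\sigma$ where $\pi_1+\pi_2$ and $\pi$ differ. If moreover $\operatorname{supp}\pi_1\cup\operatorname{supp}\pi_2$ is contained in a chain, then $c_{\pi_1+\pi_2}=1$. It is the discrete LS algebra if, for each non-standard monomial $\pi_1\pi_2$ of degree $2$, one has $j(\pi_1)j(\pi_2)=j(\pi_1+\pi_2)$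 when the supports of $\pi_1$ and $\pi_2$ are contained in a common chain, and $j(\pi_1)j(\pi_2)=0$ otherwise. For a chain $\mathcal C\subseteq S$ let $I_{\mathcal C}$ be the homogeneous ideal of $A$ generated by the $j(\pi)$ with $\pi\in\mathrm{LS}_1$ and $\operatorname{supp}\pi\not\subseteq\mathcal C$. Put $A_{\mathcal C}=A/I_{\mathcal C}$, $X=\operatorname{Proj}(A)$ and $X_{\mathcal C}=\operatorname{Proj}(A_{\mathcal C})$. **Theorem.** A discrete LS algebra over $(S,\le,\mathfrak b)$ exists, and for every such algebra $A$ the following hold. 1. For each chain $\mathcal C$ in $S$, $A_{\mathcal C}$ is, with the path basis induced by $j$, the discrete LS algebra over $\mathcal C$ with the induced order and the induced bonds, and the quotient map $A\to A_{\mathcal C}$ induces a closed immersion $X_{\mathcal C}\to X$ over $\mathbb K$. 2. The map $\mathcal C\mapsto X_{\mathcal C}$ is a bijection from the set of maximal chains of $S$ to the set of irreducible components of $X$. 3. For each non-empty chain $\mathcal C$ in $S$ (in particular, for each maximal chain), $X_{\mathcal C}$ is a projective normal toric variety over $\mathbb K$: a normal integral projective $\mathbb K$-scheme containing a split torus $T\cong\mathbb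 G_m^n$ as a dense open subscheme such that the multiplication of $T$ extends to an action of $T$ on $X_{\mathcal C}$. 4. For all chains $\mathcal C_1,\mathcal C_2$ in $S$ one has $X_{\mathcal C_1}\cap X_{\mathcal C_2}=X_{\mathcal C_1\cap\mathcal C_2}$ as subschemes of $X$. If $\mathcal C_1$ and $\mathcal C_2$ are maximal then $\mathcal C_1\cap\mathcal C_2\neq\emptyset$, so by 3 the components $X_{\mathcal C_1}$ and $X_{\mathcal C_2}$ intersect along a normal toric subvariety. -/

import Mathlib

open CategoryTheory AlgebraicGeometry

universe u

namespace LSAlg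

/-! ### Posets with bonds -/

section Bonds

variable {S : Type u} [PartialOrder S]

/-- `l` is a complete (saturated) chain `σ = η₁ ⋖ η₂ ⋖ ⋯ ⋖ η_r = τ`. -/
def IsCompleteChain (σ τ : S) (l : List S) : Prop :=
  l.IsChain (fun x y => x ⋖ y) ∧ l.head? = some σ ∧ l.getLast? = some τ

/-- The greatest common divisor of the values of `b` on the consecutive pairs of a list
(it is `0` if there are no such pairs). -/
def chainGcd (b : S → S → ℕ) : List S → ℕ
  | σ :: τ :: l => Nat.gcd (b σ τ) (chainGcd b (τ :: l))
  | _ => 0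

/-- `S` is a graded poset and `b` is a set of bonds on it. The function `b` is only relevant on
pairs `(σ, τ)` with `σ ⋖ τ`. Finiteness of `S` and the existence of a least and of a
greatest element are expressed separately, by `[Finite S] [BoundedOrder S]`. -/
structure IsPosetWithBonds (b : S → S → ℕ) : Prop where
  graded : ∀ (σ τ : S) (l l' : List S), IsCompleteChain σ τ l → IsCompleteChain σ τ l' →
    l.length = l'.length
  pos : ∀ σ τ : S, σ ⋖ τ → 0 < b σ τ
  gcd_eq : ∀ (σ τ : S) (l l' : List S), IsCompleteChain σ τ l → IsCompleteChain σ τ l' →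
    chainGcd b l = chainGcd b l'

open Classical in
/-- The extension of the bonds to comparable pairs `σ < τ`: the greatest common divisor of the
bonds along a complete chain from `σ` to `τ`. -/
noncomputable def extBond (b : S → S → ℕ) (σ τ : S) : ℕ :=
  if h : ∃ l : List S, IsCompleteChain σ τ l then chainGcd b h.choose else 0

/-- The bonds induced on a subset `C` of `S`. -/
noncomputable def restrictBond (b : S → S → ℕ) (C : Set S) : C → C → ℕ :=
  fun σ τ => extBond b σ τ

/-! ### LS-paths -/

/-- LS-paths of degree `r`. In `integral`, `σ` and `τ` are consecutive elements of the support;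
in `total`, the sum over all of `S` equals the sum over the support. -/
structure IsLSPath (b : S → S → ℕ) (r : ℕ) (π : S → ℚ) : Prop where
  nonneg : ∀ σ, 0 ≤ π σ
  isChain : IsChain (· ≤ ·) (Function.support π)
  integral : ∀ σ ∈ Function.support π, ∀ τ ∈ Function.support π, σ < τ →
    (∀ ρ ∈ Function.support π, ¬ (σ < ρ ∧ ρ < τ)) →
    ∃ m : ℕ, (extBond b σ τ : ℚ) * ∑ᶠ ρ ∈ Set.Iic σ, π ρ = m
  total : ∑ᶠ ρ, π ρ = r

/-- The set `LS_r` of LS-paths of degree `r`, as a type. -/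
abbrev LSPath (b : S → S → ℕ) (r : ℕ) : Type u := {π : S → ℚ // IsLSPath b r π}

/-- The set `LS` of all LS-paths, as a type. -/
abbrev AllLSPath (b : S → S → ℕ) : Type u := {π : S → ℚ // ∃ r, IsLSPath b r π}

variable {b : S → S → ℕ}

/-- A monomial `π₁ π₂ ⋯ π_r` of LS-paths of degree one is standard if
`max supp π_h ≤ min supp π_{h+1}` for all `h`. -/
def IsStandard (l : List (LSPath b 1)) : Prop :=
  l.IsChain fun p q => ∀ σ ∈ Function.support p.1, ∀ τ ∈ Function.support q.1, σ ≤ τ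

/-- `l` is the canonical form of `π`: a standard monomial of degree one LS-paths with sum `π`. -/
def IsCanonicalForm (l : List (LSPath b 1)) (π : S → ℚ) : Prop :=
  IsStandard l ∧ (l.map Subtype.val).sum = π

/-- There is a chain containing both supports. -/
def ComparableSupports (p q : S → ℚ) : Prop :=
  ∃ C : Set S, IsChain (· ≤ ·) C ∧ Function.support p ⊆ C ∧ Function.support q ⊆ C

/-- The reverse lexicographic order on functions `S → ℚ` defined by a total order `r` on `S`. -/
def RevLexLE (r : S → S → Prop) (p q : S → ℚ) : Prop :=
  p = q ∨ ∃ σ, p σ < q σ ∧ ∀ τ, r σ τ → τ ≠ σ → p τ = q τ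

/-- The partial order `⊴` on functions `S → ℚ`. -/
def TriLE (p q : S → ℚ) : Prop :=
  ∀ r : S → S → Prop, IsLinearOrder S r → (∀ σ τ, σ ≤ τ → r σ τ) → RevLexLE r p q

end Bonds

/-! ### LS algebras -/

section Algebra

variable {S : Type u} [PartialOrder S] {b : S → S → ℕ}
variable {K A : Type u} [Field K] [CommRing A] [Algebra K A]

open Classical in
/-- The extension of `j : LS₁ → A` to all LS-paths, `j(π) = j(π₁) ⋯ j(π_r)` where `π₁ ⋯ π_r` is the
canonical form of `π`. -/
noncomputable def pathVec {𝒜 : ℕ → Submodule K A} (j : LSPath b 1 → 𝒜 1) (π : S → ℚ) : A :=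
  if h : ∃ l : List (LSPath b 1), IsCanonicalForm l π then
    (h.choose.map fun p => (j p : A)).prod
  else 0

/-- The graded algebra `A = ⨁ 𝒜 r`, together with the path basis `j : LS₁ → 𝒜 1 ⊆ A`, is an
LS algebra over `(S, ≤, b)`. The linear combinations in the last two fields are over LS-paths, each of
which stands for the standard monomial that is its canonical form. -/
structure IsLSAlgebra (b : S → S → ℕ) (𝒜 : ℕ → Submodule K A) (j : LSPath b 1 → 𝒜 1) : Prop where
  injective : Function.Injective j
  -- the LS-paths are a basis, and their degree induces the grading
  linearIndependent : LinearIndependent K fun π : AllLSPath b => pathVec j π.1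
  span_eq_top : Submodule.span K (Set.range fun π : AllLSPath b => pathVec j π.1) = ⊤
  grading : ∀ r, 𝒜 r = Submodule.span K (Set.range fun π : LSPath b r => pathVec j π.1)
  -- order condition on the straightening relations
  straightening_le : ∀ p q : LSPath b 1, ¬ IsStandard [p, q] → ∀ c : AllLSPath b →₀ K,
    (j p : A) * j q = Finsupp.linearCombination K (fun π : AllLSPath b => pathVec j π.1) c →
    ∀ π : AllLSPath b, c π ≠ 0 → TriLE (p.1 + q.1) π.1
  -- leading coefficient of the straightening relations
  straightening_coeff : ∀ p q : LSPath b 1, ¬ IsStandard [p, q] → ComparableSupports p.1 q.1 →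
    ∀ c : AllLSPath b →₀ K,
    (j p : A) * j q = Finsupp.linearCombination K (fun π : AllLSPath b => pathVec j π.1) c →
    ∀ π : AllLSPath b, π.1 = p.1 + q.1 → c π = 1

/-- The discrete LS algebra over `(S, ≤, b)`: the LS algebra with the simplest straightening
relations. -/
structure IsDiscreteLSAlgebra (b : S → S → ℕ) (𝒜 : ℕ → Submodule K A) (j : LSPath b 1 → 𝒜 1) :
    Prop extends IsLSAlgebra b 𝒜 j where
  mul_of_comparable : ∀ p q : LSPath b 1, ¬ IsStandard [p, q] → ComparableSupports p.1 q.1 →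
    ∀ p₀ q₀ : LSPath b 1, IsCanonicalForm [p₀, q₀] (p.1 + q.1) → (j p : A) * j q = j p₀ * j q₀
  mul_of_not_comparable : ∀ p q : LSPath b 1, ¬ IsStandard [p, q] →
    ¬ ComparableSupports p.1 q.1 → (j p : A) * j q = 0

end Algebra

/-! ### Quotients of graded algebras -/

section Quotient

variable {K A : Type u} [Field K] [CommRing A] [Algebra K A]
variable (𝒜 : ℕ → Submodule K A) [GradedAlgebra 𝒜]

/-- The grading of `A / I` induced by the grading of `A`. -/
def quotGrading (I : HomogeneousIdeal 𝒜) (r : ℕ) : Submodule K (A ⧸ I.toIdeal) :=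
  (𝒜 r).map (Ideal.Quotient.mkₐ K I.toIdeal).toLinearMap

theorem mk_mem_quotGrading (I : HomogeneousIdeal 𝒜) {r : ℕ} {x : A} (hx : x ∈ 𝒜 r) :
    Ideal.Quotient.mk I.toIdeal x ∈ quotGrading 𝒜 I r :=
  ⟨x, hx, rfl⟩

/-- The map `⨁ 𝒜 r → ⨁ (A / I)_r` induced by `A → A / I`. -/
noncomputable def quotDirectSumMap (I : HomogeneousIdeal 𝒜) :
    DirectSum ℕ (fun r => 𝒜 r) →+ DirectSum ℕ (fun r => quotGrading 𝒜 I r) :=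
  DirectSum.map fun _ =>
    { toFun := fun x => ⟨Ideal.Quotient.mk I.toIdeal x, mk_mem_quotGrading 𝒜 I x.2⟩
      map_zero' := Subtype.ext (map_zero _)
      map_add' := fun _ _ => Subtype.ext (map_add _ _ _) }

theorem coe_quotDirectSumMap (I : HomogeneousIdeal 𝒜) (x : DirectSum ℕ (fun r => 𝒜 r)) :
    DirectSum.coeAddMonoidHom (quotGrading 𝒜 I) (quotDirectSumMap 𝒜 I x) =
      Ideal.Quotient.mk I.toIdeal (DirectSum.coeAddMonoidHom 𝒜 x) := by
  induction x using DirectSum.induction_on with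
  | zero => simp
  | of i x => simp [quotDirectSumMap]
  | add x y hx hy => simp only [map_add, hx, hy]

theorem quotDirectSumMap_surjective (I : HomogeneousIdeal 𝒜) :
    Function.Surjective (quotDirectSumMap 𝒜 I) := by
  intro y
  induction y using DirectSum.induction_on with
  | zero => exact ⟨0, map_zero _⟩
  | of i y =>
    obtain ⟨_, a, ha, rfl⟩ := y
    exact ⟨DirectSum.of (fun r => 𝒜 r) i ⟨a, ha⟩, by simp [quotDirectSumMap]⟩
  | add y y' h h' =>
    obtain ⟨x, rfl⟩ := h
    obtain ⟨x', rfl⟩ := h'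
    exact ⟨x + x', map_add _ _ _⟩

/-- The quotient of a graded algebra by a homogeneous ideal is graded. -/
noncomputable instance quotGradedAlgebra (I : HomogeneousIdeal 𝒜) :
    GradedAlgebra (quotGrading 𝒜 I) where
  one_mem := mk_mem_quotGrading 𝒜 I SetLike.GradedOne.one_mem
  mul_mem := by
    rintro i k _ _ ⟨x, hx, rfl⟩ ⟨y, hy, rfl⟩
    exact ⟨x * y, SetLike.GradedMul.mul_mem hx hy, by simp⟩
  __ := DirectSum.IsInternal.chooseDecomposition _ (by
    classical
    constructor
    · rw [injective_iff_map_eq_zero]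
      intro y hy
      obtain ⟨x, rfl⟩ := quotDirectSumMap_surjective 𝒜 I y
      rw [coe_quotDirectSumMap, Ideal.Quotient.eq_zero_iff_mem] at hy
      ext i
      have h := I.isHomogeneous i hy
      rw [show DirectSum.decompose 𝒜 (DirectSum.coeAddMonoidHom 𝒜 x) = x from
        DirectSum.Decomposition.right_inv x] at h
      simpa [quotDirectSumMap, Ideal.Quotient.eq_zero_iff_mem] using h
    · intro y
      obtain ⟨a, rfl⟩ := Ideal.Quotient.mk_surjective y
      exact ⟨quotDirectSumMap 𝒜 I (DirectSum.decompose 𝒜 a), by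
        rw [coe_quotDirectSumMap]
        exact congrArg _ (DirectSum.Decomposition.left_inv a)⟩)

/-- The quotient map `A → A / I` as a homomorphism of graded rings. -/
def quotHom (I : HomogeneousIdeal 𝒜) : GradedRingHom 𝒜 (quotGrading 𝒜 I) where
  toRingHom := Ideal.Quotient.mk I.toIdeal
  map_mem := mk_mem_quotGrading 𝒜 I

open HomogeneousIdeal in
theorem irrelevant_le_map_quotHom (I : HomogeneousIdeal 𝒜) :
    irrelevant (quotGrading 𝒜 I) ≤ (irrelevant 𝒜).map (quotHom 𝒜 I) := by
  rw [irrelevant_le]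
  rintro i hi _ ⟨x, hx, rfl⟩
  exact Ideal.mem_map_of_mem (quotHom 𝒜 I) (mem_irrelevant_of_mem 𝒜 hi hx)

end Quotient

/-! ### Projective schemes over a field and toric varieties -/

section Geometry

variable {K A : Type u} [Field K] [CommRing A] [Algebra K A]

/-- `Proj A` as a scheme over `K`, for a graded `K`-algebra `A = ⨁ 𝒜 r`. -/
noncomputable def projOver (𝒜 : ℕ → Submodule K A) [GradedAlgebra 𝒜] :
    Over (Spec (CommRingCat.of K)) :=
  Over.mk (Proj.toSpecZero 𝒜 ≫ Spec.map (CommRingCat.ofHom (algebraMap K (𝒜 0))))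

/-- The projective space of dimension `n` over `K`. -/
noncomputable def projectiveSpace (K : Type u) [Field K] (n : ℕ) :
    Over (Spec (CommRingCat.of K)) :=
  letI : GradedAlgebra (MvPolynomial.homogeneousSubmodule (Fin (n + 1)) K) :=
    MvPolynomial.gradedAlgebra
  projOver (MvPolynomial.homogeneousSubmodule (Fin (n + 1)) K)

/-- `X` is projective over `K`: it is isomorphic over `K` to a closed subscheme of some
projective space. -/
def IsProjectiveOver (X : Over (Spec (CommRingCat.of K))) : Prop :=
  ∃ (n : ℕ) (i : X ⟶ projectiveSpace K n), IsClosedImmersion i.left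

/-- All local rings of `X` are integrally closed domains. -/
def IsNormalScheme (X : Scheme.{u}) : Prop :=
  ∀ x : X, IsDomain (X.presheaf.stalk x) ∧ IsIntegrallyClosed (X.presheaf.stalk x)

/-- The torus `𝔾ₘⁿ` over `K`, that is `Spec K[ℤⁿ]`; the group structure is that given by the Hopf
algebra structure of the group algebra. -/
noncomputable abbrev splitTorus (K : Type u) [Field K] (n : ℕ) :
    Over (Spec (CommRingCat.of K)) :=
  (Spec (CommRingCat.of (AddMonoidAlgebra K (Fin n → ℤ)))).asOver (Spec (CommRingCat.of K))

open MonoidalCategory in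
/-- `X` is a toric variety over `K`: an integral separated scheme of finite type over `K` that
contains a torus `T` as an open subscheme (necessarily dense), such that the multiplication
`T × T → T` extends to an action `T × X → X` of `T` on `X`. -/
def IsToricVariety (X : Over (Spec (CommRingCat.of K))) : Prop :=
  IsIntegral X.left ∧ IsSeparated X.hom ∧ LocallyOfFiniteType X.hom ∧ QuasiCompact X.hom ∧
  ∃ (n : ℕ) (i : splitTorus K n ⟶ X) (act : ModObj (splitTorus K n) X),
    IsOpenImmersion i.left ∧
      splitTorus K n ◁ i ≫ act.smul = MonObj.mul (X := splitTorus K n) ≫ i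

end Geometry

/-! ### The subvarieties attached to chains -/

section Chains

variable {S : Type u} [PartialOrder S] {b : S → S → ℕ}
variable {K A : Type u} [Field K] [CommRing A] [Algebra K A]
variable {𝒜 : ℕ → Submodule K A} [GradedAlgebra 𝒜] (j : LSPath b 1 → 𝒜 1) (C : Set S)

/-- The ideal of `A` generated by the LS-paths of degree one with support not contained in `C`. -/
def chainIdeal : HomogeneousIdeal 𝒜 where
  toSubmodule := Ideal.span {a | ∃ p : LSPath b 1, ¬ Function.support p.1 ⊆ C ∧ a = j p}
  is_homogeneous' := Ideal.homogeneous_span 𝒜 _ (by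
    rintro _ ⟨p, -, rfl⟩
    exact ⟨1, (j p).2⟩)

/-- The grading of `A_C`, the quotient of `A` by `chainIdeal j C`. -/
abbrev chainGrading : ℕ → Submodule K (A ⧸ (chainIdeal j C).toIdeal) :=
  quotGrading 𝒜 (chainIdeal j C)

/-- `X_C = Proj A_C`, as a scheme over `K`. -/
noncomputable def chainVariety : Over (Spec (CommRingCat.of K)) :=
  projOver (chainGrading j C)

/-- The morphism `X_C → X` induced by the quotient map `A → A_C`. -/
noncomputable def chainι : (chainVariety j C).left ⟶ (projOver 𝒜).left :=
  Proj.map (quotHom 𝒜 (chainIdeal j C)) (irrelevant_le_map_quotHom 𝒜 (chainIdeal j C))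

end Chains

end LSAlg

/-! A discrete LS algebra is a Stanley-Reisner-like gluing of normal monoid algebras, one for each
chain. The relations prescribe products of degree one paths only, but canonical forms propagate them
to all paths: the product of the basis vectors of `p` and `q` is the basis vector of `p + q` if the
supports lie in a common chain, and zero otherwise (`pathVec_mul`, `pathVec_mul_eq_zero`). This
rests on existence and uniqueness of canonical forms: the first factor of `π` is obtained by
truncating the partial sums of `π` at 1.

For a chain `C`, keeping the paths supported in `C` and killing the others is therefore a
homomorphism from `A` to the monomial algebra `K[ℚ^S]`, with kernel `I_C` (`ker_toMonomials`). The
paths supported in `C` are the nonnegative points of a lattice, because the bond of two elements is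
the gcd of the bonds along a chain joining them (`isLSPath_of_mem_chainLattice`). So `A_C` is the
algebra of a saturated monoid, and `I_C` is prime. Existence reverses this: the algebra is realised
inside the product over all chains of copies of `K[ℚ^S]`.

Components: the paths outside a given homogeneous prime have pairwise comparable supports, so the
prime contains `I_C` for some maximal chain `C`; the paths concentrated at one point show that
distinct chains give incomparable or strictly nested varieties. Intersections: `I_{C ∩ D}` is
contained in `I_C + I_D`, and this passes to ideal sheaves chart by chart (`ker_map_le_sup`).

For the geometry of one `X_C` one replaces `S` by `C` (`IsDiscreteLSAlgebra.chain`). The chart where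
`j(p)` is invertible is `Spec K[N]`, with `N` the degree zero lattice vectors that are nonnegative
wherever `p` vanishes (`range_awayToMonomials`). If `p` has full support, `N` is the whole lattice
and the chart is the torus. Each chart is a monoid scheme receiving the torus homomorphically, so
the translations glue to an action (`exists_extends`). Since `N` is cut out by linear inequalities,
`K[N]` is the intersection of the Laurent polynomials with the integers of weight valuations, hence
integrally closed (`isIntegrallyClosed_monoidAlgebra`). -/

set_option linter.unusedSectionVars false

namespace LSAlg

/-! ### Bonds -/

section Bonds

variable {S : Type u} [PartialOrder S] {b : S → S → ℕ}

theorem IsCompleteChain.singleton (σ : S) : IsCompleteChain σ σ [σ] := by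
  simp [IsCompleteChain]

theorem IsCompleteChain.cons {σ ρ τ : S} {l : List S} (h : σ ⋖ ρ) (hl : IsCompleteChain ρ τ l) :
    IsCompleteChain σ τ (σ :: l) := by
  obtain ⟨h1, h2, h3⟩ := hl
  cases l with
  | nil => simp at h2
  | cons a t =>
    simp only [List.head?_cons, Option.some.injEq] at h2
    subst h2
    exact ⟨List.isChain_cons_cons.2 ⟨h, h1⟩, rfl, by simpa [List.getLast?_cons_cons] using h3⟩

theorem IsCompleteChain.uncons {σ τ a c : S} {t : List S} (h : IsCompleteChain σ τ (a :: c :: t)) :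
    a = σ ∧ σ ⋖ c ∧ IsCompleteChain c τ (c :: t) := by
  obtain ⟨h1, h2, h3⟩ := h
  simp only [List.head?_cons, Option.some.injEq] at h2
  subst h2
  rw [List.isChain_cons_cons] at h1
  exact ⟨rfl, h1.1, h1.2, rfl, by simpa [List.getLast?_cons_cons] using h3⟩

theorem IsCompleteChain.le {σ τ : S} {l : List S} (h : IsCompleteChain σ τ l) : σ ≤ τ := by
  induction l generalizing σ with
  | nil => simp [IsCompleteChain] at h
  | cons a t ih =>
    cases t with
    | nil =>
      obtain ⟨-, h2, h3⟩ := h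
      simp only [List.head?_cons, Option.some.injEq, List.getLast?_singleton] at h2 h3
      exact (h2.symm.trans h3).le
    | cons c t =>
      obtain ⟨-, h1, h2⟩ := h.uncons
      exact h1.le.trans (ih h2)

theorem exists_covBy_le [Finite S] {σ τ : S} (h : σ < τ) : ∃ ρ, σ ⋖ ρ ∧ ρ ≤ τ := by
  obtain ⟨ρ, hρ, hmin⟩ := (Set.toFinite {ρ : S | σ < ρ ∧ ρ ≤ τ}).exists_minimal ⟨τ, h, le_rfl⟩
  refine ⟨ρ, ⟨hρ.1, fun x h1 h2 => ?_⟩, hρ.2⟩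
  exact h2.not_ge (hmin ⟨h1, h2.le.trans hρ.2⟩ h2.le)

/-- Finiteness makes `>` well founded, so one may descend from `τ` one cover at a time; this
replaces inductions over explicit complete chains. -/
theorem le_induction_cov [Finite S] {τ : S} {P : S → Prop} (h0 : P τ)
    (h1 : ∀ σ ρ, σ ⋖ ρ → ρ ≤ τ → P ρ → P σ) {σ : S} (h : σ ≤ τ) : P σ := by
  induction σ using (wellFounded_gt (α := S)).induction with
  | _ σ ih =>
    rcases h.eq_or_lt with rfl | hlt
    · exact h0
    · obtain ⟨ρ, hρ, hle⟩ := exists_covBy_le hlt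
      exact h1 σ ρ hρ hle (ih ρ hρ.lt hle)

theorem exists_isCompleteChain [Finite S] {σ τ : S} (h : σ ≤ τ) : ∃ l, IsCompleteChain σ τ l :=
  le_induction_cov (P := fun σ => ∃ l, IsCompleteChain σ τ l) ⟨_, .singleton τ⟩
    (fun _ _ hc _ ⟨_, hl⟩ => ⟨_, hl.cons hc⟩) h

theorem IsPosetWithBonds.extBond_eq (hb : IsPosetWithBonds b) {σ τ : S} {l : List S}
    (hl : IsCompleteChain σ τ l) : extBond b σ τ = chainGcd b l := by
  have h : ∃ l : List S, IsCompleteChain σ τ l := ⟨l, hl⟩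
  rw [extBond, dif_pos h]
  exact hb.gcd_eq σ τ _ _ h.choose_spec hl

/-- The gcd of the empty family is 0, the neutral element for gcd. This lets `extBond_gcd` include
the degenerate cases of equal end points. -/
theorem IsPosetWithBonds.extBond_self (hb : IsPosetWithBonds b) (σ : S) : extBond b σ σ = 0 :=
  hb.extBond_eq (.singleton σ)

theorem IsPosetWithBonds.extBond_cons [Finite S] (hb : IsPosetWithBonds b) {σ ρ τ : S}
    (h : σ ⋖ ρ) (h' : ρ ≤ τ) : extBond b σ τ = Nat.gcd (b σ ρ) (extBond b ρ τ) := by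
  obtain ⟨l, hl⟩ := exists_isCompleteChain h'
  rw [hb.extBond_eq hl, hb.extBond_eq (hl.cons h)]
  cases l with
  | nil => simp [IsCompleteChain] at hl
  | cons a t =>
    have := hl.2.1
    simp only [List.head?_cons, Option.some.injEq] at this
    subst this
    rfl

/-- Any complete chain computes the bond, in particular one through `ρ`. Divisibility of bonds,
restriction to chains and the lattice description of paths all come from this formula. -/
theorem IsPosetWithBonds.extBond_gcd [Finite S] (hb : IsPosetWithBonds b) {σ ρ τ : S}
    (h : σ ≤ ρ) (h' : ρ ≤ τ) :
    extBond b σ τ = Nat.gcd (extBond b σ ρ) (extBond b ρ τ) := by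
  refine le_induction_cov (τ := ρ)
    (P := fun σ => extBond b σ τ = Nat.gcd (extBond b σ ρ) (extBond b ρ τ)) ?_ ?_ h
  · simp [hb.extBond_self]
  · intro σ ρ' hc hle ih
    rw [hb.extBond_cons hc (hle.trans h'), hb.extBond_cons hc hle, ih, Nat.gcd_assoc]

theorem IsPosetWithBonds.extBond_pos [Finite S] (hb : IsPosetWithBonds b) {σ τ : S}
    (h : σ < τ) : 0 < extBond b σ τ := by
  obtain ⟨ρ, hρ, hle⟩ := exists_covBy_le h
  rw [hb.extBond_cons hρ hle]
  exact Nat.gcd_pos_of_pos_left _ (hb.pos _ _ hρ)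

theorem IsPosetWithBonds.extBond_dvd [Finite S] (hb : IsPosetWithBonds b) {σ' σ τ τ' : S}
    (h1 : σ' ≤ σ) (h2 : σ ≤ τ) (h3 : τ ≤ τ') : extBond b σ' τ' ∣ extBond b σ τ := by
  rw [hb.extBond_gcd h1 (h2.trans h3), hb.extBond_gcd h2 h3]
  exact (Nat.gcd_dvd_right _ _).trans (Nat.gcd_dvd_left _ _)

/-! #### Restriction to a chain -/

/-- In a totally ordered set an element has at most one cover. Gradedness and independence of the
gcd are then automatic for the induced bonds on `C`. -/
theorem isCompleteChain_unique_of_isChain {C : Set S} (hC : IsChain (· ≤ ·) C) {σ τ : C}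
    {l l' : List C} (hl : IsCompleteChain σ τ l) (hl' : IsCompleteChain σ τ l') : l = l' := by
  have hcov : ∀ {x y z : C}, x ⋖ y → x ⋖ z → y = z := by
    intro x y z hy hz
    rcases hC.total y.2 z.2 with h | h
    · rcases (show y ≤ z from h).eq_or_lt with h | h
      · exact h
      · exact absurd h (hz.2 hy.1)
    · rcases (show z ≤ y from h).eq_or_lt with h | h
      · exact h.symm
      · exact absurd h (hy.2 hz.1)
  induction l generalizing σ l' with
  | nil => simp [IsCompleteChain] at hl
  | cons a t ih =>
    cases l' with
    | nil => simp [IsCompleteChain] at hl'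
    | cons a' t' =>
      have h1 := hl.2.1
      have h2 := hl'.2.1
      simp only [List.head?_cons, Option.some.injEq] at h1 h2
      subst h1
      subst h2
      cases t with
      | nil =>
        cases t' with
        | nil => rfl
        | cons c' t' =>
          obtain ⟨-, h3, h4⟩ := hl'.uncons
          have := hl.2.2
          simp only [List.getLast?_singleton, Option.some.injEq] at this
          exact absurd (h3.lt.trans_le h4.le) (by simp [this])
      | cons c t =>
        cases t' with
        | nil =>
          obtain ⟨-, h3, h4⟩ := hl.uncons
          have := hl'.2.2
          simp only [List.getLast?_singleton, Option.some.injEq] at this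
          exact absurd (h3.lt.trans_le h4.le) (by simp [this])
        | cons c' t' =>
          obtain ⟨-, h3, h4⟩ := hl.uncons
          obtain ⟨-, h3', h4'⟩ := hl'.uncons
          have := hcov h3 h3'
          subst this
          rw [ih h4 h4']

/-- A cover in `C` need not be a cover in `S`, but the induced bond is already the extended one, and
`extBond_gcd` telescopes along the chain. -/
theorem chainGcd_restrictBond [Finite S] (hb : IsPosetWithBonds b) {C : Set S} {σ τ : C}
    {l : List C} (hl : IsCompleteChain σ τ l) :
    chainGcd (restrictBond b C) l = extBond b σ τ := by
  induction l generalizing σ with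
  | nil => simp [IsCompleteChain] at hl
  | cons a t ih =>
    cases t with
    | nil =>
      obtain ⟨-, h2, h3⟩ := hl
      simp only [List.head?_cons, Option.some.injEq, List.getLast?_singleton] at h2 h3
      subst h2
      subst h3
      simp [chainGcd, hb.extBond_self]
    | cons c t =>
      obtain ⟨h0, h1, h2⟩ := hl.uncons
      subst h0
      rw [chainGcd, ih h2, restrictBond, ← hb.extBond_gcd h1.le h2.le]

theorem IsPosetWithBonds.restrictBond [Finite S] (hb : IsPosetWithBonds b) {C : Set S}
    (hC : IsChain (· ≤ ·) C) : IsPosetWithBonds (restrictBond b C) where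
  graded _ _ _ _ h h' := congrArg _ (isCompleteChain_unique_of_isChain hC h h')
  pos _ _ h := hb.extBond_pos h.lt
  gcd_eq _ _ _ _ h h' := by rw [isCompleteChain_unique_of_isChain hC h h']

theorem extBond_restrictBond [Finite S] (hb : IsPosetWithBonds b) {C : Set S} {σ τ : C}
    (h : σ ≤ τ) : extBond (restrictBond b C) σ τ = extBond b σ τ := by
  have h' := exists_isCompleteChain h
  rw [extBond, dif_pos h']
  exact chainGcd_restrictBond hb h'.choose_spec

end Bonds

/-! ### Partial sums -/

section PartialSums

/-- The sum of the values of `π` on `s`. -/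
noncomputable def cum {S : Type u} (s : Set S) (π : S → ℚ) : ℚ := ∑ᶠ ρ ∈ s, π ρ

variable {S : Type u}

theorem cum_univ (π : S → ℚ) : cum Set.univ π = ∑ᶠ ρ, π ρ := by simp [cum]

theorem cum_congr {s t : Set S} {π : S → ℚ} (h : ∀ ρ, π ρ ≠ 0 → (ρ ∈ s ↔ ρ ∈ t)) :
    cum s π = cum t π := by
  have : s ∩ Function.support π = t ∩ Function.support π := by
    ext ρ
    simp only [Set.mem_inter_iff, Function.mem_support]
    have := h ρ
    tauto
  unfold cum
  rw [← finsum_mem_inter_support, this, finsum_mem_inter_support]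

theorem cum_zero (s : Set S) : cum s (0 : S → ℚ) = 0 := by simp [cum]

theorem cum_eq_zero {s : Set S} {π : S → ℚ} (h : ∀ ρ ∈ s, π ρ = 0) : cum s π = 0 := by
  unfold cum
  rw [finsum_mem_congr rfl h, finsum_mem_zero]

theorem cum_nonneg (s : Set S) {π : S → ℚ} (h : ∀ σ, 0 ≤ π σ) : 0 ≤ cum s π :=
  finsum_nonneg fun _ => finsum_nonneg fun _ => h _

theorem cum_single (s : Set S) [DecidableEq S] [DecidablePred (· ∈ s)] (σ : S) (c : ℚ) :
    cum s (Pi.single σ c) = if σ ∈ s then c else 0 := by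
  unfold cum
  split_ifs with h
  · rw [finsum_eq_single _ σ fun x hx => by simp [hx]]
    simp [h]
  · refine cum_eq_zero fun ρ hρ => ?_
    rw [Pi.single_eq_of_ne]
    rintro rfl
    exact h hρ

variable [Finite S]

theorem cum_add (s : Set S) (p q : S → ℚ) : cum s (p + q) = cum s p + cum s q :=
  finsum_mem_add_distrib s.toFinite

theorem cum_neg (s : Set S) (p : S → ℚ) : cum s (-p) = -cum s p := by
  have := cum_add s p (-p)
  rw [add_neg_cancel, cum_zero] at this
  linarith

theorem cum_sub (s : Set S) (p q : S → ℚ) : cum s (p - q) = cum s p - cum s q := by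
  rw [sub_eq_add_neg, cum_add, cum_neg, sub_eq_add_neg]

theorem cum_smul (s : Set S) (c : ℚ) (p : S → ℚ) : cum s (c • p) = c * cum s p := by
  unfold cum
  exact ((DistribSMul.toAddMonoidHom ℚ c).map_finsum_mem p s.toFinite).symm

theorem cum_list_sum (s : Set S) (l : List (S → ℚ)) : cum s l.sum = (l.map (cum s)).sum := by
  induction l with
  | nil => simp [cum_zero]
  | cons a l ih => simp [cum_add, ih]

theorem cum_insert {s : Set S} {σ : S} (h : σ ∉ s) (π : S → ℚ) :
    cum (insert σ s) π = π σ + cum s π :=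
  finsum_mem_insert _ h s.toFinite

theorem cum_mono {s t : Set S} (hst : s ⊆ t) {π : S → ℚ} (h : ∀ σ, 0 ≤ π σ) :
    cum s π ≤ cum t π := by
  have : cum t π = cum s π + cum (t \ s) π := by
    unfold cum
    rw [← finsum_mem_union Set.disjoint_sdiff_right s.toFinite (Set.toFinite _),
      Set.union_sdiff_cancel hst]
  linarith [cum_nonneg (t \ s) h]

theorem cum_pos {s : Set S} {π : S → ℚ} (h : ∀ σ, 0 ≤ π σ) {σ : S} (hσ : σ ∈ s) (h0 : π σ ≠ 0) :
    0 < cum s π := by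
  have h1 := cum_mono (Set.singleton_subset_iff.2 hσ) h
  have h2 : cum {σ} π = π σ := by simp [cum]
  have := (h σ).lt_of_ne' h0
  linarith

variable [PartialOrder S]

theorem cum_Iic (σ : S) (π : S → ℚ) : cum (Set.Iic σ) π = π σ + cum (Set.Iio σ) π := by
  rw [← Set.Iio_insert, cum_insert (by simp)]

end PartialSums

end LSAlg

namespace LSAlg

/-! ### Integrality of multiples of a rational number -/

section Integrality

/-- Bézout: the gcd is an integral combination of `a` and `c`. -/
theorem exists_int_gcd_mul {a c : ℕ} {x : ℚ} (h : ∃ m : ℤ, (a : ℚ) * x = m)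
    (h' : ∃ m : ℤ, (c : ℚ) * x = m) : ∃ m : ℤ, ((Nat.gcd a c : ℕ) : ℚ) * x = m := by
  obtain ⟨m, hm⟩ := h
  obtain ⟨n, hn⟩ := h'
  refine ⟨m * Nat.gcdA a c + n * Nat.gcdB a c, ?_⟩
  have := congrArg (fun z : ℤ => (z : ℚ) * x) (Nat.gcd_eq_gcd_ab a c)
  push_cast at this ⊢
  rw [this, ← hm, ← hn]
  ring

theorem exists_int_mul_of_dvd {a c : ℕ} {x : ℚ} (hd : a ∣ c) (h : ∃ m : ℤ, (a : ℚ) * x = m) :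
    ∃ m : ℤ, (c : ℚ) * x = m := by
  obtain ⟨k, rfl⟩ := hd
  obtain ⟨m, hm⟩ := h
  exact ⟨k * m, by push_cast; rw [← hm]; ring⟩

theorem exists_nat_of_exists_int {x : ℚ} (hx : 0 ≤ x) (h : ∃ m : ℤ, x = m) :
    ∃ m : ℕ, x = m := by
  obtain ⟨m, rfl⟩ := h
  refine ⟨m.toNat, ?_⟩
  have : 0 ≤ m := by exact_mod_cast hx
  exact_mod_cast (Int.toNat_of_nonneg this).symm

end Integrality

/-! ### Partial sums and addition of LS-paths -/

section LSPaths

variable {S : Type u} [PartialOrder S] [Finite S] {b : S → S → ℕ} {r : ℕ} {π : S → ℚ}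

theorem IsLSPath.cum_univ (h : IsLSPath b r π) : cum Set.univ π = r := by
  rw [LSAlg.cum_univ, h.total]

theorem IsLSPath.integral' (h : IsLSPath b r π) {σ τ : S} (hσ : π σ ≠ 0) (hτ : π τ ≠ 0)
    (hlt : σ < τ) (hn : ∀ ρ, π ρ ≠ 0 → ¬ (σ < ρ ∧ ρ < τ)) :
    ∃ m : ℤ, (extBond b σ τ : ℚ) * cum (Set.Iic σ) π = m := by
  obtain ⟨m, hm⟩ := h.integral σ hσ τ hτ hlt hn
  exact ⟨m, by exact_mod_cast hm⟩

/-- Nonnegativity of the partial sums turns integers into natural numbers, so all later arguments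
can use integers, where subtraction and Bézout are available. -/
theorem IsLSPath.of_int (h0 : ∀ σ, 0 ≤ π σ) (hc : IsChain (· ≤ ·) (Function.support π))
    (hi : ∀ σ, π σ ≠ 0 → ∀ τ, π τ ≠ 0 → σ < τ → (∀ ρ, π ρ ≠ 0 → ¬ (σ < ρ ∧ ρ < τ)) →
      ∃ m : ℤ, (extBond b σ τ : ℚ) * cum (Set.Iic σ) π = m)
    (ht : cum Set.univ π = r) : IsLSPath b r π where
  nonneg := h0
  isChain := hc
  integral σ hσ τ hτ hlt hn :=
    exists_nat_of_exists_int (mul_nonneg (Nat.cast_nonneg _) (cum_nonneg _ h0))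
      (hi σ hσ τ hτ hlt hn)
  total := by rw [← LSAlg.cum_univ, ht]

/-- The integrality condition holds for any two elements between which there is no element
of the support. -/
theorem IsLSPath.extBond_mul_cum (hb : IsPosetWithBonds b) (h : IsLSPath b r π) {σ τ : S}
    (hlt : σ < τ) (hσ : ∀ ρ, π ρ ≠ 0 → ρ ≤ σ ∨ σ ≤ ρ) (hτ : ∀ ρ, π ρ ≠ 0 → ρ ≤ τ ∨ τ ≤ ρ)
    (hn : ∀ ρ, π ρ ≠ 0 → ¬ (σ < ρ ∧ ρ < τ)) :
    ∃ m : ℤ, (extBond b σ τ : ℚ) * cum (Set.Iic σ) π = m := by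
  have hdich : ∀ ρ, π ρ ≠ 0 → ρ ≤ σ ∨ τ ≤ ρ := by
    intro ρ hρ
    rcases hσ ρ hρ with h1 | h1
    · exact .inl h1
    · rcases h1.eq_or_lt with rfl | h1
      · exact .inl le_rfl
      · rcases hτ ρ hρ with h2 | h2
        · rcases h2.eq_or_lt with rfl | h2
          · exact .inr le_rfl
          · exact absurd ⟨h1, h2⟩ (hn ρ hρ)
        · exact .inr h2
  -- The support splits into a part below `σ` and a part above `τ`. If both are nonempty, their
  -- facing end points `σ'`, `τ'` are consecutive and the bond of the larger interval divides that
  -- of `σ`, `τ`. Otherwise the partial sum is the full degree or zero.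
  by_cases hA : ∃ ρ, π ρ ≠ 0 ∧ ρ ≤ σ
  · by_cases hB : ∃ ρ, π ρ ≠ 0 ∧ τ ≤ ρ
    · obtain ⟨σ', ⟨hσ'0, hσ'1⟩, hmax⟩ :=
        (Set.toFinite {ρ : S | π ρ ≠ 0 ∧ ρ ≤ σ}).exists_maximal hA
      obtain ⟨τ', ⟨hτ'0, hτ'1⟩, hmin⟩ :=
        (Set.toFinite {ρ : S | π ρ ≠ 0 ∧ τ ≤ ρ}).exists_minimal hB
      have hlt' : σ' < τ' := hσ'1.trans_lt (hlt.trans_le hτ'1)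
      have key := h.integral' hσ'0 hτ'0 hlt' fun ρ hρ hh => by
        rcases hdich ρ hρ with h1 | h1
        · exact hh.1.not_ge (hmax ⟨hρ, h1⟩ hh.1.le)
        · exact hh.2.not_ge (hmin ⟨hρ, h1⟩ hh.2.le)
      have hcum : cum (Set.Iic σ) π = cum (Set.Iic σ') π := by
        refine cum_congr fun ρ hρ => ⟨fun h1 => ?_, fun h1 => le_trans h1 hσ'1⟩
        rcases h.isChain.total hρ hσ'0 with h2 | h2
        · exact h2
        · exact hmax ⟨hρ, h1⟩ h2
      rw [hcum]
      exact exists_int_mul_of_dvd (hb.extBond_dvd hσ'1 hlt.le hτ'1) key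
    · push Not at hB
      have : cum (Set.Iic σ) π = r := by
        rw [← h.cum_univ]
        refine cum_congr fun ρ hρ => ⟨fun _ => trivial, fun _ => ?_⟩
        exact (hdich ρ hρ).resolve_right (hB ρ hρ)
      exact ⟨extBond b σ τ * r, by rw [this]; push_cast; rfl⟩
  · push Not at hA
    refine ⟨0, ?_⟩
    rw [cum_eq_zero fun ρ hρ => ?_]
    · simp
    · by_contra h0
      exact hA ρ h0 hρ

theorem support_add_of_nonneg {p q : S → ℚ} (hp : ∀ σ, 0 ≤ p σ) (hq : ∀ σ, 0 ≤ q σ) (σ : S) :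
    (p + q) σ ≠ 0 ↔ p σ ≠ 0 ∨ q σ ≠ 0 := by
  have h1 := hp σ
  have h2 := hq σ
  constructor
  · intro h
    by_contra! h'
    exact h (by simp [h'])
  · rintro (h | h) h' <;> simp only [Pi.add_apply] at h' <;> exact h (by linarith)

/-- Consecutive elements of the support of the sum need not belong to the support of either summand,
which is why integrality is needed in the form of `extBond_mul_cum`. -/
theorem IsLSPath.add (hb : IsPosetWithBonds b) {s : ℕ} {p q : S → ℚ} (hp : IsLSPath b r p)
    (hq : IsLSPath b s q) (hc : ComparableSupports p q) : IsLSPath b (r + s) (p + q) := by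
  obtain ⟨C, hC, hpC, hqC⟩ := hc
  have hsup := support_add_of_nonneg hp.nonneg hq.nonneg
  have hmem : ∀ σ, (p + q) σ ≠ 0 → σ ∈ C := fun σ h =>
    ((hsup σ).1 h).elim (fun h => hpC h) fun h => hqC h
  refine .of_int (fun σ => add_nonneg (hp.nonneg σ) (hq.nonneg σ)) (hC.mono hmem) ?_ ?_
  · intro σ hσ τ hτ hlt hn
    have hσ := hmem σ hσ
    have hτ := hmem τ hτ
    obtain ⟨m, hm⟩ := hp.extBond_mul_cum hb hlt (fun ρ hρ => hC.total (hpC hρ) hσ)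
      (fun ρ hρ => hC.total (hpC hρ) hτ) (fun ρ hρ => hn ρ ((hsup ρ).2 (.inl hρ)))
    obtain ⟨n, hn'⟩ := hq.extBond_mul_cum hb hlt (fun ρ hρ => hC.total (hqC hρ) hσ)
      (fun ρ hρ => hC.total (hqC hρ) hτ) (fun ρ hρ => hn ρ ((hsup ρ).2 (.inr hρ)))
    exact ⟨m + n, by rw [cum_add, mul_add, hm, hn']; push_cast; rfl⟩
  · rw [cum_add, hp.cum_univ, hq.cum_univ]; push_cast; rfl

theorem IsLSPath.zero : IsLSPath b 0 (0 : S → ℚ) :=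
  .of_int (fun _ => le_rfl) (by simp [Function.support_zero]) (by simp) (by simp [cum_zero])

theorem IsLSPath.eq_zero (h : IsLSPath b 0 π) : π = 0 := by
  ext σ
  by_contra h0
  have := cum_pos h.nonneg (Set.mem_univ σ) h0
  rw [h.cum_univ] at this
  simp at this

theorem IsLSPath.exists_ne_zero (h : IsLSPath b r π) (hr : r ≠ 0) : ∃ σ, π σ ≠ 0 := by
  by_contra! h0
  have : cum Set.univ π = 0 := cum_eq_zero fun ρ _ => h0 ρ
  rw [h.cum_univ] at this
  exact hr (by exact_mod_cast this)

theorem IsLSPath.degree_eq {s : ℕ} (h : IsLSPath b r π) (h' : IsLSPath b s π) : r = s := by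
  have := h.cum_univ.symm.trans h'.cum_univ
  exact_mod_cast this

theorem isLSPath_single [DecidableEq S] (σ : S) : IsLSPath b 1 (Pi.single σ (1 : ℚ)) := by
  classical
  have hs : ∀ τ, (Pi.single σ (1 : ℚ) : S → ℚ) τ ≠ 0 → τ = σ := by
    intro τ h
    by_contra h'
    exact h (Pi.single_eq_of_ne h' _)
  refine .of_int (fun τ => ?_) ?_ ?_ ?_
  · by_cases h : τ = σ
    · subst h; simp
    · simp [Pi.single_eq_of_ne h]
  · intro x hx y hy hne
    exact absurd ((hs x hx).trans (hs y hy).symm) hne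
  · intro x hx y hy hlt
    exact absurd ((hs x hx).trans (hs y hy).symm) hlt.ne
  · rw [cum_single]; simp

end LSPaths

/-! ### Canonical forms -/

section CanonicalForm

variable {S : Type u} [PartialOrder S] [Finite S] {b : S → S → ℕ} {r : ℕ} {π : S → ℚ}

/-- The first factor of the canonical form of an LS-path. -/
noncomputable def firstFactor (π : S → ℚ) (σ : S) : ℚ :=
  min (cum (Set.Iic σ) π) 1 - min (cum (Set.Iio σ) π) 1

theorem firstFactor_nonneg (h0 : ∀ σ, 0 ≤ π σ) (σ : S) : 0 ≤ firstFactor π σ := by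
  have := cum_mono (Set.Iio_subset_Iic_self (a := σ)) h0
  exact sub_nonneg.2 (min_le_min_right _ this)

theorem firstFactor_le (h0 : ∀ σ, 0 ≤ π σ) (σ : S) : firstFactor π σ ≤ π σ := by
  have h := cum_Iic σ π
  have := h0 σ
  unfold firstFactor
  rw [h]
  rcases le_total (cum (Set.Iio σ) π) 1 with h1 | h1
  · rw [min_eq_left h1]
    linarith [min_le_left (π σ + cum (Set.Iio σ) π) 1]
  · rw [min_eq_right h1, min_eq_right (by linarith)]
    linarith

/-- The partial sums of the first factor over the sets that are downward closed in the support. -/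
theorem cum_firstFactor (h0 : ∀ σ, 0 ≤ π σ) (hc : IsChain (· ≤ ·) (Function.support π))
    {s : Set S} (hs : ∀ σ ∈ s, π σ ≠ 0 → ∀ τ, π τ ≠ 0 → τ ≤ σ → τ ∈ s) :
    cum s (firstFactor π) = min (cum s π) 1 := by
  have hff : ∀ σ, π σ = 0 → firstFactor π σ = 0 := fun σ h =>
    le_antisymm ((firstFactor_le h0 σ).trans h.le) (firstFactor_nonneg h0 σ)
  -- Induction on the number of support points in `s`: removing the largest one, `m`, the sum
  -- telescopes, since the sums of `π` over `s` and over `s` without `m` are those over `Iic m` and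
  -- `Iio m`.
  obtain ⟨n, hn⟩ : ∃ n, (s ∩ Function.support π).ncard = n := ⟨_, rfl⟩
  induction n generalizing s with
  | zero =>
    rw [Set.ncard_eq_zero] at hn
    have hz : ∀ ρ ∈ s, π ρ = 0 := fun ρ hρ => by
      by_contra h
      exact Set.notMem_empty ρ (hn ▸ ⟨hρ, h⟩)
    rw [cum_eq_zero hz, cum_eq_zero fun ρ hρ => hff ρ (hz ρ hρ)]
    simp
  | succ n ih =>
    have hne : (s ∩ Function.support π).Nonempty := by
      rw [← Set.ncard_pos]; omega
    obtain ⟨m, ⟨hms, hm0⟩, hmax⟩ := (Set.toFinite (s ∩ Function.support π)).exists_maximal hne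
    have hle : ∀ ρ ∈ s, π ρ ≠ 0 → ρ ≤ m := fun ρ hρ h => by
      rcases hc.total h hm0 with h1 | h1
      · exact h1
      · exact hmax ⟨hρ, h⟩ h1
    have e1 : cum s π = cum (Set.Iic m) π :=
      cum_congr fun ρ hρ => ⟨fun h => hle ρ h hρ, fun h => hs m hms hm0 ρ hρ h⟩
    have e2 : cum (s \ {m}) π = cum (Set.Iio m) π :=
      cum_congr fun ρ hρ => ⟨fun h => (hle ρ h.1 hρ).lt_of_ne h.2,
        fun h => ⟨hs m hms hm0 ρ hρ (le_of_lt h), ne_of_lt h⟩⟩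
    have e3 : cum s (firstFactor π) = firstFactor π m + cum (s \ {m}) (firstFactor π) := by
      rw [← cum_insert (by simp), Set.insert_sdiff_singleton, Set.insert_eq_of_mem hms]
    rw [e3, ih (s := s \ {m}), e1, e2, firstFactor]
    · ring
    · rintro σ ⟨hσ, hσm⟩ h τ hτ hτσ
      refine ⟨hs σ hσ h τ hτ hτσ, ?_⟩
      rintro rfl
      exact hσm (le_antisymm (hle σ hσ h) hτσ)
    · have : (s \ {m}) ∩ Function.support π = (s ∩ Function.support π) \ {m} := by
        ext x; simp only [Set.mem_inter_iff, Set.mem_sdiff]; tauto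
      rw [this, Set.ncard_sdiff_singleton_of_mem (show m ∈ s ∩ Function.support π from ⟨hms, hm0⟩), hn]
      rfl

/-- The first factor takes the lowest mass 1 of `π`, so its partial sums are those of `π` truncated
at 1. Where the truncation is effective the integrality condition is trivial; elsewhere it is
inherited from `π`. -/
theorem IsLSPath.firstFactor (h : IsLSPath b (r + 1) π) : IsLSPath b 1 (firstFactor π) := by
  have h0 := h.nonneg
  have hsub : ∀ σ, LSAlg.firstFactor π σ ≠ 0 → π σ ≠ 0 := fun σ h1 h2 =>
    h1 (le_antisymm ((firstFactor_le h0 σ).trans h2.le) (firstFactor_nonneg h0 σ))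
  refine .of_int (firstFactor_nonneg h0) (h.isChain.mono hsub) ?_ ?_
  · intro σ hσ τ hτ hlt hn
    rw [cum_firstFactor h0 h.isChain (s := Set.Iic σ) fun x hx _ y _ hyx => le_trans hyx hx]
    rcases le_total 1 (cum (Set.Iic σ) π) with h1 | h1
    · exact ⟨extBond b σ τ, by rw [min_eq_right h1]; simp⟩
    · rw [min_eq_left h1]
      refine h.integral' (hsub σ hσ) (hsub τ hτ) hlt fun ρ hρ hh => ?_
      by_cases hρ' : LSAlg.firstFactor π ρ = 0
      -- A support point of `π` missed by the first factor has mass at least 1 strictly below it.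
      -- The truncated sums are constant from there on, so the first factor would vanish at `τ`.
      · have h2 : 1 ≤ cum (Set.Iio ρ) π := by
          by_contra! h2
          rw [LSAlg.firstFactor, min_eq_left h2.le, cum_Iic, sub_eq_zero] at hρ'
          have h3 := (h0 ρ).lt_of_ne' hρ
          rcases min_cases (π ρ + cum (Set.Iio ρ) π) 1 with h4 | h4 <;> linarith
        have h3 : cum (Set.Iio ρ) π ≤ cum (Set.Iio τ) π :=
          cum_mono (Set.Iio_subset_Iio hh.2.le) h0
        have h4 : cum (Set.Iio τ) π ≤ cum (Set.Iic τ) π := cum_mono Set.Iio_subset_Iic_self h0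
        apply hτ
        rw [LSAlg.firstFactor, min_eq_right (by linarith), min_eq_right (by linarith), sub_self]
      · exact hn ρ hρ' hh
  · rw [cum_firstFactor h0 h.isChain (s := Set.univ) fun _ _ _ _ _ _ => trivial, h.cum_univ, min_eq_right]
    · simp
    · push_cast; linarith [Nat.cast_nonneg (α := ℚ) r]

/-- The remainder lives where the partial sums have passed 1; the point at which 1 is crossed may
lie in both supports. -/
theorem sub_firstFactor_ne_zero (h0 : ∀ σ, 0 ≤ π σ) {σ : S} :
    (π - firstFactor π) σ ≠ 0 ↔ π σ ≠ 0 ∧ 1 < cum (Set.Iic σ) π := by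
  simp only [Pi.sub_apply, firstFactor, cum_Iic]
  have := h0 σ
  have h1 := cum_nonneg (Set.Iio σ) h0
  constructor
  · intro h
    constructor
    · rintro h2; simp [h2] at h
    · by_contra! h2
      rw [min_eq_left h2, min_eq_left (by linarith)] at h
      exact h (by ring)
  · rintro ⟨h2, h3⟩ h4
    have h5 := this.lt_of_ne' h2
    rw [min_eq_right h3.le] at h4
    rcases min_cases (cum (Set.Iio σ) π) 1 with h6 | h6 <;> linarith

/-- On its support the partial sums of the remainder are those of `π` minus 1, which changes the
integrality condition by an integer. Support points of `π` above a support point of the remainder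
stay in the remainder, so consecutive pairs remain consecutive. -/
theorem IsLSPath.sub_firstFactor (h : IsLSPath b (r + 1) π) :
    IsLSPath b r (π - LSAlg.firstFactor π) := by
  have h0 := h.nonneg
  have hsub : ∀ σ, (π - LSAlg.firstFactor π) σ ≠ 0 → π σ ≠ 0 := fun σ h1 =>
    ((sub_firstFactor_ne_zero h0).1 h1).1
  refine .of_int (fun σ => sub_nonneg.2 (firstFactor_le h0 σ)) (h.isChain.mono hsub) ?_ ?_
  · intro σ hσ τ hτ hlt hn
    rw [cum_sub, cum_firstFactor h0 h.isChain (s := Set.Iic σ) fun x hx _ y _ hyx => le_trans hyx hx]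
    obtain ⟨h1, h2⟩ := (sub_firstFactor_ne_zero h0).1 hσ
    obtain ⟨m, hm⟩ := h.integral' h1 (hsub τ hτ) hlt fun ρ hρ hh =>
      hn ρ ((sub_firstFactor_ne_zero h0).2 ⟨hρ, h2.trans_le
        (cum_mono (Set.Iic_subset_Iic.2 hh.1.le) h0)⟩) hh
    exact ⟨m - extBond b σ τ, by rw [min_eq_right h2.le, mul_sub, hm]; push_cast; ring⟩
  · rw [cum_sub, cum_firstFactor h0 h.isChain (s := Set.univ) fun _ _ _ _ _ _ => trivial, h.cum_univ, min_eq_right]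
    · push_cast; ring
    · push_cast; linarith [Nat.cast_nonneg (α := ℚ) r]

theorem IsLSPath.firstFactor_le_sub (h : IsLSPath b (r + 1) π) {σ τ : S}
    (hσ : LSAlg.firstFactor π σ ≠ 0) (hτ : (π - LSAlg.firstFactor π) τ ≠ 0) : σ ≤ τ := by
  have h0 := h.nonneg
  have hσ' : π σ ≠ 0 := fun h2 =>
    hσ (le_antisymm ((firstFactor_le h0 σ).trans h2.le) (firstFactor_nonneg h0 σ))
  obtain ⟨hτ1, hτ2⟩ := (sub_firstFactor_ne_zero h0).1 hτ
  rcases h.isChain.total hσ' hτ1 with h1 | h1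
  · exact h1
  rcases h1.eq_or_lt with rfl | h1
  · exact le_rfl
  exfalso
  have h2 : cum (Set.Iic τ) π ≤ cum (Set.Iio σ) π := cum_mono (Set.Iic_subset_Iio.2 h1) h0
  have h3 : cum (Set.Iio σ) π ≤ cum (Set.Iic σ) π := cum_mono Set.Iio_subset_Iic_self h0
  apply hσ
  rw [LSAlg.firstFactor, min_eq_right (by linarith), min_eq_right (by linarith), sub_self]

/-- Standardness of neighbours implies standardness of all pairs: the relation is transitive because
a path of degree one has nonempty support. -/
theorem isStandard_cons {p : LSPath b 1} {l : List (LSPath b 1)} :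
    IsStandard (p :: l) ↔
      (∀ q ∈ l, ∀ σ, p.1 σ ≠ 0 → ∀ τ, q.1 τ ≠ 0 → σ ≤ τ) ∧ IsStandard l := by
  have htrans : Trans (fun p q : LSPath b 1 => ∀ σ ∈ Function.support p.1,
      ∀ τ ∈ Function.support q.1, σ ≤ τ) (fun p q : LSPath b 1 => ∀ σ ∈ Function.support p.1,
      ∀ τ ∈ Function.support q.1, σ ≤ τ) (fun p q : LSPath b 1 => ∀ σ ∈ Function.support p.1,
      ∀ τ ∈ Function.support q.1, σ ≤ τ) := ⟨fun {p q r} h1 h2 σ hσ τ hτ => by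
    obtain ⟨ρ, hρ⟩ := q.2.exists_ne_zero one_ne_zero
    exact (h1 σ hσ ρ hρ).trans (h2 ρ hρ τ hτ)⟩
  unfold IsStandard
  rw [List.isChain_iff_pairwise, List.isChain_iff_pairwise, List.pairwise_cons]
  rfl

theorem cum_list_pos {l : List (LSPath b 1)} {s : Set S}
    (h : 0 < cum s (l.map Subtype.val).sum) : ∃ q ∈ l, ∃ τ ∈ s, q.1 τ ≠ 0 := by
  by_contra! h'
  rw [cum_list_sum, List.map_map, List.sum_eq_zero] at h
  · exact h.false
  · simp only [List.mem_map, Function.comp_apply, forall_exists_index, and_imp]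
    rintro _ q hq rfl
    exact cum_eq_zero fun ρ hρ => h' q hq ρ hρ

theorem list_sum_nonneg (l : List (LSPath b 1)) (σ : S) : 0 ≤ (l.map Subtype.val).sum σ := by
  induction l with
  | nil => simp
  | cons p l ih => simpa using add_nonneg (p.2.nonneg σ) ih

theorem list_sum_ne_zero {l : List (LSPath b 1)} {σ : S} :
    (l.map Subtype.val).sum σ ≠ 0 ↔ ∃ p ∈ l, p.1 σ ≠ 0 := by
  induction l with
  | nil => simp
  | cons p l ih =>
    rw [List.map_cons, List.sum_cons, support_add_of_nonneg p.2.nonneg (list_sum_nonneg l), ih]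
    simp

theorem cum_univ_list_sum (l : List (LSPath b 1)) :
    cum Set.univ (l.map Subtype.val).sum = l.length := by
  induction l with
  | nil => simp [cum_zero]
  | cons p l ih =>
    rw [List.map_cons, List.sum_cons, cum_add, ih, p.2.cum_univ]
    push_cast [List.length_cons]
    ring

theorem IsCanonicalForm.length_eq {l : List (LSPath b 1)} (hl : IsCanonicalForm l π)
    (h : IsLSPath b r π) : l.length = r := by
  have := cum_univ_list_sum l
  rw [hl.2, h.cum_univ] at this
  exact_mod_cast this.symm

/-- For a lower set `s`, either the tail has no mass in `s`, or `s` contains a point above all of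
the support of `p` and so the whole mass 1 of `p`. In both cases truncating the sum over `s` at 1
leaves the contribution of `p`. Uniqueness of canonical forms follows by peeling off heads. -/
theorem IsCanonicalForm.head_eq {p : LSPath b 1} {l : List (LSPath b 1)}
    (h : IsCanonicalForm (p :: l) π) : p.1 = LSAlg.firstFactor π := by
  obtain ⟨h1, rfl⟩ := h
  rw [isStandard_cons] at h1
  simp only [List.map_cons, List.sum_cons]
  have key : ∀ s : Set S, (∀ σ ∈ s, ∀ τ ≤ σ, τ ∈ s) →
      min (cum s (p.1 + (l.map Subtype.val).sum)) 1 = cum s p.1 := by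
    intro s hs
    rw [cum_add]
    have hR := cum_nonneg s (list_sum_nonneg l)
    have hP : cum s p.1 ≤ 1 := by
      have := cum_mono (Set.subset_univ s) p.2.nonneg
      rw [p.2.cum_univ] at this
      exact_mod_cast this
    rcases hR.eq_or_lt with h0 | h0
    · rw [← h0, add_zero, min_eq_left hP]
    · obtain ⟨q, hq, τ, hτs, hτ⟩ := cum_list_pos h0
      have : cum s p.1 = 1 := by
        rw [show (1 : ℚ) = ((1 : ℕ) : ℚ) by simp, ← p.2.cum_univ]
        exact cum_congr fun ρ hρ => ⟨fun _ => trivial, fun _ => hs τ hτs ρ (h1.1 q hq ρ hρ τ hτ)⟩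
      rw [this, min_eq_right (by linarith)]
  ext σ
  rw [LSAlg.firstFactor, key (Set.Iic σ) fun x hx y hyx => le_trans hyx hx,
    key (Set.Iio σ) fun x hx y hyx => lt_of_le_of_lt hyx hx, cum_Iic]
  ring

theorem IsCanonicalForm.unique {l l' : List (LSPath b 1)} (h : IsCanonicalForm l π)
    (h' : IsCanonicalForm l' π) : l = l' := by
  have hlen : l.length = l'.length := by
    have h1 := cum_univ_list_sum l
    have h2 := cum_univ_list_sum l'
    rw [h.2] at h1
    rw [h'.2, h1] at h2
    exact_mod_cast h2
  induction l generalizing l' π with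
  | nil => exact (List.length_eq_zero_iff.1 hlen.symm).symm
  | cons p l ih =>
    cases l' with
    | nil => simp at hlen
    | cons p' l' =>
      obtain rfl : p = p' := Subtype.ext (h.head_eq.trans h'.head_eq.symm)
      have e : (l'.map Subtype.val).sum = (l.map Subtype.val).sum := by
        have := h'.2.trans h.2.symm
        simpa using this
      rw [ih ⟨(isStandard_cons.1 h.1).2, rfl⟩ ⟨(isStandard_cons.1 h'.1).2, e⟩ (by simpa using hlen)]

theorem IsLSPath.exists_canonicalForm (h : IsLSPath b r π) :
    ∃ l : List (LSPath b 1), IsCanonicalForm l π := by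
  induction r generalizing π with
  | zero => exact ⟨[], by simp [IsStandard], by simp [h.eq_zero]⟩
  | succ r ih =>
    obtain ⟨l, hl⟩ := ih h.sub_firstFactor
    refine ⟨⟨_, h.firstFactor⟩ :: l, isStandard_cons.2 ⟨fun q hq σ hσ τ hτ => ?_, hl.1⟩, ?_⟩
    · refine h.firstFactor_le_sub hσ ?_
      rw [← hl.2]
      exact list_sum_ne_zero.2 ⟨q, hq, hτ⟩
    · rw [List.map_cons, List.sum_cons, hl.2, add_sub_cancel]

end CanonicalForm
end LSAlg

namespace LSAlg

/-! ### LS-paths supported on a chain -/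

section Chain

variable {S : Type u} [PartialOrder S] [Finite S] {b : S → S → ℕ} {r : ℕ}

theorem cum_extend (C : Set S) (s : Set S) (π : C → ℚ) :
    cum s (Function.extend Subtype.val π 0) = cum (Subtype.val ⁻¹' s) π := by
  have h1 : cum s (Function.extend Subtype.val π 0) =
      cum (Subtype.val '' (Subtype.val ⁻¹' s : Set C)) (Function.extend Subtype.val π 0) := by
    refine cum_congr fun ρ hρ => ?_
    rw [Subtype.image_preimage_coe]
    have : ρ ∈ C := by
      by_contra h
      rw [Function.extend_apply' _ _ _ (by rintro ⟨x, rfl⟩; exact h x.2)] at hρ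
      exact hρ rfl
    simp [this]
  rw [h1]
  unfold cum
  rw [finsum_mem_image Subtype.val_injective.injOn]
  simp only [Subtype.val_injective.extend_apply]

theorem extend_of_notMem {C : Set S} (π : C → ℚ) {σ : S} (h : σ ∉ C) :
    Function.extend Subtype.val π 0 σ = 0 :=
  Function.extend_apply' _ _ _ (by rintro ⟨x, rfl⟩; exact h x.2)

theorem extend_coe {C : Set S} (π : C → ℚ) (σ : C) :
    Function.extend Subtype.val π 0 (σ : S) = π σ :=
  Subtype.val_injective.extend_apply π 0 σ

theorem extend_restrict {C : Set S} {π : S → ℚ} (h : ∀ σ, π σ ≠ 0 → σ ∈ C) :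
    Function.extend Subtype.val (fun σ : C => π σ) 0 = π := by
  ext σ
  by_cases hσ : σ ∈ C
  · exact extend_coe (fun σ : C => π σ) ⟨σ, hσ⟩
  · rw [extend_of_notMem _ hσ]
    by_contra h0
    exact hσ (h σ (Ne.symm h0))

theorem mem_of_extend_ne_zero {C : Set S} {π : C → ℚ} {σ : S}
    (h : Function.extend Subtype.val π 0 σ ≠ 0) : σ ∈ C := by
  by_contra h'
  exact h (extend_of_notMem π h')

theorem isLSPath_extend_iff (hb : IsPosetWithBonds b) {C : Set S} (hC : IsChain (· ≤ ·) C)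
    {π : C → ℚ} :
    IsLSPath b r (Function.extend Subtype.val π 0) ↔ IsLSPath (restrictBond b C) r π := by
  have hcum : ∀ σ : C, cum (Set.Iic (σ : S)) (Function.extend Subtype.val π 0) =
      cum (Set.Iic σ) π := fun σ => cum_extend C _ π
  constructor
  · intro h
    refine .of_int (fun σ => ?_) (fun x _ y _ _ => hC.total x.2 y.2) ?_ ?_
    · rw [← extend_coe π σ]; exact h.nonneg σ
    · intro σ hσ τ hτ hlt hn
      rw [extBond_restrictBond hb hlt.le, ← hcum]
      rw [← extend_coe π] at hσ hτ
      refine h.integral' hσ hτ hlt fun ρ hρ hh => ?_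
      have hρC := mem_of_extend_ne_zero hρ
      rw [extend_coe π ⟨ρ, hρC⟩] at hρ
      exact hn _ hρ hh
    · have := cum_extend C Set.univ π
      rw [Set.preimage_univ, h.cum_univ] at this
      exact this.symm
  · intro h
    refine .of_int (fun σ => ?_) (hC.mono fun σ hσ => mem_of_extend_ne_zero hσ) ?_ ?_
    · by_cases hσ : σ ∈ C
      · rw [extend_coe π ⟨σ, hσ⟩]; exact h.nonneg _
      · rw [extend_of_notMem π hσ]
    · intro σ hσ τ hτ hlt hn
      lift σ to C using mem_of_extend_ne_zero hσ
      lift τ to C using mem_of_extend_ne_zero hτ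
      rw [extend_coe] at hσ hτ
      rw [hcum, ← extBond_restrictBond hb (le_of_lt hlt)]
      refine h.integral' hσ hτ hlt fun ρ hρ hh => ?_
      rw [← extend_coe π] at hρ
      exact hn ρ hρ hh
    · rw [cum_extend, Set.preimage_univ, h.cum_univ]

variable (b) in
/-- The lattice generated by the LS-paths with support in the chain `C`. -/
def chainLattice (C : Set S) : AddSubgroup (S → ℚ) where
  -- Integrality is imposed at consecutive elements of `C`, not of the support of `u`; this makes
  -- the conditions additive.
  carrier := {u | (∀ σ, u σ ≠ 0 → σ ∈ C) ∧ (∃ m : ℤ, cum Set.univ u = m) ∧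
    ∀ σ ∈ C, ∀ τ ∈ C, σ < τ → (∀ ρ ∈ C, ¬ (σ < ρ ∧ ρ < τ)) →
      ∃ m : ℤ, (extBond b σ τ : ℚ) * cum (Set.Iic σ) u = m}
  zero_mem' := ⟨fun σ h => absurd rfl h, ⟨0, by simp [cum_zero]⟩, fun _ _ _ _ _ _ =>
    ⟨0, by simp [cum_zero]⟩⟩
  add_mem' := by
    rintro u v ⟨h1, ⟨m, h2⟩, h3⟩ ⟨h1', ⟨m', h2'⟩, h3'⟩
    refine ⟨fun σ h => ?_, ⟨m + m', by rw [cum_add, h2, h2']; push_cast; rfl⟩,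
      fun σ hσ τ hτ hlt hn => ?_⟩
    · by_contra hσ
      refine h ?_
      rw [Pi.add_apply, not_imp_comm.1 (h1 σ) hσ, not_imp_comm.1 (h1' σ) hσ, add_zero]
    · obtain ⟨m, hm⟩ := h3 σ hσ τ hτ hlt hn
      obtain ⟨n, hn⟩ := h3' σ hσ τ hτ hlt hn
      exact ⟨m + n, by rw [cum_add, mul_add, hm, hn]; push_cast; rfl⟩
  neg_mem' := by
    rintro u ⟨h1, ⟨m, h2⟩, h3⟩
    refine ⟨fun σ h => h1 σ (by simpa using h), ⟨-m, by rw [cum_neg, h2]; push_cast; rfl⟩,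
      fun σ hσ τ hτ hlt hn => ?_⟩
    obtain ⟨m, hm⟩ := h3 σ hσ τ hτ hlt hn
    exact ⟨-m, by rw [cum_neg, mul_neg, hm]; push_cast; rfl⟩

theorem IsLSPath.mem_chainLattice (hb : IsPosetWithBonds b) {C : Set S} (hC : IsChain (· ≤ ·) C)
    {π : S → ℚ} (h : IsLSPath b r π) (hπ : ∀ σ, π σ ≠ 0 → σ ∈ C) : π ∈ chainLattice b C :=
  ⟨hπ, ⟨r, by rw [h.cum_univ]; simp⟩, fun _ hσ _ hτ hlt hn =>
    h.extBond_mul_cum hb hlt (fun ρ hρ => hC.total (hπ ρ hρ) hσ)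
      (fun ρ hρ => hC.total (hπ ρ hρ) hτ) fun ρ hρ => hn ρ (hπ ρ hρ)⟩

/-- Together with `IsLSPath.mem_chainLattice`, this identifies the paths supported in `C` with the
nonnegative lattice points. Between consecutive support points the partial sum is constant along
`C`, so its products with all intermediate bonds are integers; by Bézout so is its product with
their gcd, the bond of the pair. -/
theorem isLSPath_of_mem_chainLattice (hb : IsPosetWithBonds b) {C : Set S}
    (hC : IsChain (· ≤ ·) C) {u : S → ℚ} (hu : u ∈ chainLattice b C) (h0 : ∀ σ, 0 ≤ u σ)
    (hr : cum Set.univ u = r) : IsLSPath b r u := by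
  obtain ⟨h1, -, h3⟩ := hu
  refine .of_int h0 (hC.mono h1) (fun σ hσ τ hτ hlt hn => ?_) hr
  have key : ∀ τ, τ ∈ C → σ ≤ τ → (∀ ρ, u ρ ≠ 0 → ¬ (σ < ρ ∧ ρ < τ)) →
      ∃ m : ℤ, (extBond b σ τ : ℚ) * cum (Set.Iic σ) u = m := by
    intro τ
    induction τ using (wellFounded_lt (α := S)).induction with
    | _ τ ih =>
      intro hτ hle hn
      rcases hle.eq_or_lt with rfl | hlt
      · exact ⟨0, by simp [hb.extBond_self]⟩
      -- `ρ` is the predecessor of `τ` in `C`.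
      · obtain ⟨ρ, ⟨hρC, hρτ⟩, hmax⟩ :=
          (Set.toFinite {ρ | ρ ∈ C ∧ ρ < τ}).exists_maximal ⟨σ, h1 σ hσ, hlt⟩
        have hσρ : σ ≤ ρ := (hC.total (h1 σ hσ) hρC).elim id fun h => hmax ⟨h1 σ hσ, hlt⟩ h
        have i1 := ih ρ hρτ hρC hσρ fun x hx hh => hn x hx ⟨hh.1, hh.2.trans hρτ⟩
        have i2 := h3 ρ hρC τ hτ hρτ fun x hx hh => hh.1.not_ge (hmax ⟨hx, hh.2⟩ hh.1.le)
        have : cum (Set.Iic ρ) u = cum (Set.Iic σ) u := by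
          refine cum_congr fun x hx => ⟨fun h => ?_, fun h => le_trans h hσρ⟩
          rcases hC.total (h1 x hx) (h1 σ hσ) with h' | h'
          · exact h'
          · rcases h'.eq_or_lt with rfl | h'
            · exact le_rfl
            · exact absurd ⟨h', lt_of_le_of_lt h hρτ⟩ (hn x hx)
        rw [this] at i2
        rw [hb.extBond_gcd hσρ hρτ.le]
        exact exists_int_gcd_mul i1 i2
  exact key τ (h1 τ hτ) hlt.le hn

/-- The denominators of the elements of the lattices of all chains are bounded. -/
theorem exists_denominator (hb : IsPosetWithBonds b) :
    ∃ N : ℕ, 0 < N ∧ ∀ C : Set S, IsChain (· ≤ ·) C → ∀ u ∈ chainLattice b C, ∀ σ,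
      ∃ m : ℤ, (N : ℚ) * u σ = m := by
  classical
  have := Fintype.ofFinite S
  -- `N` is a common multiple of all bonds; pairs without a bond, where `extBond` is 0, contribute
  -- 1. It clears the denominators of the partial sums along `C`, hence of the values, which are
  -- their differences.
  let N : ℕ := ∏ x : S × S, if extBond b x.1 x.2 = 0 then 1 else extBond b x.1 x.2
  have hdvd : ∀ σ τ : S, σ < τ → extBond b σ τ ∣ N := fun σ τ h => by
    have := Finset.dvd_prod_of_mem
      (fun x : S × S => if extBond b x.1 x.2 = 0 then 1 else extBond b x.1 x.2)
      (Finset.mem_univ (σ, τ))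
    simpa [(hb.extBond_pos h).ne'] using this
  refine ⟨N, Finset.prod_pos fun x _ => by split_ifs <;> omega, fun C hC u hu => ?_⟩
  obtain ⟨h1, ⟨d, hd⟩, h3⟩ := hu
  have hF : ∀ σ ∈ C, ∃ m : ℤ, (N : ℚ) * cum (Set.Iic σ) u = m := by
    intro σ hσ
    by_cases hs : ∃ τ ∈ C, σ < τ
    · obtain ⟨τ, ⟨hτC, hτ⟩, hmin⟩ :=
        (Set.toFinite {τ | τ ∈ C ∧ σ < τ}).exists_minimal hs
      exact exists_int_mul_of_dvd (hdvd σ τ hτ)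
        (h3 σ hσ τ hτC hτ fun x hx hh => hh.2.not_ge (hmin ⟨hx, hh.1⟩ hh.2.le))
    · have : cum (Set.Iic σ) u = cum Set.univ u := by
        refine cum_congr fun x hx => ⟨fun _ => trivial, fun _ => ?_⟩
        rcases hC.total (h1 x hx) hσ with h' | h'
        · exact h'
        · rcases h'.eq_or_lt with rfl | h'
          · exact le_rfl
          · exact absurd ⟨x, h1 x hx, h'⟩ hs
      exact ⟨N * d, by rw [this, hd]; push_cast; rfl⟩
  intro σ
  by_cases hσ : σ ∈ C
  swap
  · exact ⟨0, by rw [not_imp_comm.1 (h1 σ) hσ]; simp⟩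
  have e : u σ = cum (Set.Iic σ) u - cum (Set.Iio σ) u := by rw [cum_Iic]; ring
  obtain ⟨m, hm⟩ := hF σ hσ
  by_cases hs : ∃ τ ∈ C, τ < σ
  · obtain ⟨τ, ⟨hτC, hτ⟩, hmax⟩ :=
      (Set.toFinite {τ | τ ∈ C ∧ τ < σ}).exists_maximal hs
    obtain ⟨n, hn⟩ := hF τ hτC
    have : cum (Set.Iio σ) u = cum (Set.Iic τ) u := by
      refine cum_congr fun x hx => ⟨fun h => ?_, fun h => lt_of_le_of_lt h hτ⟩
      exact (hC.total (h1 x hx) hτC).elim id fun h' => hmax ⟨h1 x hx, h⟩ h'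
    exact ⟨m - n, by rw [e, this, mul_sub, hm, hn]; push_cast; rfl⟩
  · have : cum (Set.Iio σ) u = 0 := cum_eq_zero fun x hx => by
      by_contra h
      exact hs ⟨x, h1 x h, hx⟩
    exact ⟨m, by rw [e, this, sub_zero, hm]⟩

/-- All values of such a path lie in `[0, r]` and have a common denominator. -/
theorem finite_lsPath (hb : IsPosetWithBonds b) (r : ℕ) : Finite (LSPath b r) := by
  obtain ⟨N, hN, h⟩ := exists_denominator hb
  have hN' : (0 : ℚ) < N := by exact_mod_cast hN
  have hfin : (Set.pi Set.univ fun _ : S =>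
      (fun k : ℤ => (k : ℚ) / N) '' Set.Icc 0 (N * r)).Finite :=
    Set.Finite.pi (fun _ => (Set.finite_Icc _ _).image _)
  refine (hfin.subset ?_).to_subtype
  intro π hπ σ _
  obtain ⟨m, hm⟩ := h _ hπ.isChain π (hπ.mem_chainLattice hb hπ.isChain fun _ h => h) σ
  have h1 : π σ ≤ r := by
    rw [← hπ.cum_univ]
    have := cum_mono (Set.subset_univ {σ}) hπ.nonneg
    simpa [cum] using this
  refine ⟨m, ⟨?_, ?_⟩, ?_⟩
  · have : (0 : ℚ) ≤ m := by rw [← hm]; exact mul_nonneg hN'.le (hπ.nonneg σ)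
    exact_mod_cast this
  · have : (m : ℚ) ≤ N * r := by rw [← hm]; gcongr
    exact_mod_cast this
  · show (m : ℚ) / N = π σ
    rw [← hm]; field_simp

/-- The elements of degree zero of the lattice of a chain. -/
def chainLatticeZero (b : S → S → ℕ) (C : Set S) : AddSubgroup (S → ℚ) where
  carrier := {u | u ∈ chainLattice b C ∧ cum Set.univ u = 0}
  zero_mem' := ⟨zero_mem _, cum_zero _⟩
  add_mem' h h' := ⟨add_mem h.1 h'.1, by rw [cum_add, h.2, h'.2, add_zero]⟩
  neg_mem' h := ⟨neg_mem h.1, by rw [cum_neg, h.2, neg_zero]⟩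

/-- Multiplication by the common denominator embeds the group in `ℤ^S`, so it is finitely generated
and torsion-free, hence free. Its rank `n` will be the dimension of the torus. -/
theorem exists_lattice_param (hb : IsPosetWithBonds b) {C : Set S} (hC : IsChain (· ≤ ·) C) :
    ∃ (n : ℕ) (ι : (Fin n → ℤ) →+ (S → ℚ)), Function.Injective ι ∧
      ι.range = chainLatticeZero b C := by
  obtain ⟨N, hN, h⟩ := exists_denominator hb
  have hN' : (N : ℚ) ≠ 0 := by exact_mod_cast hN.ne'
  choose m hm using fun u : chainLatticeZero b C => h C hC u.1 u.2.1
  let f : chainLatticeZero b C →+ (S → ℤ) :=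
    { toFun := m
      map_zero' := by
        ext σ
        have := hm 0 σ
        simp only [ZeroMemClass.coe_zero, Pi.zero_apply, mul_zero] at this
        exact_mod_cast this.symm
      map_add' := by
        intro u v
        ext σ
        have h1 := hm (u + v) σ
        have h2 := hm u σ
        have h3 := hm v σ
        simp only [AddMemClass.coe_add, Pi.add_apply, mul_add, h2, h3] at h1
        exact_mod_cast h1.symm }
  have hf : Function.Injective f := by
    intro u v huv
    ext σ
    have h1 := hm u σ
    have h2 := hm v σ
    have h3 : m u σ = m v σ := congrFun huv σ
    rw [h3, ← h2] at h1
    exact mul_left_cancel₀ hN' h1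
  have hfin : Module.Finite ℤ (chainLatticeZero b C) :=
    Module.Finite.of_injective f.toIntLinearMap hf
  have htf : Module.IsTorsionFree ℤ (chainLatticeZero b C) :=
    Function.Injective.moduleIsTorsionFree f hf fun c x => map_zsmul f c x
  have hfree : Module.Free ℤ (chainLatticeZero b C) := inferInstance
  let e := (Module.finBasis ℤ (chainLatticeZero b C)).equivFun
  refine ⟨_, (chainLatticeZero b C).subtype.comp e.symm.toAddEquiv.toAddMonoidHom,
    Subtype.val_injective.comp e.symm.injective, ?_⟩
  ext u
  simp only [AddMonoidHom.mem_range, AddMonoidHom.coe_comp, Function.comp_apply]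
  constructor
  · rintro ⟨x, rfl⟩
    exact (e.symm x).2
  · intro hu
    exact ⟨e ⟨u, hu⟩, by simp⟩

/-- Used to write the monomial with exponent `u` as a fraction whose denominator is a power of
`j(p)`. -/
theorem exists_nsmul_add_nonneg {u p : S → ℚ} (hp : ∀ σ, 0 ≤ p σ) (h : ∀ σ, p σ = 0 → 0 ≤ u σ) :
    ∃ k : ℕ, ∀ σ, 0 ≤ (u + k • p) σ := by
  have := Fintype.ofFinite S
  have : ∀ σ, ∃ k : ℕ, ∀ k' : ℕ, k ≤ k' → 0 ≤ u σ + k' * p σ := by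
    intro σ
    by_cases h0 : p σ = 0
    · exact ⟨0, fun k _ => by simpa [h0] using h σ h0⟩
    · have hpos := (hp σ).lt_of_ne' h0
      obtain ⟨k, hk⟩ := exists_nat_ge (-u σ / p σ)
      refine ⟨k, fun k' hk' => ?_⟩
      have h2 : -u σ / p σ ≤ k' := hk.trans (by exact_mod_cast hk')
      rw [div_le_iff₀ hpos] at h2
      linarith
  choose k hk using this
  refine ⟨Finset.univ.sup k, fun σ => ?_⟩
  simpa using hk σ _ (Finset.le_sup (Finset.mem_univ σ))

/-- The indicator function of `C` works: all its partial sums are integers. The chart of such a path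
will be the torus. -/
theorem exists_isLSPath_support_eq (hb : IsPosetWithBonds b) {C : Set S}
    (hC : IsChain (· ≤ ·) C) (hne : C.Nonempty) :
    ∃ (d : ℕ) (q : S → ℚ), 0 < d ∧ IsLSPath b d q ∧ ∀ σ, q σ ≠ 0 ↔ σ ∈ C := by
  classical
  have := Fintype.ofFinite S
  have hq : ∀ s : Set S, cum s (C.indicator (1 : S → ℚ)) = ((s ∩ C).ncard : ℕ) := by
    intro s
    unfold cum
    rw [← finsum_mem_inter_support, Set.support_indicator, Function.support_one, Set.inter_univ,
      finsum_mem_congr rfl (g := fun _ => (1 : ℚ)) fun x hx => by simp [hx.2],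
      finsum_mem_eq_finite_toFinset_sum _ (Set.toFinite (s ∩ C)), Finset.sum_const,
      Set.ncard_eq_toFinset_card _ (Set.toFinite (s ∩ C))]
    simp
  refine ⟨C.ncard, C.indicator 1, (Set.ncard_pos).2 hne, ?_, fun σ => by simp⟩
  refine isLSPath_of_mem_chainLattice hb hC ⟨fun σ h => by simpa using h, ⟨C.ncard, ?_⟩,
    fun σ _ τ _ _ _ => ⟨extBond b σ τ * (Set.Iic σ ∩ C).ncard, ?_⟩⟩ ?_ ?_
  · rw [hq]; simp
  · rw [hq]; simp
  · exact fun σ => Set.indicator_nonneg (fun _ _ => zero_le_one) σ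
  · rw [hq]; simp

end Chain
end LSAlg

namespace LSAlg

/-! ### Multiplication of the path basis -/

section Comparable

variable {S : Type u} [PartialOrder S] {b : S → S → ℕ}

theorem comparableSupports_iff {p q : S → ℚ} (hp : IsChain (· ≤ ·) (Function.support p))
    (hq : IsChain (· ≤ ·) (Function.support q)) :
    ComparableSupports p q ↔ ∀ σ, p σ ≠ 0 → ∀ τ, q τ ≠ 0 → σ ≤ τ ∨ τ ≤ σ := by
  constructor
  · rintro ⟨C, hC, hpC, hqC⟩ σ hσ τ hτ
    exact hC.total (hpC hσ) (hqC hτ)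
  · intro h
    refine ⟨Function.support p ∪ Function.support q, ?_, Set.subset_union_left,
      Set.subset_union_right⟩
    rintro σ (hσ | hσ) τ (hτ | hτ) hne
    · exact hp hσ hτ hne
    · exact h σ hσ τ hτ
    · exact (h τ hτ σ hσ).symm
    · exact hq hσ hτ hne

theorem ComparableSupports.mono {p q p' q' : S → ℚ} (h : ComparableSupports p q)
    (hp : ∀ σ, p' σ ≠ 0 → p σ ≠ 0 ∨ q σ ≠ 0) (hq : ∀ σ, q' σ ≠ 0 → p σ ≠ 0 ∨ q σ ≠ 0) :
    ComparableSupports p' q' := by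
  obtain ⟨C, hC, hpC, hqC⟩ := h
  exact ⟨C, hC, fun σ hσ => (hp σ hσ).elim (fun h => hpC h) fun h => hqC h,
    fun σ hσ => (hq σ hσ).elim (fun h => hpC h) fun h => hqC h⟩

theorem TriLE.refl (p : S → ℚ) : TriLE p p := fun _ _ _ => .inl rfl

variable [Finite S]

theorem comparableSupports_of_isStandard_cons {p : LSPath b 1} {l : List (LSPath b 1)}
    (h : IsStandard (p :: l)) (hl : IsChain (· ≤ ·) (Function.support (l.map Subtype.val).sum)) :
    ComparableSupports p.1 (l.map Subtype.val).sum := by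
  rw [comparableSupports_iff p.2.isChain hl]
  intro σ hσ τ hτ
  obtain ⟨q, hq, hτ⟩ := list_sum_ne_zero.1 hτ
  exact .inl ((isStandard_cons.1 h).1 q hq σ hσ τ hτ)

theorem isLSPath_list_sum (hb : IsPosetWithBonds b) {l : List (LSPath b 1)} (h : IsStandard l) :
    IsLSPath b l.length (l.map Subtype.val).sum := by
  induction l with
  | nil => exact .zero
  | cons p l ih =>
    have ih := ih (isStandard_cons.1 h).2
    rw [List.length_cons, add_comm]
    exact p.2.add hb ih (comparableSupports_of_isStandard_cons h ih.isChain)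

theorem IsStandard.comparableSupports {p q : LSPath b 1} (h : IsStandard [p, q]) :
    ComparableSupports p.1 q.1 := by
  have := comparableSupports_of_isStandard_cons h (by simpa using q.2.isChain)
  simpa using this

end Comparable

/-! ### Discrete LS algebras from multiplicative bases -/

section Criterion

variable {S : Type u} [PartialOrder S] [Finite S] {b : S → S → ℕ}
variable {K A : Type u} [Field K] [CommRing A] [Algebra K A]

theorem pathVec_of_isCanonicalForm {𝒜 : ℕ → Submodule K A} (j : LSPath b 1 → 𝒜 1) {π : S → ℚ}
    {l : List (LSPath b 1)} (h : IsCanonicalForm l π) :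
    pathVec j π = (l.map fun p => (j p : A)).prod := by
  have h' : ∃ l : List (LSPath b 1), IsCanonicalForm l π := ⟨l, h⟩
  rw [pathVec, dif_pos h', h'.choose_spec.unique h]

theorem pathVec_eq_of_mul (hb : IsPosetWithBonds b) {𝒜 : ℕ → Submodule K A}
    {j : LSPath b 1 → 𝒜 1} {v : (S → ℚ) → A} (hj : ∀ p, (j p : A) = v p.1) (h0 : v 0 = 1)
    (hmul : ∀ p π : S → ℚ, (∃ r, IsLSPath b r p) → (∃ r, IsLSPath b r π) →
      ComparableSupports p π → v p * v π = v (p + π)) {r : ℕ} {π : S → ℚ}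
    (h : IsLSPath b r π) : pathVec j π = v π := by
  obtain ⟨l, hl⟩ := h.exists_canonicalForm
  rw [pathVec_of_isCanonicalForm j hl]
  obtain ⟨h1, rfl⟩ := hl
  clear h
  induction l with
  | nil => simp [h0]
  | cons p l ih =>
    have hl := (isStandard_cons.1 h1).2
    rw [List.map_cons, List.prod_cons, ih hl, hj, List.map_cons, List.sum_cons,
      hmul _ _ ⟨1, p.2⟩ ⟨_, isLSPath_list_sum hb hl⟩
        (comparableSupports_of_isStandard_cons h1 (isLSPath_list_sum hb hl).isChain)]

/-- A graded algebra with a multiplicative basis indexed by the LS-paths is a discrete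
LS algebra. -/
theorem IsDiscreteLSAlgebra.of_mul (hb : IsPosetWithBonds b) {𝒜 : ℕ → Submodule K A}
    {j : LSPath b 1 → 𝒜 1} {v : (S → ℚ) → A} (hj : ∀ p, (j p : A) = v p.1) (h0 : v 0 = 1)
    (hmul : ∀ p π : S → ℚ, (∃ r, IsLSPath b r p) → (∃ r, IsLSPath b r π) →
      ComparableSupports p π → v p * v π = v (p + π))
    (hmul0 : ∀ p π : S → ℚ, (∃ r, IsLSPath b r p) → (∃ r, IsLSPath b r π) →
      ¬ ComparableSupports p π → v p * v π = 0)
    (hli : LinearIndependent K fun π : AllLSPath b => v π.1)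
    (hspan : Submodule.span K (Set.range fun π : AllLSPath b => v π.1) = ⊤)
    (hgr : ∀ r, 𝒜 r = Submodule.span K (Set.range fun π : LSPath b r => v π.1)) :
    IsDiscreteLSAlgebra b 𝒜 j := by
  have hv : (fun π : AllLSPath b => pathVec j π.1) = fun π => v π.1 := by
    ext π
    obtain ⟨r, hr⟩ := π.2
    exact pathVec_eq_of_mul hb hj h0 hmul hr
  have hv' : ∀ r, (fun π : LSPath b r => pathVec j π.1) = fun π => v π.1 := fun r => by
    ext π
    exact pathVec_eq_of_mul hb hj h0 hmul π.2
  -- By independence the expansion of such a product has the single term `p + q`, with coefficient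
  -- 1, so the order condition reduces to reflexivity.
  have hlc : ∀ p q : LSPath b 1, ComparableSupports p.1 q.1 → ∀ c : AllLSPath b →₀ K,
      (j p : A) * j q = Finsupp.linearCombination K (fun π : AllLSPath b => v π.1) c →
      ∃ h, c = Finsupp.single ⟨p.1 + q.1, h⟩ 1 := by
    intro p q hpq c hc
    refine ⟨⟨_, p.2.add hb q.2 hpq⟩, hli ?_⟩
    rw [← hc, hj, hj, hmul _ _ ⟨1, p.2⟩ ⟨1, q.2⟩ hpq]
    simp
  refine ⟨⟨fun p q h => ?_, hv ▸ hli, hv ▸ hspan, fun r => hv' r ▸ hgr r, ?_, ?_⟩, ?_, ?_⟩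
  · have h1 : v p.1 = v q.1 := by rw [← hj, ← hj, h]
    have h2 := hli.injective (a₁ := ⟨p.1, 1, p.2⟩) (a₂ := ⟨q.1, 1, q.2⟩) h1
    exact Subtype.ext (Subtype.mk.inj h2)
  · intro p q _ c hc π hπ
    rw [hv] at hc
    by_cases hpq : ComparableSupports p.1 q.1
    · obtain ⟨h, rfl⟩ := hlc p q hpq c hc
      rw [Finsupp.single_apply_ne_zero] at hπ
      rw [hπ.1]
      exact TriLE.refl _
    · rw [hj, hj, hmul0 _ _ ⟨1, p.2⟩ ⟨1, q.2⟩ hpq] at hc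
      have : c = 0 := hli (by rw [← hc, map_zero])
      simp [this] at hπ
  · intro p q _ hpq c hc π hπ
    rw [hv] at hc
    obtain ⟨h, rfl⟩ := hlc p q hpq c hc
    have : π = ⟨p.1 + q.1, h⟩ := Subtype.ext hπ
    rw [this, Finsupp.single_eq_same]
  · intro p q _ hpq p₀ q₀ h
    have h1 := pathVec_of_isCanonicalForm j h
    rw [pathVec_eq_of_mul hb hj h0 hmul (p.2.add hb q.2 hpq)] at h1
    rw [hj p, hj q, hmul _ _ ⟨1, p.2⟩ ⟨1, q.2⟩ hpq, h1]
    simp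
  · intro p q _ hpq
    rw [hj, hj]
    exact hmul0 _ _ ⟨1, p.2⟩ ⟨1, q.2⟩ hpq

end Criterion

/-! ### Products of arbitrary path basis elements -/

section Multiplication

variable {S : Type u} [PartialOrder S] [Finite S] {b : S → S → ℕ}
variable {K A : Type u} [Field K] [CommRing A] [Algebra K A] {𝒜 : ℕ → Submodule K A}
  {j : LSPath b 1 → 𝒜 1}

theorem isStandard_singleton (p : LSPath b 1) : IsStandard [p] := by simp [IsStandard]

variable (j) in
theorem pathVec_coe (p : LSPath b 1) : pathVec j p.1 = j p := by
  rw [pathVec_of_isCanonicalForm j (l := [p]) ⟨isStandard_singleton p, by simp⟩]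
  simp

variable (j) in
theorem pathVec_zero : pathVec j 0 = 1 := by
  rw [pathVec_of_isCanonicalForm j (l := []) ⟨by simp [IsStandard], by simp⟩]
  simp

variable (j) in
theorem pathVec_cons {p : LSPath b 1} {l : List (LSPath b 1)} {π : S → ℚ}
    (h : IsCanonicalForm (p :: l) π) :
    pathVec j π = j p * pathVec j (l.map Subtype.val).sum := by
  rw [pathVec_of_isCanonicalForm j h,
    pathVec_of_isCanonicalForm j (l := l) ⟨(isStandard_cons.1 h.1).2, rfl⟩]
  simp

theorem IsDiscreteLSAlgebra.mul_eq (hA : IsDiscreteLSAlgebra b 𝒜 j) {p q p₀ q₀ : LSPath b 1}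
    (hpq : ComparableSupports p.1 q.1) (h : IsCanonicalForm [p₀, q₀] (p.1 + q.1)) :
    (j p : A) * j q = j p₀ * j q₀ := by
  by_cases hs : IsStandard [p, q]
  · have := h.unique (l' := [p, q]) ⟨hs, by simp⟩
    simp only [List.cons.injEq, and_true] at this
    rw [this.1, this.2]
  · exact hA.mul_of_comparable p q hs hpq p₀ q₀ h

/-- The whole mass 1 of `q` lies strictly below `σ`, so the first factor is exhausted before
reaching `σ`. -/
theorem firstFactor_eq_zero_of_lt {p q : LSPath b 1} {σ τ : S} (hlt : τ < σ)
    (hq : ∀ ρ, q.1 ρ ≠ 0 → ρ ≤ τ) : firstFactor (p.1 + q.1) σ = 0 := by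
  have h0 : ∀ ρ, 0 ≤ (p.1 + q.1) ρ := fun ρ => add_nonneg (p.2.nonneg ρ) (q.2.nonneg ρ)
  have h1 : 1 ≤ cum (Set.Iio σ) (p.1 + q.1) := by
    have : cum (Set.Iio σ) q.1 = 1 := by
      rw [show (1 : ℚ) = ((1 : ℕ) : ℚ) by simp, ← q.2.cum_univ]
      exact cum_congr fun ρ hρ => ⟨fun _ => trivial, fun _ => (hq ρ hρ).trans_lt hlt⟩
    rw [cum_add, this]
    linarith [cum_nonneg (Set.Iio σ) p.2.nonneg]
  have h3 : cum (Set.Iio σ) (p.1 + q.1) ≤ cum (Set.Iic σ) (p.1 + q.1) :=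
    cum_mono Set.Iio_subset_Iic_self h0
  rw [firstFactor, min_eq_right (by linarith), min_eq_right h1, sub_self]

/-- Insertion of one factor in a standard monomial. The product of `p` with the head `q` of `π` is
replaced by the canonical form of `p + q`, whose second factor is absorbed in the tail by induction
on the degree. The point is that the first factor still lies below everything else. -/
theorem IsDiscreteLSAlgebra.coe_mul_pathVec (hb : IsPosetWithBonds b)
    (hA : IsDiscreteLSAlgebra b 𝒜 j) {r : ℕ} {p : LSPath b 1} {π : S → ℚ} (hπ : IsLSPath b r π)
    (hc : ComparableSupports p.1 π) : (j p : A) * pathVec j π = pathVec j (p.1 + π) := by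
  induction r generalizing p π with
  | zero => rw [hπ.eq_zero, pathVec_zero, add_zero, pathVec_coe, mul_one]
  | succ r ih =>
    obtain ⟨l, hl⟩ := hπ.exists_canonicalForm
    cases l with
    | nil => simpa using hl.length_eq hπ
    | cons q l =>
      have hlen := hl.length_eq hπ
      simp only [List.length_cons, add_left_inj] at hlen
      have hstd := isStandard_cons.1 hl.1
      have hπ' := isLSPath_list_sum hb hstd.2
      rw [hlen] at hπ'
      have hsum : q.1 + (l.map Subtype.val).sum = π := by simpa using hl.2
      have hsupp := support_add_of_nonneg q.2.nonneg (list_sum_nonneg l)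
      rw [hsum] at hsupp
      have hpq : ComparableSupports p.1 q.1 :=
        hc.mono (fun σ h => .inl h) fun σ h => .inr ((hsupp σ).2 (.inl h))
      have h2 := p.2.add hb q.2 hpq
      have hcan : IsCanonicalForm [⟨_, h2.firstFactor⟩, ⟨_, h2.sub_firstFactor⟩] (p.1 + q.1) := by
        refine ⟨isStandard_cons.2 ⟨?_, isStandard_singleton _⟩, by simp⟩
        simp only [List.mem_singleton, forall_eq]
        exact fun σ hσ τ hτ => h2.firstFactor_le_sub hσ hτ
      rw [pathVec_cons j hl, ← mul_assoc, hA.mul_eq hpq hcan, mul_assoc]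
      have hq₀ : ∀ σ, (p.1 + q.1 - firstFactor (p.1 + q.1)) σ ≠ 0 → p.1 σ ≠ 0 ∨ π σ ≠ 0 := by
        intro σ h
        have := ((sub_firstFactor_ne_zero h2.nonneg).1 h).1
        rw [support_add_of_nonneg p.2.nonneg q.2.nonneg] at this
        exact this.imp id fun h => (hsupp σ).2 (.inl h)
      have hc' := hc.mono hq₀ fun σ h => .inr ((hsupp σ).2 (.inr h))
      rw [ih hπ' hc']
      have h3 := h2.sub_firstFactor.add hb hπ' hc'
      obtain ⟨l', hl'⟩ := h3.exists_canonicalForm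
      have hcan' : IsCanonicalForm (⟨_, h2.firstFactor⟩ :: l') (p.1 + π) := by
        refine ⟨isStandard_cons.2 ⟨fun q' hq' σ hσ τ hτ => ?_, hl'.1⟩, ?_⟩
        · have hτ : (p.1 + q.1 - firstFactor (p.1 + q.1) + (l.map Subtype.val).sum) τ ≠ 0 := by
            rw [← hl'.2]
            exact list_sum_ne_zero.2 ⟨q', hq', hτ⟩
          rw [support_add_of_nonneg h2.sub_firstFactor.nonneg (list_sum_nonneg l)] at hτ
          rcases hτ with hτ | hτ
          · exact h2.firstFactor_le_sub hσ hτ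
          -- Here `τ` comes from the tail, hence lies above the support of `q`. If `σ` were strictly
          -- above `τ`, all of `q` would lie below `σ` and the first factor would vanish there.
          · obtain ⟨q₁, hq₁, hτ₁⟩ := list_sum_ne_zero.1 hτ
            have hle : ∀ ρ, q.1 ρ ≠ 0 → ρ ≤ τ := fun ρ hρ => hstd.1 q₁ hq₁ ρ hρ τ hτ₁
            have hσ' : (p.1 + q.1) σ ≠ 0 := fun h =>
              hσ (le_antisymm ((firstFactor_le h2.nonneg σ).trans h.le)
                (firstFactor_nonneg h2.nonneg σ))
            have hcomp : σ ≤ τ ∨ τ ≤ σ := by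
              rcases (support_add_of_nonneg p.2.nonneg q.2.nonneg σ).1 hσ' with h | h
              · obtain ⟨C, hC, hpC, hqC⟩ := hc
                exact hC.total (hpC h) (hqC ((hsupp τ).2 (.inr hτ)))
              · exact .inl (hle σ h)
            rcases hcomp with h | h
            · exact h
            · rcases h.eq_or_lt with rfl | h
              · exact le_rfl
              · exact absurd (firstFactor_eq_zero_of_lt h hle) hσ
        · rw [List.map_cons, List.sum_cons, hl'.2, ← hsum]
          simp only
          abel
      rw [pathVec_cons j hcan', hl'.2]

theorem IsDiscreteLSAlgebra.pathVec_mul (hb : IsPosetWithBonds b)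
    (hA : IsDiscreteLSAlgebra b 𝒜 j) {p π : S → ℚ} (hp : ∃ r, IsLSPath b r p)
    (hπ : ∃ r, IsLSPath b r π) (hc : ComparableSupports p π) :
    pathVec j p * pathVec j π = pathVec j (p + π) := by
  obtain ⟨r, hp⟩ := hp
  obtain ⟨s, hπ⟩ := hπ
  obtain ⟨l, hl⟩ := hp.exists_canonicalForm
  induction l generalizing r p with
  | nil =>
    obtain rfl : p = 0 := by simpa using hl.2.symm
    rw [pathVec_zero, one_mul, zero_add]
  | cons q l ih =>
    have hstd := isStandard_cons.1 hl.1
    have hsum : q.1 + (l.map Subtype.val).sum = p := by simpa using hl.2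
    have hsupp := support_add_of_nonneg q.2.nonneg (list_sum_nonneg l)
    rw [hsum] at hsupp
    have hp' := isLSPath_list_sum hb hstd.2
    have hc1 : ComparableSupports (l.map Subtype.val).sum π :=
      hc.mono (fun σ h => .inl ((hsupp σ).2 (.inr h))) fun σ h => .inr h
    have hc2 : ComparableSupports q.1 ((l.map Subtype.val).sum + π) := by
      refine hc.mono (fun σ h => .inl ((hsupp σ).2 (.inl h))) fun σ h => ?_
      rw [support_add_of_nonneg (list_sum_nonneg l) hπ.nonneg] at h
      exact h.imp (fun h => (hsupp σ).2 (.inr h)) id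
    rw [pathVec_cons j hl, mul_assoc, ih hc1 _ hp' ⟨hstd.2, rfl⟩,
      hA.coe_mul_pathVec hb (hp'.add hb hπ hc1) hc2, ← add_assoc, hsum]

theorem coe_dvd_pathVec {r : ℕ} {π : S → ℚ} (h : IsLSPath b r π) {σ : S} (hσ : π σ ≠ 0) :
    ∃ p : LSPath b 1, p.1 σ ≠ 0 ∧ (∀ τ, p.1 τ ≠ 0 → π τ ≠ 0) ∧ (j p : A) ∣ pathVec j π := by
  obtain ⟨l, hl⟩ := h.exists_canonicalForm
  have hsum := hl.2
  rw [← hsum] at hσ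
  obtain ⟨p, hp, hpσ⟩ := list_sum_ne_zero.1 hσ
  refine ⟨p, hpσ, fun τ hτ => ?_, ?_⟩
  · rw [← hsum]
    exact list_sum_ne_zero.2 ⟨p, hp, hτ⟩
  · rw [pathVec_of_isCanonicalForm j hl]
    exact List.dvd_prod (List.mem_map_of_mem hp)

/-- Take incomparable points in the two supports and degree one factors containing them: the product
of these two factors is zero and divides the product in question. -/
theorem IsDiscreteLSAlgebra.pathVec_mul_eq_zero
    (hA : IsDiscreteLSAlgebra b 𝒜 j) {p π : S → ℚ} (hp : ∃ r, IsLSPath b r p)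
    (hπ : ∃ r, IsLSPath b r π) (hc : ¬ ComparableSupports p π) :
    pathVec j p * pathVec j π = 0 := by
  obtain ⟨r, hp⟩ := hp
  obtain ⟨s, hπ⟩ := hπ
  rw [comparableSupports_iff hp.isChain hπ.isChain] at hc
  push Not at hc
  obtain ⟨σ, hσ, τ, hτ, h1, h2⟩ := hc
  obtain ⟨p', hp', -, hdvd⟩ := coe_dvd_pathVec (j := j) hp hσ
  obtain ⟨q', hq', -, hdvd'⟩ := coe_dvd_pathVec (j := j) hπ hτ
  have hnc : ¬ ComparableSupports p'.1 q'.1 := by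
    rw [comparableSupports_iff p'.2.isChain q'.2.isChain]
    exact fun h => (h σ hp' τ hq').elim h1 h2
  have := mul_dvd_mul hdvd hdvd'
  rwa [hA.mul_of_not_comparable p' q' (fun h => hnc h.comparableSupports) hnc, zero_dvd_iff]
    at this

end Multiplication
end LSAlg

namespace LSAlg

/-! ### The algebra of a chain -/

section ChainAlgebra

variable {S : Type u} [PartialOrder S] [Finite S] {b : S → S → ℕ}
variable {K A : Type u} [Field K] [CommRing A] [Algebra K A] {𝒜 : ℕ → Submodule K A}
  {j : LSPath b 1 → 𝒜 1}

/-- The basis of an LS algebra consisting of the LS-paths. -/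
noncomputable def IsLSAlgebra.basis (hA : IsLSAlgebra b 𝒜 j) :
    Module.Basis (AllLSPath b) K A :=
  Module.Basis.mk hA.linearIndependent hA.span_eq_top.ge

theorem IsLSAlgebra.basis_apply (hA : IsLSAlgebra b 𝒜 j) (π : AllLSPath b) :
    hA.basis π = pathVec j π.1 := by
  simp [IsLSAlgebra.basis]

open Classical in
/-- The linear map sending an LS-path `π` to the monomial with exponent `π` if the support of `π`
is contained in `C`, and to zero otherwise. -/
noncomputable def IsLSAlgebra.toMonomialsLin (hA : IsLSAlgebra b 𝒜 j) (C : Set S) :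
    A →ₗ[K] AddMonoidAlgebra K (S → ℚ) :=
  hA.basis.constr K fun π => if ∀ σ, π.1 σ ≠ 0 → σ ∈ C then AddMonoidAlgebra.single π.1 1 else 0

open Classical in
theorem IsLSAlgebra.toMonomialsLin_pathVec (hA : IsLSAlgebra b 𝒜 j) (C : Set S) {π : S → ℚ}
    (hπ : ∃ r, IsLSPath b r π) : hA.toMonomialsLin C (pathVec j π) =
      if ∀ σ, π σ ≠ 0 → σ ∈ C then AddMonoidAlgebra.single π 1 else 0 := by
  have := hA.basis.constr_basis K (fun π : AllLSPath b =>
    if ∀ σ, π.1 σ ≠ 0 → σ ∈ C then (AddMonoidAlgebra.single π.1 1 : AddMonoidAlgebra K (S → ℚ))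
      else 0) ⟨π, hπ⟩
  rwa [hA.basis_apply] at this

theorem IsLSAlgebra.induction (hA : IsLSAlgebra b 𝒜 j) {P : A → Prop} (x : A)
    (hv : ∀ π, (∃ r, IsLSPath b r π) → P (pathVec j π)) (h0 : P 0)
    (hadd : ∀ x y, P x → P y → P (x + y)) (hsmul : ∀ (c : K) x, P x → P (c • x)) : P x := by
  have hx : x ∈ Submodule.span K (Set.range fun π : AllLSPath b => pathVec j π.1) := by
    rw [hA.span_eq_top]; trivial
  induction hx using Submodule.span_induction with
  | mem x h => obtain ⟨π, rfl⟩ := h; exact hv _ π.2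
  | zero => exact h0
  | add x y _ _ h1 h2 => exact hadd x y h1 h2
  | smul c x _ h => exact hsmul c x h

variable (hb : IsPosetWithBonds b) (hA : IsDiscreteLSAlgebra b 𝒜 j) {C : Set S}
  (hC : IsChain (· ≤ ·) C)

include hb hC in
-- It suffices to test on basis elements. When the product vanishes for lack of comparability, one
-- of the two supports leaves `C`, because `C` is a chain; then the product of the images vanishes
-- too.
theorem IsDiscreteLSAlgebra.toMonomialsLin_mul (x y : A) :
    hA.toMonomialsLin C (x * y) = hA.toMonomialsLin C x * hA.toMonomialsLin C y := by
  classical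
  refine hA.induction (P := fun x => hA.toMonomialsLin C (x * y) =
    hA.toMonomialsLin C x * hA.toMonomialsLin C y) x (fun p hp => ?_) (by simp) (fun x x' h h' => by
    rw [add_mul, map_add, h, h', map_add, add_mul]) fun c x h => by
    rw [smul_mul_assoc, map_smul, h, map_smul, smul_mul_assoc]
  refine hA.induction (P := fun y => hA.toMonomialsLin C (pathVec j p * y) =
    hA.toMonomialsLin C (pathVec j p) * hA.toMonomialsLin C y) y (fun q hq => ?_) (by simp) (fun x x' h h' => by
    rw [mul_add, map_add, h, h', map_add, mul_add]) fun c x h => by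
    rw [mul_smul_comm, map_smul, h, map_smul, mul_smul_comm]
  have h0p := hp.choose_spec.nonneg
  have h0q := hq.choose_spec.nonneg
  rw [hA.toMonomialsLin_pathVec C hp, hA.toMonomialsLin_pathVec C hq]
  by_cases hc : ComparableSupports p q
  · obtain ⟨r, hr⟩ := hp
    obtain ⟨s, hs⟩ := hq
    rw [hA.pathVec_mul hb ⟨r, hr⟩ ⟨s, hs⟩ hc,
      hA.toMonomialsLin_pathVec C ⟨_, hr.add hb hs hc⟩]
    have hiff : (∀ σ, (p + q) σ ≠ 0 → σ ∈ C) ↔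
        (∀ σ, p σ ≠ 0 → σ ∈ C) ∧ (∀ σ, q σ ≠ 0 → σ ∈ C) := by
      simp only [support_add_of_nonneg h0p h0q]
      exact ⟨fun h => ⟨fun σ h' => h σ (.inl h'), fun σ h' => h σ (.inr h')⟩,
        fun h σ h' => h'.elim (h.1 σ) (h.2 σ)⟩
    by_cases h1 : ∀ σ, p σ ≠ 0 → σ ∈ C
    · by_cases h2 : ∀ σ, q σ ≠ 0 → σ ∈ C
      · rw [if_pos (hiff.2 ⟨h1, h2⟩), if_pos h1, if_pos h2, AddMonoidAlgebra.single_mul_single,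
          one_mul]
      · rw [if_neg fun h => h2 (hiff.1 h).2, if_neg h2, mul_zero]
    · rw [if_neg fun h => h1 (hiff.1 h).1, if_neg h1, zero_mul]
  · rw [hA.pathVec_mul_eq_zero hp hq hc, map_zero]
    by_cases h1 : ∀ σ, p σ ≠ 0 → σ ∈ C
    · by_cases h2 : ∀ σ, q σ ≠ 0 → σ ∈ C
      · exact absurd ⟨C, hC, h1, h2⟩ hc
      · rw [if_neg h2, mul_zero]
    · rw [if_neg h1, zero_mul]

include hb hC in
theorem IsDiscreteLSAlgebra.toMonomialsLin_one : hA.toMonomialsLin C 1 = 1 := by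
  classical
  rw [← pathVec_zero j, hA.toMonomialsLin_pathVec C ⟨0, .zero⟩, if_pos (by simp)]
  rfl

/-- The homomorphism sending an LS-path `π` to the monomial with exponent `π` if the support of `π`
is contained in `C`, and to zero otherwise. -/
noncomputable def IsDiscreteLSAlgebra.toMonomials : A →ₐ[K] AddMonoidAlgebra K (S → ℚ) :=
  AlgHom.ofLinearMap (hA.toMonomialsLin C) (hA.toMonomialsLin_one hb hC)
    (hA.toMonomialsLin_mul hb hC)

theorem IsDiscreteLSAlgebra.toMonomials_pathVec {π : S → ℚ} (hπ : ∃ r, IsLSPath b r π)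
    (h : ∀ σ, π σ ≠ 0 → σ ∈ C) :
    hA.toMonomials hb hC (pathVec j π) = AddMonoidAlgebra.single π 1 := by
  classical
  exact (hA.toMonomialsLin_pathVec C hπ).trans (if_pos h)

theorem IsDiscreteLSAlgebra.toMonomials_pathVec_eq_zero {π : S → ℚ} (hπ : ∃ r, IsLSPath b r π)
    (h : ¬ ∀ σ, π σ ≠ 0 → σ ∈ C) : hA.toMonomials hb hC (pathVec j π) = 0 := by
  classical
  exact (hA.toMonomialsLin_pathVec C hπ).trans (if_neg h)

variable [GradedAlgebra 𝒜]

theorem mk_pathVec_eq_zero {π : S → ℚ} {C : Set S} (hπ : ∃ r, IsLSPath b r π)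
    (h : ¬ ∀ σ, π σ ≠ 0 → σ ∈ C) :
    Ideal.Quotient.mk (chainIdeal j C).toIdeal (pathVec j π) = 0 := by
  rw [Ideal.Quotient.eq_zero_iff_mem]
  push Not at h
  obtain ⟨σ, hσ, hσC⟩ := h
  obtain ⟨p, hp, -, hdvd⟩ := coe_dvd_pathVec (j := j) hπ.choose_spec hσ
  exact Ideal.mem_of_dvd _ hdvd (Ideal.subset_span ⟨p, fun h => hσC (h hp), rfl⟩)

/-- The linear map `θ` sends a monomial back to the class of its path. After `toMonomials` it gives
the quotient map, because a path not supported in `C` has a degree one factor in the ideal; so the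
kernel is no larger than `I_C`. -/
theorem IsDiscreteLSAlgebra.ker_toMonomials :
    RingHom.ker (hA.toMonomials hb hC) = (chainIdeal j C).toIdeal := by
  apply le_antisymm
  · let θ : AddMonoidAlgebra K (S → ℚ) →ₗ[K] A ⧸ (chainIdeal j C).toIdeal :=
      (AddMonoidAlgebra.basis (S → ℚ) K).constr K
        fun u => Ideal.Quotient.mk (chainIdeal j C).toIdeal (pathVec j u)
    have hθ : ∀ x, θ (hA.toMonomials hb hC x) = Ideal.Quotient.mkₐ K (chainIdeal j C).toIdeal x := by
      intro x
      refine hA.induction (P := fun x => θ (hA.toMonomials hb hC x) =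
        Ideal.Quotient.mkₐ K (chainIdeal j C).toIdeal x) x (fun π hπ => ?_) (by simp) (fun x y hx hy => by
        rw [map_add, map_add, hx, hy, map_add]) fun c x hx => by
        rw [map_smul, map_smul, hx, map_smul]
      by_cases h : ∀ σ, π σ ≠ 0 → σ ∈ C
      · rw [hA.toMonomials_pathVec hb hC hπ h, ← AddMonoidAlgebra.basis_apply,
          Module.Basis.constr_basis]
        rfl
      · rw [hA.toMonomials_pathVec_eq_zero hb hC hπ h, map_zero]
        exact (mk_pathVec_eq_zero hπ h).symm
    intro x hx
    have := hθ x
    rw [RingHom.mem_ker.1 hx, map_zero] at this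
    exact Ideal.Quotient.eq_zero_iff_mem.1 this.symm
  · refine Ideal.span_le.2 ?_
    rintro _ ⟨p, hp, rfl⟩
    rw [← pathVec_coe]
    exact hA.toMonomials_pathVec_eq_zero hb hC ⟨1, p.2⟩ hp

/-- The embedding of the algebra of a chain into an algebra of monomials. -/
noncomputable def IsDiscreteLSAlgebra.chainToMonomials :
    (A ⧸ (chainIdeal j C).toIdeal) →ₐ[K] AddMonoidAlgebra K (S → ℚ) :=
  Ideal.Quotient.liftₐ _ (hA.toMonomials hb hC) fun x hx => by
    rwa [← hA.ker_toMonomials hb hC] at hx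

include hb hA hC in
/-- The quotient of a discrete LS algebra associated to a chain is a discrete LS algebra. -/
theorem IsDiscreteLSAlgebra.chain :
    ∃ jC : LSPath (restrictBond b C) 1 → chainGrading j C 1,
      (∀ π : LSPath (restrictBond b C) 1, ∃ π' : LSPath b 1,
        π'.1 = Function.extend Subtype.val π.1 0 ∧
          (jC π).1 = Ideal.Quotient.mk (chainIdeal j C).toIdeal (j π' : A)) ∧
      IsDiscreteLSAlgebra (restrictBond b C) (chainGrading j C) jC := by
  classical
  let ext : (C → ℚ) → (S → ℚ) := fun π => Function.extend Subtype.val π 0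
  have hext : ∀ {r} {π : C → ℚ}, IsLSPath (restrictBond b C) r π → IsLSPath b r (ext π) :=
    fun h => (isLSPath_extend_iff hb hC).2 h
  have hextinj : Function.Injective ext := fun p q h => by
    ext σ
    rw [← extend_coe p, ← extend_coe q]
    exact congrFun h σ
  have hmemC : ∀ (π : C → ℚ) σ, ext π σ ≠ 0 → σ ∈ C := fun π σ h => mem_of_extend_ne_zero h
  have hadd : ∀ p q : C → ℚ, ext (p + q) = ext p + ext q := by
    intro p q
    ext σ
    by_cases hσ : σ ∈ C
    · simp only [ext, Pi.add_apply, extend_coe _ ⟨σ, hσ⟩]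
    · simp only [ext, Pi.add_apply, extend_of_notMem _ hσ, add_zero]
  let mk := Ideal.Quotient.mk (chainIdeal j C).toIdeal
  let v : (C → ℚ) → A ⧸ (chainIdeal j C).toIdeal := fun π => mk (pathVec j (ext π))
  let jC : LSPath (restrictBond b C) 1 → chainGrading j C 1 := fun π =>
    ⟨mk (j ⟨ext π.1, hext π.2⟩), mk_mem_quotGrading 𝒜 _ (j _).2⟩
  -- Over a chain all supports are comparable, so the vanishing relations are vacuous.
  have hcomp : ∀ p q : C → ℚ, ComparableSupports p q := fun p q =>
    ⟨Set.univ, fun x _ y _ _ => hC.total x.2 y.2, Set.subset_univ _, Set.subset_univ _⟩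
  have hcomp' : ∀ p q : C → ℚ, ComparableSupports (ext p) (ext q) := fun p q =>
    ⟨C, hC, hmemC p, hmemC q⟩
  have hspan : ∀ r, (𝒜 r).map (Ideal.Quotient.mkₐ K (chainIdeal j C).toIdeal).toLinearMap =
      Submodule.span K (Set.range fun π : LSPath (restrictBond b C) r => v π.1) := by
    intro r
    rw [hA.grading, Submodule.map_span, ← Set.range_comp]
    apply le_antisymm
    · refine Submodule.span_le.2 ?_
      rintro _ ⟨π, rfl⟩
      by_cases h : ∀ σ, π.1 σ ≠ 0 → σ ∈ C
      · have h' : ext (fun σ : C => π.1 σ) = π.1 := extend_restrict h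
        refine Submodule.subset_span ⟨⟨fun σ : C => π.1 σ, ?_⟩, ?_⟩
        · rw [← isLSPath_extend_iff hb hC]
          change IsLSPath b r (ext _)
          rw [h']
          exact π.2
        · simp only [v, h']
          rfl
      · have := mk_pathVec_eq_zero (j := j) ⟨r, π.2⟩ h
        change mk _ ∈ _
        rw [this]
        exact zero_mem _
    · refine Submodule.span_le.2 ?_
      rintro _ ⟨π, rfl⟩
      exact Submodule.subset_span ⟨⟨ext π.1, hext π.2⟩, rfl⟩
  refine ⟨jC, fun π => ⟨⟨ext π.1, hext π.2⟩, rfl, rfl⟩,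
    .of_mul (hb.restrictBond hC) (v := v) (fun p => ?_) ?_ ?_ ?_ ?_ ?_ ?_⟩
  · exact congrArg mk (pathVec_coe j ⟨ext p.1, hext p.2⟩).symm
  · have : ext 0 = 0 := by
      ext σ
      by_cases hσ : σ ∈ C
      · exact extend_coe 0 ⟨σ, hσ⟩
      · exact extend_of_notMem 0 hσ
    simp only [v, this, pathVec_zero, map_one]
  · rintro p q ⟨r, hp⟩ ⟨s, hq⟩ -
    simp only [v, hadd]
    rw [← map_mul, hA.pathVec_mul hb ⟨r, hext hp⟩ ⟨s, hext hq⟩ (hcomp' p q)]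
  · rintro p q - - h
    exact absurd (hcomp p q) h
  · refine LinearIndependent.of_comp (hA.chainToMonomials hb hC).toLinearMap ?_
    have : (hA.chainToMonomials hb hC).toLinearMap ∘
        (fun π : AllLSPath (restrictBond b C) => v π.1) =
        (AddMonoidAlgebra.basis (S → ℚ) K) ∘ fun π : AllLSPath (restrictBond b C) => ext π.1 := by
      ext1 π
      obtain ⟨r, hr⟩ := π.2
      rw [Function.comp_apply, Function.comp_apply, AddMonoidAlgebra.basis_apply]
      exact hA.toMonomials_pathVec hb hC ⟨r, hext hr⟩ (hmemC π.1)
    rw [this]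
    exact (AddMonoidAlgebra.basis (S → ℚ) K).linearIndependent.comp _
      (hextinj.comp Subtype.val_injective)
  · rw [eq_top_iff]
    rintro x -
    obtain ⟨x, rfl⟩ := Ideal.Quotient.mk_surjective x
    rw [← DirectSum.sum_support_decompose 𝒜 x, map_sum]
    refine Submodule.sum_mem _ fun r _ => ?_
    have h1 : mk (DirectSum.decompose 𝒜 x r) ∈ Submodule.span K
        (Set.range fun π : LSPath (restrictBond b C) r => v π.1) := by
      rw [← hspan]
      exact ⟨_, (DirectSum.decompose 𝒜 x r).2, rfl⟩
    refine Submodule.span_mono ?_ h1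
    rintro _ ⟨π, rfl⟩
    exact ⟨⟨π.1, r, π.2⟩, rfl⟩
  · exact hspan

end ChainAlgebra

/-! ### Existence -/

section Existence

variable {S : Type u} [PartialOrder S] [Finite S] {b : S → S → ℕ}
variable {K : Type u} [Field K]

open Classical in
/-- The family, indexed by the chains, of the monomials with exponent `π`, for the chains that
contain the support of `π`. -/
noncomputable def monomialFamily (K : Type u) [Field K] (π : S → ℚ) :
    {C : Set S // IsChain (· ≤ ·) C} → AddMonoidAlgebra K (S → ℚ) :=
  fun C => if Function.support π ⊆ C.1 then AddMonoidAlgebra.single π 1 else 0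

theorem monomialFamily_mul {p q : S → ℚ} (hp : ∀ σ, 0 ≤ p σ) (hq : ∀ σ, 0 ≤ q σ) :
    monomialFamily K p * monomialFamily K q = monomialFamily K (p + q) := by
  ext1 C
  have : Function.support (p + q) ⊆ C.1 ↔ Function.support p ⊆ C.1 ∧ Function.support q ⊆ C.1 := by
    rw [← Set.union_subset_iff]
    have : Function.support (p + q) = Function.support p ∪ Function.support q := by
      ext σ; exact support_add_of_nonneg hp hq σ
    rw [this]
  simp only [Pi.mul_apply, monomialFamily]
  by_cases h1 : Function.support p ⊆ C.1
  · by_cases h2 : Function.support q ⊆ C.1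
    · rw [if_pos h1, if_pos h2, if_pos (this.2 ⟨h1, h2⟩), AddMonoidAlgebra.single_mul_single,
        one_mul]
    · rw [if_neg h2, if_neg fun h => h2 (this.1 h).2, mul_zero]
  · rw [if_neg h1, if_neg fun h => h1 (this.1 h).1, zero_mul]

theorem monomialFamily_mul_eq_zero {p q : S → ℚ} (h : ¬ ComparableSupports p q) :
    monomialFamily K p * monomialFamily K q = 0 := by
  ext1 C
  simp only [Pi.mul_apply, monomialFamily]
  by_cases h1 : Function.support p ⊆ C.1
  · by_cases h2 : Function.support q ⊆ C.1
    · exact absurd ⟨C.1, C.2, h1, h2⟩ h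
    · simp [h2]
  · simp [h1]

theorem monomialFamily_zero : monomialFamily K (0 : S → ℚ) = 1 := by
  ext1 C
  simp only [monomialFamily, Function.support_zero, Set.empty_subset, if_true]
  rfl

/-- The coefficient of `π` is read off in the component indexed by the support of `π`, at the
exponent `π`. -/
theorem linearIndependent_monomialFamily :
    LinearIndependent K fun π : AllLSPath b => monomialFamily K π.1 := by
  rw [linearIndependent_iff]
  intro c hc
  ext π
  obtain ⟨r, hr⟩ := π.2
  have h1 := congrArg (fun x => (x ⟨_, hr.isChain⟩).coeff π.1) hc
  simp only [Finsupp.linearCombination_apply, Finsupp.sum, Finset.sum_apply, Pi.smul_apply,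
    AddMonoidAlgebra.coeff_sum, Finsupp.finsetSum_apply, AddMonoidAlgebra.coeff_smul,
    Finsupp.smul_apply, Pi.zero_apply, AddMonoidAlgebra.coeff_zero, Finsupp.zero_apply] at h1
  rw [Finset.sum_eq_single π] at h1
  · simpa [monomialFamily] using h1
  · intro π' _ hne
    have : π'.1 ≠ π.1 := fun h => hne (Subtype.ext h)
    simp only [monomialFamily]
    split_ifs
    · simp [this]
    · simp
  · intro h
    simp [Finsupp.notMem_support_iff.1 h]

/-- The span of the monomial families in the product over all chains is closed under multiplication,
so the ring axioms are inherited. Two families multiply to zero exactly as required: no component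
sees two supports that lie in no common chain. -/
theorem exists_isDiscreteLSAlgebra (K : Type u) [Field K] (hb : IsPosetWithBonds b) :
    ∃ (A : Type u) (_ : CommRing A) (_ : Algebra K A) (𝒜 : ℕ → Submodule K A)
      (_ : GradedAlgebra 𝒜) (j : LSPath b 1 → 𝒜 1), IsDiscreteLSAlgebra b 𝒜 j := by
  classical
  let M := Submodule.span K (Set.range fun π : AllLSPath b => monomialFamily K π.1)
  have hM : ∀ {π : S → ℚ}, (∃ r, IsLSPath b r π) → monomialFamily K π ∈ M := fun h =>
    Submodule.subset_span ⟨⟨_, h⟩, rfl⟩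
  have hmul : ∀ p q : S → ℚ, (∃ r, IsLSPath b r p) → (∃ r, IsLSPath b r q) →
      ComparableSupports p q → monomialFamily K p * monomialFamily K q =
        monomialFamily K (p + q) := fun p q hp hq _ =>
    monomialFamily_mul hp.choose_spec.nonneg hq.choose_spec.nonneg
  let A : Subalgebra K ({C : Set S // IsChain (· ≤ ·) C} → AddMonoidAlgebra K (S → ℚ)) :=
    M.toSubalgebra (monomialFamily_zero (K := K) (S := S) ▸ hM ⟨0, .zero⟩) (by
      intro x y hx hy
      induction hx using Submodule.span_induction with
      | zero => simp
      | add x x' _ _ h h' => rw [add_mul]; exact add_mem h h'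
      | smul c x _ h => rw [smul_mul_assoc]; exact M.smul_mem c h
      | mem x h =>
        obtain ⟨p, rfl⟩ := h
        induction hy using Submodule.span_induction with
        | zero => simp
        | add x x' _ _ h h' => rw [mul_add]; exact add_mem h h'
        | smul c x _ h => rw [mul_smul_comm]; exact M.smul_mem c h
        | mem y h =>
          obtain ⟨q, rfl⟩ := h
          by_cases hc : ComparableSupports p.1 q.1
          · simp only
            rw [hmul _ _ p.2 q.2 hc]
            obtain ⟨r, hr⟩ := p.2
            obtain ⟨s, hs⟩ := q.2
            exact hM ⟨_, hr.add hb hs hc⟩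
          · simp only
            rw [monomialFamily_mul_eq_zero hc]
            exact zero_mem _)
  let v : (S → ℚ) → A := fun π =>
    if h : ∃ r, IsLSPath b r π then ⟨monomialFamily K π, hM h⟩ else 0
  have hv : ∀ {π : S → ℚ}, (∃ r, IsLSPath b r π) → (v π : _) = monomialFamily K π := fun h => by
    simp only [v, dif_pos h]
  have hli : LinearIndependent K fun π : AllLSPath b => v π.1 := by
    refine LinearIndependent.of_comp A.val.toLinearMap ?_
    have : A.val.toLinearMap ∘ (fun π : AllLSPath b => v π.1) =
        fun π : AllLSPath b => monomialFamily K π.1 := by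
      ext1 π
      exact hv π.2
    rw [this]
    exact linearIndependent_monomialFamily
  have hspan : Submodule.span K (Set.range fun π : AllLSPath b => v π.1) = ⊤ := by
    rw [eq_top_iff]
    rintro ⟨x, hx⟩ -
    refine Submodule.span_induction (p := fun x hx => (⟨x, hx⟩ : A) ∈
      Submodule.span K (Set.range fun π : AllLSPath b => v π.1)) ?_ ?_ ?_ ?_ hx
    · rintro _ ⟨π, rfl⟩
      exact Submodule.subset_span ⟨π, Subtype.ext (hv π.2)⟩
    · exact zero_mem _
    · exact fun x y hx hy h h' => add_mem h h'
    · exact fun c x hx h => Submodule.smul_mem _ c h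
  have h0 : v 0 = 1 := Subtype.ext ((hv ⟨0, .zero⟩).trans monomialFamily_zero)
  have hmulA : ∀ p q : S → ℚ, (∃ r, IsLSPath b r p) → (∃ r, IsLSPath b r q) →
      ComparableSupports p q → v p * v q = v (p + q) := by
    rintro p q ⟨r, hp⟩ ⟨s, hq⟩ hc
    refine Subtype.ext ?_
    rw [MulMemClass.coe_mul, hv ⟨r, hp⟩, hv ⟨s, hq⟩, hv ⟨_, hp.add hb hq hc⟩,
      hmul p q ⟨r, hp⟩ ⟨s, hq⟩ hc]
  have hmulA0 : ∀ p q : S → ℚ, (∃ r, IsLSPath b r p) → (∃ r, IsLSPath b r q) →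
      ¬ ComparableSupports p q → v p * v q = 0 := by
    intro p q hp hq hc
    refine Subtype.ext ?_
    rw [MulMemClass.coe_mul, hv hp, hv hq, monomialFamily_mul_eq_zero hc]
    rfl
  let 𝒜 : ℕ → Submodule K A := fun r => Submodule.span K (Set.range fun π : LSPath b r => v π.1)
  have hmem : ∀ {r} {π : S → ℚ}, IsLSPath b r π → v π ∈ 𝒜 r := fun h =>
    Submodule.subset_span ⟨⟨_, h⟩, rfl⟩
  let B := Module.Basis.mk hli hspan.ge
  choose deg hdeg using fun π : AllLSPath b => π.2
  let δ : A →ₗ[K] DirectSum ℕ (fun r => 𝒜 r) :=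
    B.constr K fun π => DirectSum.lof K ℕ (fun r => 𝒜 r) (deg π) ⟨v π.1, hmem (hdeg π)⟩
  have hδ : ∀ r (π : S → ℚ) (h : IsLSPath b r π), δ (v π) =
      DirectSum.lof K ℕ (fun r => 𝒜 r) r ⟨v π, hmem h⟩ := by
    intro r π h
    have h1 : B ⟨π, r, h⟩ = v π := by simp [B]
    -- The degree used in `δ` is a chosen one; it equals `r` because the degree of a path is unique,
    -- and the summand is transported along this equality.
    have key : ∀ s (hs : IsLSPath b s π), s = r →
        DirectSum.lof K ℕ (fun r => 𝒜 r) s ⟨v π, hmem hs⟩ =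
          DirectSum.lof K ℕ (fun r => 𝒜 r) r ⟨v π, hmem h⟩ := by
      rintro s hs rfl
      rfl
    refine Eq.trans ?_ (key _ (hdeg ⟨π, r, h⟩) ((hdeg ⟨π, r, h⟩).degree_eq h))
    exact (congrArg δ h1.symm).trans (B.constr_basis K _ _)
  let gr : GradedAlgebra 𝒜 :=
    { DirectSum.Decomposition.ofLinearMap 𝒜 δ (by
        refine B.ext fun π => ?_
        obtain ⟨r, hr⟩ := π.2
        have h1 : B π = v π.1 := by simp [B]
        rw [LinearMap.comp_apply, h1, hδ r _ hr, DirectSum.coeLinearMap_lof]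
        rfl) (by
        ext r ⟨x, hx⟩ : 2
        simp only [LinearMap.comp_apply, DirectSum.coeLinearMap_lof, LinearMap.id_apply]
        induction hx using Submodule.span_induction with
        | zero =>
          exact (LinearMap.map_zero δ).trans
            (LinearMap.map_zero (DirectSum.lof K ℕ (fun r => 𝒜 r) r)).symm
        | add x y hx hy h h' =>
          exact (LinearMap.map_add δ x y).trans ((congrArg₂ (· + ·) h h').trans
            (LinearMap.map_add (DirectSum.lof K ℕ (fun r => 𝒜 r) r) ⟨x, hx⟩ ⟨y, hy⟩).symm)
        | smul c x hx h =>
          exact (LinearMap.map_smul δ c x).trans ((congrArg (c • ·) h).trans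
            (LinearMap.map_smul (DirectSum.lof K ℕ (fun r => 𝒜 r) r) c ⟨x, hx⟩).symm)
        | mem x h =>
          obtain ⟨π, rfl⟩ := h
          exact hδ r _ π.2) with
      one_mem := h0 ▸ hmem .zero
      mul_mem := by
        intro r s x y hx hy
        induction hx using Submodule.span_induction with
        | zero => simp
        | add x x' _ _ h h' => rw [add_mul]; exact add_mem h h'
        | smul c x _ h => rw [smul_mul_assoc]; exact Submodule.smul_mem _ c h
        | mem x h =>
          obtain ⟨p, rfl⟩ := h
          induction hy using Submodule.span_induction with
          | zero => simp
          | add x x' _ _ h h' => rw [mul_add]; exact add_mem h h'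
          | smul c x _ h => rw [mul_smul_comm]; exact Submodule.smul_mem _ c h
          | mem y h =>
            obtain ⟨q, rfl⟩ := h
            simp only
            by_cases hc : ComparableSupports p.1 q.1
            · rw [hmulA _ _ ⟨r, p.2⟩ ⟨s, q.2⟩ hc]
              exact hmem (p.2.add hb q.2 hc)
            · rw [hmulA0 _ _ ⟨r, p.2⟩ ⟨s, q.2⟩ hc]
              exact zero_mem _ }
  exact ⟨A, inferInstance, inferInstance, 𝒜, gr, fun p => ⟨v p.1, hmem p.2⟩,
    .of_mul hb (v := v) (fun _ => rfl) h0 hmulA hmulA0 hli hspan fun _ => rfl⟩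

end Existence
end LSAlg

namespace LSAlg

/-! ### Morphisms between projective spectra -/

section Proj

open HomogeneousIdeal HomogeneousLocalization

section Ring

variable {A B C D σ τ ρ υ : Type u} [CommRing A] [SetLike σ A] [AddSubgroupClass σ A]
  [CommRing B] [SetLike τ B] [AddSubgroupClass τ B]
  [CommRing C] [SetLike ρ C] [AddSubgroupClass ρ C]
  [CommRing D] [SetLike υ D] [AddSubgroupClass υ D]
  {𝒜 : ℕ → σ} {ℬ : ℕ → τ} {𝒞 : ℕ → ρ} {𝒟 : ℕ → υ}
  [GradedRing 𝒜] [GradedRing ℬ] [GradedRing 𝒞] [GradedRing 𝒟]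
  (f : GradedRingHom 𝒜 ℬ) (hf : irrelevant ℬ ≤ (irrelevant 𝒜).map f)

theorem exists_mem_map_eq (hs : Function.Surjective f) {n : ℕ} {y : B} (hy : y ∈ ℬ n) :
    ∃ x ∈ 𝒜 n, f x = y := by
  obtain ⟨x, rfl⟩ := hs y
  refine ⟨DirectSum.decompose 𝒜 x n, (DirectSum.decompose 𝒜 x n).2, ?_⟩
  rw [GradedRingHom.map_directSumDecompose, DirectSum.decompose_of_mem_same ℬ hy]

theorem irrelevant_le_map_of_surjective (hs : Function.Surjective f) :
    irrelevant ℬ ≤ (irrelevant 𝒜).map f := by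
  rw [irrelevant_le]
  intro i hi y hy
  obtain ⟨x, hx, rfl⟩ := exists_mem_map_eq f hs hy
  exact Ideal.mem_map_of_mem f (mem_irrelevant_of_mem 𝒜 hi hx)

theorem awayMap_surjective (hs : Function.Surjective f) {i : ℕ} {s : A} (h : s ∈ 𝒜 i) :
    Function.Surjective (Away.map f s : Away 𝒜 s →+* Away ℬ (f s)) := by
  intro y
  obtain ⟨n, a, ha, rfl⟩ := Away.mk_surjective ℬ (f.2 h) y
  obtain ⟨x, hx, rfl⟩ := exists_mem_map_eq f hs ha
  exact ⟨Away.mk 𝒜 h n x hx, Away.map_mk f s h n x hx⟩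

theorem isPullback_awayι {i : ℕ} (hi : 0 < i) (s : A) (h : s ∈ 𝒜 i) :
    IsPullback (Spec.map (CommRingCat.ofHom (Away.map f s : Away 𝒜 s →+* Away ℬ (f s))))
      (Proj.awayι ℬ (f s) (f.2 h) hi) (Proj.awayι 𝒜 s h hi) (Proj.map f hf) := by
  refine IsOpenImmersion.isPullback _ _ _ _ (Proj.awayι_comp_map f hf hi s h) ?_
  rw [Proj.opensRange_awayι, Proj.opensRange_awayι, Proj.map_preimage_basicOpen]

/-- The preimage of a standard chart is a standard chart, and there the map is induced by a
surjection of degree zero localizations. -/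
theorem isClosedImmersion_map (hs : Function.Surjective f) :
    IsClosedImmersion (Proj.map f hf) := by
  have key : ∀ {i : ℕ} (hi : 0 < i) (s : A) (h : s ∈ 𝒜 i), IsClosedImmersion
      (Limits.pullback.snd (Proj.map f hf) (Proj.awayι 𝒜 s h hi)) := by
    intro i hi s h
    have : IsClosedImmersion (Spec.map (CommRingCat.ofHom
        (Away.map f s : Away 𝒜 s →+* Away ℬ (f s)))) :=
      IsClosedImmersion.spec_of_surjective _ (awayMap_surjective f hs h)
    rw [← (isPullback_awayι f hf hi s h).flip.isoPullback_inv_snd]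
    infer_instance
  exact IsZariskiLocalAtTarget.of_openCover (Proj.affineOpenCover 𝒜).openCover fun s =>
    key s.1.2 s.2.1 s.2.2

/-- On the chart the pullback sends `a / sⁿ` to `f a / (f s)ⁿ`, which is zero when a power of `f s`
kills `f a`. -/
theorem mem_ker_map_app {i : ℕ} (hi : 0 < i) {s : A} (h : s ∈ 𝒜 i) (n : ℕ) {a : A}
    (ha : a ∈ 𝒜 (n • i)) :
    (Proj.map f hf).app (Proj.basicOpen 𝒜 s) (Proj.awayToSection 𝒜 s (Away.mk 𝒜 h n a ha)) = 0 ↔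
      ∃ k, f (s ^ k * a) = 0 := by
  have h1 := congrArg (fun g => g.hom (Away.mk 𝒜 h n a ha))
    (Proj.awayToSection_comp_appLE f hf h)
  have h2 : Function.Injective (Proj.awayToSection ℬ (f s)) :=
    (Proj.basicOpenIsoAway ℬ (f s) (f.2 h) hi).commRingCatIsoToRingEquiv.injective
  have h3 : (Proj.map f hf).app (Proj.basicOpen 𝒜 s)
      (Proj.awayToSection 𝒜 s (Away.mk 𝒜 h n a ha)) =
      Proj.awayToSection ℬ (f s) (Away.map f s (Away.mk 𝒜 h n a ha)) := by
    rw [← Scheme.Hom.appLE_eq_app]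
    exact h1
  rw [h3, Away.map_mk]
  trans Away.mk ℬ (f.2 h) n (f a) (f.2 ha) = 0
  · exact ⟨fun h => h2 (h.trans (map_zero _).symm), fun h => by rw [h]; exact map_zero _⟩
  rw [HomogeneousLocalization.ext_iff_val, Away.val_mk, val_zero, Localization.mk_eq_mk',
    IsLocalization.mk'_eq_zero_iff]
  constructor
  · rintro ⟨⟨_, k, rfl⟩, hk⟩
    exact ⟨k, by simpa using hk⟩
  · rintro ⟨k, hk⟩
    exact ⟨⟨_, k, rfl⟩, by simpa using hk⟩

theorem iSup_basicOpen_pos (𝒜 : ℕ → σ) [GradedRing 𝒜] :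
    ⨆ s : Σ i : ℕ+, 𝒜 i, Proj.basicOpen 𝒜 s.2.1 = ⊤ := by
  refine Proj.iSup_basicOpen_eq_top 𝒜 _ ((toIdeal_irrelevant_le _).2 ?_)
  intro i hi x hx
  exact Ideal.subset_span ⟨⟨⟨i, hi⟩, x, hx⟩, rfl⟩

theorem ker_map_le_sup (g₁ : GradedRingHom 𝒜 𝒞) (hg₁ : irrelevant 𝒞 ≤ (irrelevant 𝒜).map g₁)
    (g₂ : GradedRingHom 𝒜 𝒟) (hg₂ : irrelevant 𝒟 ≤ (irrelevant 𝒜).map g₂)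
    [QuasiCompact (Proj.map f hf)] [QuasiCompact (Proj.map g₁ hg₁)]
    [QuasiCompact (Proj.map g₂ hg₂)]
    (h : ∀ x, f x = 0 → ∃ x₁ x₂, x = x₁ + x₂ ∧ g₁ x₁ = 0 ∧ g₂ x₂ = 0) :
    (Proj.map f hf).ker ≤ (Proj.map g₁ hg₁).ker ⊔ (Proj.map g₂ hg₂).ker := by
  refine Scheme.IdealSheafData.le_of_iSup_eq_top
    (fun s : Σ i : ℕ+, 𝒜 i => ⟨Proj.basicOpen 𝒜 s.2.1,
      Proj.isAffineOpen_basicOpen 𝒜 s.2.1 s.2.2 s.1.2⟩) (iSup_basicOpen_pos 𝒜) ?_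
  rintro ⟨i', s, hs⟩ y hy
  obtain ⟨i, hi, rfl⟩ : ∃ (i : ℕ) (hi : 0 < i), i' = ⟨i, hi⟩ := ⟨i', i'.2, rfl⟩
  replace hs : s ∈ 𝒜 i := hs
  rw [Scheme.IdealSheafData.ideal_sup, Pi.sup_apply, Scheme.Hom.ker_apply, Scheme.Hom.ker_apply]
  rw [Scheme.Hom.ker_apply] at hy
  obtain ⟨z, rfl⟩ :=
    (Proj.basicOpenIsoAway 𝒜 s hs hi).commRingCatIsoToRingEquiv.surjective y
  obtain ⟨n, a, ha, rfl⟩ := Away.mk_surjective 𝒜 hs z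
  obtain ⟨k, hk⟩ := (mem_ker_map_app f hf hi hs n ha).1 hy
  obtain ⟨x₁, x₂, hx, h1, h2⟩ := h _ hk
  have hka : s ^ k * a ∈ 𝒜 ((k + n) • i) := by
    rw [add_smul]
    exact SetLike.mul_mem_graded (SetLike.pow_mem_graded k hs) ha
  -- The summands need not be homogeneous. Their components of the degree of `s ^ k * a` still lie
  -- in the two kernels, since `g₁` and `g₂` are graded, and they are valid numerators over `s ^ (k
  -- + n)`.
  have e : s ^ k * a = DirectSum.decompose 𝒜 x₁ ((k + n) • i) +
      DirectSum.decompose 𝒜 x₂ ((k + n) • i) := by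
    rw [← DirectSum.decompose_of_mem_same 𝒜 hka, hx, DirectSum.decompose_add]
    rfl
  have e1 : Away.mk 𝒜 hs n a ha =
      Away.mk 𝒜 hs (k + n) _ (DirectSum.decompose 𝒜 x₁ ((k + n) • i)).2 +
      Away.mk 𝒜 hs (k + n) _ (DirectSum.decompose 𝒜 x₂ ((k + n) • i)).2 := by
    rw [HomogeneousLocalization.ext_iff_val, val_add]
    simp only [Away.val_mk]
    rw [Localization.add_mk_self, ← e, Localization.mk_eq_mk_iff, Localization.r_iff_exists]
    exact ⟨1, by simp only [OneMemClass.coe_one, one_mul]; ring⟩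
  have e2 : (Proj.basicOpenIsoAway 𝒜 s hs hi).commRingCatIsoToRingEquiv (Away.mk 𝒜 hs n a ha) =
      Proj.awayToSection 𝒜 s
        (Away.mk 𝒜 hs (k + n) _ (DirectSum.decompose 𝒜 x₁ ((k + n) • i)).2) +
      Proj.awayToSection 𝒜 s
        (Away.mk 𝒜 hs (k + n) _ (DirectSum.decompose 𝒜 x₂ ((k + n) • i)).2) := by
    rw [e1]
    exact map_add (Proj.awayToSection 𝒜 s).hom _ _
  rw [e2]
  refine Submodule.add_mem_sup ?_ ?_
  · refine (mem_ker_map_app g₁ hg₁ hi hs (k + n) _).2 ⟨0, ?_⟩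
    rw [pow_zero, one_mul, GradedRingHom.map_directSumDecompose, h1, DirectSum.decompose_zero]
    rfl
  · refine (mem_ker_map_app g₂ hg₂ hi hs (k + n) _).2 ⟨0, ?_⟩
    rw [pow_zero, one_mul, GradedRingHom.map_directSumDecompose, h2, DirectSum.decompose_zero]
    rfl

/-- A prime containing the kernel is the preimage of its image under a surjection; relevance of the
image follows from that of the prime. -/
theorem range_map (hs : Function.Surjective f) :
    Set.range (Proj.map f hf) = {x : Proj 𝒜 | ∀ a, f a = 0 →
      a ∈ (x : ProjectiveSpectrum 𝒜).asHomogeneousIdeal} := by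
  ext x
  constructor
  · rintro ⟨y, rfl⟩ a ha
    change f a ∈ (y : ProjectiveSpectrum ℬ).asHomogeneousIdeal
    rw [ha]
    exact zero_mem _
  · intro hx
    have hcm : ∀ a, f a ∈ (HomogeneousIdeal.map f
        (x : ProjectiveSpectrum 𝒜).asHomogeneousIdeal) ↔
        a ∈ (x : ProjectiveSpectrum 𝒜).asHomogeneousIdeal := by
      intro a
      constructor
      · intro h
        have h' : f a ∈ Ideal.map f.toRingHom
          (x : ProjectiveSpectrum 𝒜).asHomogeneousIdeal.toIdeal := h
        obtain ⟨c, hc, hce⟩ := (Ideal.mem_map_iff_of_surjective f.toRingHom hs).1 h'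
        have := hx (a - c) (by rw [map_sub, sub_eq_zero]; exact hce.symm)
        simpa using add_mem this hc
      · exact fun h => Ideal.mem_map_of_mem f h
    refine ⟨(⟨HomogeneousIdeal.map f (x : ProjectiveSpectrum 𝒜).asHomogeneousIdeal, ?_, ?_⟩ :
      ProjectiveSpectrum ℬ), ?_⟩
    · have := (x : ProjectiveSpectrum 𝒜).isPrime
      exact Ideal.map_isPrime_of_surjective (f := f.toRingHom) hs fun a ha => hx a ha
    · intro h
      refine (x : ProjectiveSpectrum 𝒜).not_irrelevant_le ?_
      intro a ha
      rw [← hcm]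
      refine h ?_
      rw [HomogeneousIdeal.mem_irrelevant_iff, GradedRing.proj_apply] at ha ⊢
      rw [← GradedRingHom.map_directSumDecompose, ha, map_zero]
    · refine ProjectiveSpectrum.ext (HomogeneousIdeal.ext (Ideal.ext fun a => ?_))
      exact hcm a

end Ring

/-! ### The structure morphism -/

section Algebra

variable {K A B : Type u} [Field K] [CommRing A] [Algebra K A] [CommRing B] [Algebra K B]
  {𝒜 : ℕ → Submodule K A} {ℬ : ℕ → Submodule K B} [GradedAlgebra 𝒜] [GradedAlgebra ℬ]
  (f : GradedRingHom 𝒜 ℬ) (hf : irrelevant ℬ ≤ (irrelevant 𝒜).map f)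

variable (𝒜) in
/-- The structure morphism of `projOver`. -/
noncomputable def structureMap : Proj 𝒜 ⟶ Spec (CommRingCat.of K) :=
  Proj.toSpecZero 𝒜 ≫ Spec.map (CommRingCat.ofHom (algebraMap K (𝒜 0)))

theorem awayι_structureMap {i : ℕ} (hi : 0 < i) (s : A) (h : s ∈ 𝒜 i) :
    Proj.awayι 𝒜 s h hi ≫ structureMap 𝒜 = Spec.map (CommRingCat.ofHom
      ((fromZeroRingHom 𝒜 (.powers s)).comp (algebraMap K (𝒜 0)))) := by
  rw [structureMap, Proj.awayι_toSpecZero_assoc, ← Spec.map_comp, ← CommRingCat.ofHom_comp]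

theorem map_structureMap (hK : ∀ k, f (algebraMap K A k) = algebraMap K B k) :
    Proj.map f hf ≫ structureMap 𝒜 = structureMap ℬ := by
  refine (Proj.mapAffineOpenCover f hf).openCover.hom_ext _ _ fun s => ?_
  have key : ∀ {i : ℕ} (hi : 0 < i) (s : A) (h : s ∈ 𝒜 i),
      Proj.awayι ℬ (f s) (f.2 h) hi ≫ Proj.map f hf ≫ structureMap 𝒜 =
        Proj.awayι ℬ (f s) (f.2 h) hi ≫ structureMap ℬ := by
    intro i hi s h
    rw [Proj.awayι_comp_map_assoc f hf hi s h, awayι_structureMap, awayι_structureMap,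
      ← Spec.map_comp, ← CommRingCat.ofHom_comp]
    congr 2
    ext k
    change ((Away.map f s) (fromZeroRingHom 𝒜 _ (algebraMap K (𝒜 0) k))).val =
      (fromZeroRingHom ℬ _ (algebraMap K (ℬ 0) k)).val
    have h1 : fromZeroRingHom 𝒜 (.powers s) (algebraMap K (𝒜 0) k) =
      Away.mk 𝒜 h 0 (algebraMap K A k) (by
        rw [zero_smul]; exact (algebraMap K (𝒜 0) k).2) := by
      rw [HomogeneousLocalization.ext_iff_val, Away.val_mk]
      simp only [pow_zero]
      rfl
    rw [h1, Away.map_mk, Away.val_mk]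
    simp only [pow_zero, hK]
    rfl
  exact key s.1.2 s.2.1 s.2.2

end Algebra

end Proj

end LSAlg

namespace LSAlg

/-! ### The subvarieties of chains -/

section ChainVariety

variable {S : Type u} [PartialOrder S] [Finite S] {b : S → S → ℕ}
variable {K A : Type u} [Field K] [CommRing A] [Algebra K A] {𝒜 : ℕ → Submodule K A}
  [GradedAlgebra 𝒜] {j : LSPath b 1 → 𝒜 1}
variable (hb : IsPosetWithBonds b) (hA : IsDiscreteLSAlgebra b 𝒜 j)

theorem quotHom_surjective (I : HomogeneousIdeal 𝒜) : Function.Surjective (quotHom 𝒜 I) :=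
  Ideal.Quotient.mk_surjective

theorem quotHom_eq_zero_iff {I : HomogeneousIdeal 𝒜} {x : A} : quotHom 𝒜 I x = 0 ↔ x ∈ I :=
  Ideal.Quotient.eq_zero_iff_mem

theorem isClosedImmersion_chainι (C : Set S) : IsClosedImmersion (chainι j C) :=
  isClosedImmersion_map _ _ (quotHom_surjective _)

theorem chainι_hom (C : Set S) : chainι j C ≫ (projOver 𝒜).hom = (chainVariety j C).hom :=
  map_structureMap _ _ fun _ => rfl

/-- The map `A / I → A / J` for `I ≤ J`, as a homomorphism of graded rings. -/
def factorHom {I J : HomogeneousIdeal 𝒜} (h : I ≤ J) :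
    GradedRingHom (quotGrading 𝒜 I) (quotGrading 𝒜 J) where
  toRingHom := Ideal.Quotient.factor h
  map_mem := by
    rintro r _ ⟨x, hx, rfl⟩
    exact ⟨x, hx, rfl⟩

theorem factorHom_surjective {I J : HomogeneousIdeal 𝒜} (h : I ≤ J) :
    Function.Surjective (factorHom h) := by
  intro y
  obtain ⟨x, rfl⟩ := quotHom_surjective J y
  exact ⟨quotHom 𝒜 I x, rfl⟩

theorem map_factorHom_comp {I J : HomogeneousIdeal 𝒜} (h : I ≤ J) :
    Proj.map (factorHom h) (irrelevant_le_map_of_surjective _ (factorHom_surjective h)) ≫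
      Proj.map (quotHom 𝒜 I) (irrelevant_le_map_quotHom 𝒜 I) =
    Proj.map (quotHom 𝒜 J) (irrelevant_le_map_quotHom 𝒜 J) := by
  rw [← Proj.map_comp]
  rfl

theorem chainIdeal_anti {C D : Set S} (h : C ⊆ D) : chainIdeal j D ≤ chainIdeal j C :=
  Ideal.span_mono fun _ ⟨p, hp, e⟩ => ⟨p, fun h' => hp (h'.trans h), e⟩

theorem chainIdeal_inter_le (C D : Set S) :
    (chainIdeal j (C ∩ D)).toIdeal ≤ (chainIdeal j C).toIdeal ⊔ (chainIdeal j D).toIdeal := by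
  refine Ideal.span_le.2 ?_
  rintro _ ⟨p, hp, rfl⟩
  by_cases h : Function.support p.1 ⊆ C
  · exact Ideal.mem_sup_right
      (Ideal.subset_span ⟨p, fun h' => hp (Set.subset_inter h h'), rfl⟩)
  · exact Ideal.mem_sup_left (Ideal.subset_span ⟨p, h, rfl⟩)

/-- A morphism to `X` through both `Z₁` and `Z₂` kills both ideal sheaves, hence that of `Z`, and so
factors through `Z`. Uniqueness holds because closed immersions are monomorphisms. -/
theorem isPullback_of_ker_le_sup {X Z₁ Z₂ Z : Scheme.{u}} {i₁ : Z₁ ⟶ X} {i₂ : Z₂ ⟶ X} {i : Z ⟶ X}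
    {f : Z ⟶ Z₁} {g : Z ⟶ Z₂} [IsClosedImmersion i₁] [IsClosedImmersion i₂] [IsClosedImmersion i]
    (hf : f ≫ i₁ = i) (hg : g ≫ i₂ = i) (h : i.ker ≤ i₁.ker ⊔ i₂.ker) : IsPullback f g i₁ i₂ := by
  refine ⟨⟨hf.trans hg.symm⟩, ⟨Limits.PullbackCone.IsLimit.mk _
    (fun s => IsClosedImmersion.lift i (s.fst ≫ i₁) (h.trans (sup_le ?_ ?_))) ?_ ?_ ?_⟩⟩
  · exact Scheme.Hom.le_ker_comp _ _
  · rw [s.condition]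
    exact Scheme.Hom.le_ker_comp _ _
  · intro s
    rw [← cancel_mono i₁, Category.assoc, hf, IsClosedImmersion.lift_fac]
  · intro s
    rw [← cancel_mono i₂, Category.assoc, hg, IsClosedImmersion.lift_fac, s.condition]
  · intro s m hm _
    rw [← cancel_mono i, IsClosedImmersion.lift_fac, ← hm, Category.assoc, hf]

theorem exists_isPullback_chainι (C D : Set S) :
    ∃ (f : (chainVariety j (C ∩ D)).left ⟶ (chainVariety j C).left)
      (g : (chainVariety j (C ∩ D)).left ⟶ (chainVariety j D).left),
      f ≫ chainι j C = chainι j (C ∩ D) ∧ IsPullback f g (chainι j C) (chainι j D) := by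
  have hf := map_factorHom_comp (chainIdeal_anti (j := j) (Set.inter_subset_left : C ∩ D ⊆ C))
  have hg := map_factorHom_comp (chainIdeal_anti (j := j) (Set.inter_subset_right : C ∩ D ⊆ D))
  have := isClosedImmersion_chainι (j := j) C
  have := isClosedImmersion_chainι (j := j) D
  have := isClosedImmersion_chainι (j := j) (C ∩ D)
  have hker : (chainι j (C ∩ D)).ker ≤ (chainι j C).ker ⊔ (chainι j D).ker := by
    refine @ker_map_le_sup _ _ _ _ _ _ _ _ _ _ _ _ _ _ _ _ _ _ _ _ _ _ _ _ _ _ _ _ _ _ _ _ _ _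
      (inferInstanceAs (QuasiCompact (chainι j (C ∩ D))))
      (inferInstanceAs (QuasiCompact (chainι j C))) (inferInstanceAs (QuasiCompact (chainι j D))) ?_
    intro x hx
    obtain ⟨x₁, h₁, x₂, h₂, rfl⟩ := Submodule.mem_sup.1
      (chainIdeal_inter_le C D (quotHom_eq_zero_iff.1 hx))
    exact ⟨x₁, x₂, rfl, quotHom_eq_zero_iff.2 h₁, quotHom_eq_zero_iff.2 h₂⟩
  exact ⟨_, _, hf, isPullback_of_ker_le_sup (i₁ := chainι j C) (i₂ := chainι j D)
    (i := chainι j (C ∩ D)) hf hg hker⟩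

/-! ### Irreducible components -/

theorem range_chainι (C : Set S) : Set.range (chainι j C) =
    {x : Proj 𝒜 | chainIdeal j C ≤ (x : ProjectiveSpectrum 𝒜).asHomogeneousIdeal} := by
  refine (range_map _ _ (quotHom_surjective _)).trans ?_
  ext x
  exact forall_congr' fun a => imp_congr_left quotHom_eq_zero_iff

include hA in
-- Paths with incomparable supports have product zero, so a prime contains one of them. Hence the
-- supports of the paths outside `x` unite to a chain, which extends to a maximal one.
theorem exists_isMaxChain_le (x : ProjectiveSpectrum 𝒜) :
    ∃ C : Set S, IsMaxChain (· ≤ ·) C ∧ chainIdeal j C ≤ x.asHomogeneousIdeal := by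
  let D : Set S := {σ | ∃ p : LSPath b 1, (j p : A) ∉ x.asHomogeneousIdeal ∧ p.1 σ ≠ 0}
  have hD : IsChain (· ≤ ·) D := by
    rintro σ ⟨p, hp, hσ⟩ τ ⟨q, hq, hτ⟩ -
    by_cases hc : ComparableSupports p.1 q.1
    · obtain ⟨E, hE, h1, h2⟩ := hc
      exact hE.total (h1 hσ) (h2 hτ)
    · exfalso
      have h0 := hA.mul_of_not_comparable p q (fun h => hc h.comparableSupports) hc
      rcases x.isPrime.mem_or_mem (h0 ▸ zero_mem _ : (j p : A) * j q ∈ x.asHomogeneousIdeal.toIdeal)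
        with h | h
      exacts [hp h, hq h]
  obtain ⟨C, hC⟩ := hD.exists_subset_flag
  refine ⟨C, C.maxChain, Ideal.span_le.2 ?_⟩
  rintro _ ⟨p, hp, rfl⟩
  by_contra h
  exact hp fun σ hσ => hC ⟨p, h, hσ⟩

include hb hA in
-- The ideal is the kernel of a homomorphism to the domain `K[ℚ^S]`.
theorem isPrime_chainIdeal {C : Set S} (hC : IsChain (· ≤ ·) C) :
    (chainIdeal j C).toIdeal.IsPrime := by
  rw [← hA.ker_toMonomials hb hC]
  exact RingHom.ker_isPrime _

/-- The LS-path with support `{σ}`. -/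
noncomputable def extremalPath (b : S → S → ℕ) (σ : S) : LSPath b 1 :=
  open Classical in ⟨Pi.single σ 1, isLSPath_single σ⟩

include hb hA in
theorem extremalPath_mem_chainIdeal_iff {C : Set S} (hC : IsChain (· ≤ ·) C) {σ : S} :
    (j (extremalPath b σ) : A) ∈ chainIdeal j C ↔ σ ∉ C := by
  classical
  constructor
  · intro h hσ
    have h1 : (j (extremalPath b σ) : A) ∈ (chainIdeal j C).toIdeal := h
    rw [← hA.ker_toMonomials hb hC, RingHom.mem_ker, ← pathVec_coe] at h1
    have h2 := hA.toMonomials_pathVec hb hC ⟨1, (extremalPath b σ).2⟩ (fun τ hτ => by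
      by_cases e : τ = σ
      · exact e ▸ hσ
      · exact absurd (Pi.single_eq_of_ne e 1) hτ)
    have h3 := h2.symm.trans h1
    rw [AddMonoidAlgebra.single_eq_zero] at h3
    exact one_ne_zero h3
  · intro h
    exact Ideal.subset_span ⟨_, fun h' => h (h' (by simp [extremalPath])), rfl⟩

/-- The generic point of the subvariety of a non-empty chain. -/
noncomputable def chainPoint {C : Set S} (hC : IsChain (· ≤ ·) C) (hne : C.Nonempty) :
    ProjectiveSpectrum 𝒜 where
  asHomogeneousIdeal := chainIdeal j C
  isPrime := isPrime_chainIdeal hb hA hC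
  not_irrelevant_le h := by
    obtain ⟨σ, hσ⟩ := hne
    exact (extremalPath_mem_chainIdeal_iff hb hA hC).1
      (h (HomogeneousIdeal.mem_irrelevant_of_mem 𝒜 one_pos (j (extremalPath b σ)).2)) hσ

include hb hA in
theorem range_chainι_eq_closure {C : Set S} (hC : IsChain (· ≤ ·) C) (hne : C.Nonempty) :
    Set.range (chainι j C) =
      closure {(chainPoint hb hA hC hne : (projOver 𝒜).left)} := by
  rw [range_chainι]
  ext x
  exact ProjectiveSpectrum.le_iff_mem_closure 𝒜 (chainPoint hb hA hC hne) x

include hb hA in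
theorem range_chainι_subset_iff {C D : Set S} (hC : IsChain (· ≤ ·) C) (hne : C.Nonempty)
    (hD : IsChain (· ≤ ·) D) :
    Set.range (chainι j C) ⊆ Set.range (chainι j D) ↔ C ⊆ D := by
  rw [range_chainι, range_chainι]
  constructor
  · intro h σ hσ
    by_contra hσD
    have h1 : chainIdeal j D ≤ chainIdeal j C :=
      h (a := chainPoint hb hA hC hne) (le_refl (chainIdeal j C))
    exact (extremalPath_mem_chainIdeal_iff hb hA hC).1
      (h1 ((extremalPath_mem_chainIdeal_iff hb hA hD).2 hσD)) hσ
  · intro h x hx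
    exact (chainIdeal_anti h).trans hx

include hb hA in
-- The `X_C` of the finitely many maximal chains are closed, irreducible, cover `X`, and are
-- pairwise not contained in one another because containment of varieties is containment of chains.
theorem bijOn_irreducibleComponents [Nonempty S] :
    Set.BijOn (fun C : Set S => Set.range (chainι j C))
      {C : Set S | IsMaxChain (· ≤ ·) C} (irreducibleComponents (projOver 𝒜).left) := by
  have hne : ∀ {C : Set S}, IsMaxChain (· ≤ ·) C → C.Nonempty := fun h =>
    h.nonempty_iff.1 inferInstance
  have hcl : ∀ {C : Set S}, IsMaxChain (· ≤ ·) C → IsClosed (Set.range (chainι j C)) := by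
    intro C hC
    rw [range_chainι_eq_closure hb hA hC.isChain (hne hC)]
    exact isClosed_closure
  have hirr : ∀ {C : Set S}, IsMaxChain (· ≤ ·) C → IsIrreducible (Set.range (chainι j C)) := by
    intro C hC
    rw [range_chainι_eq_closure hb hA hC.isChain (hne hC)]
    exact isIrreducible_singleton.closure
  have hcov : ∀ Z : Set (projOver 𝒜).left, IsIrreducible Z →
      ∃ C : Set S, IsMaxChain (· ≤ ·) C ∧ Z ⊆ Set.range (chainι j C) := by
    intro Z hZ
    have hfin := (Set.toFinite {C : Set S | IsMaxChain (· ≤ ·) C}).image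
      fun C => Set.range (chainι j C)
    obtain ⟨z, hz, hZz⟩ := isIrreducible_iff_sUnion_isClosed.1 hZ hfin.toFinset (by
      intro z hz
      obtain ⟨C, hC, rfl⟩ := hfin.mem_toFinset.1 hz
      exact hcl hC) (by
      intro x _
      obtain ⟨C, hC, hx⟩ := exists_isMaxChain_le hA x
      refine ⟨_, hfin.mem_toFinset.2 ⟨C, hC, rfl⟩, ?_⟩
      exact (range_chainι C).ge hx)
    obtain ⟨C, hC, rfl⟩ := hfin.mem_toFinset.1 hz
    exact ⟨C, hC, hZz⟩
  refine ⟨fun C hC => ⟨hirr hC, fun Z hZ hCZ => ?_⟩, fun C hC D hD h => ?_, fun Z hZ => ?_⟩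
  · obtain ⟨D, hD, hZD⟩ := hcov Z hZ
    have := (range_chainι_subset_iff hb hA hC.isChain (hne hC) hD.isChain).1 (hCZ.trans hZD)
    rwa [hC.2 hD.isChain this]
  · exact hC.2 hD.isChain
      ((range_chainι_subset_iff hb hA hC.isChain (hne hC) hD.isChain).1 h.subset)
  · obtain ⟨C, hC, hZC⟩ := hcov Z hZ.1
    exact ⟨C, hC, (hZ.2 (hirr hC) hZC).antisymm hZC⟩

end ChainVariety

end LSAlg

namespace LSAlg

/-! ### Projectivity -/

section Projective

variable {K A : Type u} [Field K] [CommRing A] [Algebra K A] {𝒜 : ℕ → Submodule K A}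
  [GradedAlgebra 𝒜]

theorem aeval_mem_of_isHomogeneous {m : Type*} {x : m → A} (hx : ∀ i, x i ∈ 𝒜 1)
    {r : ℕ} {p : MvPolynomial m K} (hp : p.IsHomogeneous r) : MvPolynomial.aeval x p ∈ 𝒜 r := by
  rw [p.as_sum, map_sum]
  refine Submodule.sum_mem _ fun d hd => ?_
  rw [MvPolynomial.aeval_monomial, ← Algebra.smul_def]
  refine Submodule.smul_mem _ _ ?_
  have h1 := hp (MvPolynomial.mem_support_iff.1 hd)
  rw [Finsupp.weight_apply] at h1
  rw [← h1]
  exact SetLike.prod_pow_mem_graded 𝒜 (fun _ => 1) x (fun i => d i) fun i _ => hx i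

attribute [local instance] MvPolynomial.gradedAlgebra

/-- The graded homomorphism from a polynomial ring given by elements of degree one. -/
noncomputable def aevalHom {m : Type*} {x : m → A} (hx : ∀ i, x i ∈ 𝒜 1) :
    GradedRingHom (MvPolynomial.homogeneousSubmodule m K) 𝒜 where
  toRingHom := (MvPolynomial.aeval x).toRingHom
  map_mem := fun h => aeval_mem_of_isHomogeneous hx ((MvPolynomial.mem_homogeneousSubmodule _ _).1 h)

theorem aevalHom_surjective {m : Type*} {x : m → A} (hx : ∀ i, x i ∈ 𝒜 1)
    (h : Algebra.adjoin K (Set.range x) = ⊤) : Function.Surjective (aevalHom hx) := by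
  rw [Algebra.adjoin_range_eq_range_aeval] at h
  exact (AlgHom.range_eq_top _).1 h

theorem isProjectiveOver_projOver {n : ℕ} {x : Fin (n + 1) → A} (hx : ∀ i, x i ∈ 𝒜 1)
    (h : Algebra.adjoin K (Set.range x) = ⊤) : IsProjectiveOver (projOver 𝒜) := by
  have hs := aevalHom_surjective hx h
  have hi := irrelevant_le_map_of_surjective _ hs
  exact ⟨n, Over.homMk (Proj.map (aevalHom hx) hi)
    (map_structureMap _ hi fun k => MvPolynomial.aeval_C x k), isClosedImmersion_map _ hi hs⟩

/-- Degree zero elements lift to polynomials of degree zero, that is constants. This makes `Spec 𝒜₀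
→ Spec K` a closed immersion, so the finiteness properties over `K` follow from those over `𝒜₀`. -/
theorem algebraMap_zero_surjective {m : Type u} {x : m → A} (hx : ∀ i, x i ∈ 𝒜 1)
    (h : Algebra.adjoin K (Set.range x) = ⊤) : Function.Surjective (algebraMap K (𝒜 0)) := by
  rintro ⟨y, hy⟩
  obtain ⟨p, hp, rfl⟩ := exists_mem_map_eq _ (aevalHom_surjective hx h) hy
  rw [MvPolynomial.mem_homogeneousSubmodule, ← MvPolynomial.totalDegree_zero_iff_isHomogeneous,
    MvPolynomial.totalDegree_eq_zero_iff_eq_C] at hp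
  exact ⟨MvPolynomial.coeff 0 p, Subtype.ext
    ((MvPolynomial.aeval_C x _).symm.trans (congrArg (aevalHom hx) hp.symm))⟩

theorem finiteType_projOver {m : Type u} [Finite m] {x : m → A} (hx : ∀ i, x i ∈ 𝒜 1)
    (h : Algebra.adjoin K (Set.range x) = ⊤) :
    IsSeparated (projOver 𝒜).hom ∧ LocallyOfFiniteType (projOver 𝒜).hom ∧
      QuasiCompact (projOver 𝒜).hom := by
  have : Algebra.FiniteType K A := ⟨⟨(Set.finite_range x).toFinset, by simpa using h⟩⟩
  have : @IsScalarTower K (𝒜 0) A Algebra.toSMul Algebra.toSMul Algebra.toSMul :=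
    .of_algebraMap_eq fun _ => rfl
  have : Algebra.FiniteType (𝒜 0) A := .of_restrictScalars_finiteType K _ _
  have : IsClosedImmersion (Spec.map (CommRingCat.ofHom (algebraMap K (𝒜 0)))) :=
    IsClosedImmersion.spec_of_surjective _ (algebraMap_zero_surjective hx h)
  change IsSeparated (structureMap 𝒜) ∧ LocallyOfFiniteType (structureMap 𝒜) ∧
    QuasiCompact (structureMap 𝒜)
  unfold structureMap
  exact ⟨inferInstance, inferInstance, inferInstance⟩

end Projective

/-! ### Generation of LS algebras by finitely many paths of degree one -/

section LSAlgebra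

variable {S : Type u} [PartialOrder S] [Finite S] {b : S → S → ℕ}
variable {K A : Type u} [Field K] [CommRing A] [Algebra K A] {𝒜 : ℕ → Submodule K A}
  {j : LSPath b 1 → 𝒜 1}

theorem IsLSAlgebra.adjoin_range (hA : IsLSAlgebra b 𝒜 j) :
    Algebra.adjoin K (Set.range fun p : LSPath b 1 => (j p : A)) = ⊤ := by
  rw [eq_top_iff]
  intro x _
  refine hA.induction x (fun π ⟨r, h⟩ => ?_) (zero_mem _) (fun _ _ => add_mem)
    fun c _ h => Subalgebra.smul_mem _ h c
  obtain ⟨l, hl⟩ := h.exists_canonicalForm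
  rw [pathVec_of_isCanonicalForm j hl]
  refine list_prod_mem fun y hy => ?_
  obtain ⟨p, -, rfl⟩ := List.mem_map.1 hy
  exact Algebra.subset_adjoin ⟨p, rfl⟩

variable [GradedAlgebra 𝒜]

theorem IsLSAlgebra.isProjectiveOver [Nonempty S] (hb : IsPosetWithBonds b)
    (hA : IsLSAlgebra b 𝒜 j) : IsProjectiveOver (projOver 𝒜) := by
  have := finite_lsPath hb 1
  obtain ⟨n, ⟨e⟩⟩ := Finite.exists_equiv_fin (LSPath b 1)
  obtain ⟨σ⟩ := ‹Nonempty S›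
  obtain ⟨m, rfl⟩ : ∃ m, n = m + 1 :=
    Nat.exists_eq_succ_of_ne_zero (by rintro rfl; exact (e (extremalPath b σ)).elim0)
  refine isProjectiveOver_projOver (x := fun i => j (e.symm i)) (fun i => (j _).2) ?_
  rw [← hA.adjoin_range]
  congr 1
  exact e.symm.surjective.range_comp (fun p : LSPath b 1 => (j p : A))

theorem IsDiscreteLSAlgebra.isProjectiveOver_chainVariety (hb : IsPosetWithBonds b)
    (hA : IsDiscreteLSAlgebra b 𝒜 j) {C : Set S} (hC : IsChain (· ≤ ·) C) (hne : C.Nonempty) :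
    IsProjectiveOver (chainVariety j C) := by
  obtain ⟨jC, -, h⟩ := hA.chain hb hC
  have := hne.to_subtype
  exact h.isProjectiveOver (hb.restrictBond hC)

end LSAlgebra

end LSAlg

namespace LSAlg

/-! ### Extending the multiplication of a monoid scheme to an action -/

section Action

open MonoidalCategory CartesianMonoidalCategory MonObj

variable {K : Type u} [Field K]

/-- Geometric integrality of the torus keeps the products integral, so their nonempty opens are
dense and identities can be checked there. -/
theorem isIntegral_tensor {T X : Over (Spec (CommRingCat.of K))} [GeometricallyIntegral T.hom]
    [LocallyOfFiniteType X.hom] [IsIntegral X.left] : IsIntegral (T ⊗ X).left := by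
  have : IsLocallyNoetherian X.left := LocallyOfFiniteType.isLocallyNoetherian X.hom
  exact inferInstanceAs (IsIntegral (Limits.pullback T.hom X.hom))

theorem locallyOfFiniteType_tensor {T X : Over (Spec (CommRingCat.of K))}
    [LocallyOfFiniteType T.hom] [LocallyOfFiniteType X.hom] :
    LocallyOfFiniteType (T ⊗ X).hom := by
  change LocallyOfFiniteType (Limits.pullback.fst T.hom X.hom ≫ T.hom)
  infer_instance

theorem isPullback_whiskerLeft (T : Over (Spec (CommRingCat.of K)))
    {X Y : Over (Spec (CommRingCat.of K))} (f : X ⟶ Y) :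
    IsPullback (T ◁ f).left (Limits.pullback.snd T.hom X.hom) (Limits.pullback.snd T.hom Y.hom)
      f.left := by
  refine IsPullback.of_right (h₁₂ := Limits.pullback.fst T.hom Y.hom) ?_
    (Over.whiskerLeft_left_snd f) (IsPullback.of_hasPullback T.hom Y.hom)
  rw [Over.whiskerLeft_left_fst, Over.w]
  exact IsPullback.of_hasPullback T.hom X.hom

theorem isOpenImmersion_whiskerLeft (T : Over (Spec (CommRingCat.of K)))
    {X Y : Over (Spec (CommRingCat.of K))} (f : X ⟶ Y) [IsOpenImmersion f.left] :
    IsOpenImmersion (T ◁ f).left :=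
  MorphismProperty.of_isPullback (isPullback_whiskerLeft T f).flip ‹_›

theorem over_hom_ext {V X Y : Over (Spec (CommRingCat.of K))} (d : V ⟶ Y) {f g : Y ⟶ X}
    [IsOpenImmersion d.left] [Nonempty V.left] [IsIntegral Y.left] [IsSeparated X.hom]
    (h : d ≫ f = d ≫ g) : f = g := by
  have hd : IsDominant d.left := by
    refine ⟨?_⟩
    exact d.left.isOpenEmbedding.isOpen_range.dense (Set.range_nonempty _)
  ext1
  exact ext_of_isDominant_of_isSeparated X.hom (by simp) d.left
    (congrArg CommaMorphism.left h)

theorem mem_range_whiskerLeft (T : Over (Spec (CommRingCat.of K)))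
    {X Y : Over (Spec (CommRingCat.of K))} (f : X ⟶ Y) (z : (T ⊗ Y).left)
    (hz : Limits.pullback.snd T.hom Y.hom z ∈ Set.range f.left) :
    z ∈ Set.range (T ◁ f).left := by
  have h := isPullback_whiskerLeft T f
  obtain ⟨y, hy⟩ := (Scheme.Pullback.range_fst ..).ge hz
  refine ⟨h.isoPullback.inv y, ?_⟩
  rw [← Scheme.Hom.comp_apply, h.isoPullback_inv_fst, hy]

theorem isIntegral_left_of_iso {X Y : Over (Spec (CommRingCat.of K))} (e : Y ≅ X)
    [IsIntegral X.left] : IsIntegral Y.left := by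
  have : IsIso e.hom.left := inferInstanceAs (IsIso ((Over.forget _).map e.hom))
  have : Nonempty Y.left := ⟨e.inv.left (Classical.arbitrary _)⟩
  exact isIntegral_of_isOpenImmersion e.hom.left

variable {T X : Over (Spec (CommRingCat.of K))} [MonObj T] [GeometricallyIntegral T.hom]
  [LocallyOfFiniteType T.hom] [IsIntegral T.left] [IsIntegral X.left] [LocallyOfFiniteType X.hom]
  [IsSeparated X.hom] {i : T ⟶ X} [IsOpenImmersion i.left]

/-- An extension of the multiplication of `T` to `T × X` is an action. -/
@[reducible] def modObjOfExtends (act : T ⊗ X ⟶ X) (h : T ◁ i ≫ act = μ ≫ i) : ModObj T X where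
  smul := act
  one_smul := by
    change η ▷ X ≫ act = (λ_ X).hom
    have : IsIntegral (𝟙_ (Over (Spec (CommRingCat.of K))) ⊗ X).left :=
      isIntegral_left_of_iso (λ_ X)
    have : IsOpenImmersion (𝟙_ (Over (Spec (CommRingCat.of K))) ◁ i).left :=
      isOpenImmersion_whiskerLeft _ i
    have : IsIntegral (𝟙_ (Over (Spec (CommRingCat.of K))) ⊗ T).left :=
      isIntegral_left_of_iso (λ_ T)
    -- By density it suffices to check the axiom after restricting `X` to `T`, where it is the unit
    -- law of `T`; associativity below is treated alike.
    refine over_hom_ext (𝟙_ _ ◁ i) ?_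
    rw [whisker_exchange_assoc, h, MonObj.one_mul_assoc, leftUnitor_naturality]
  mul_smul := by
    change μ ▷ X ≫ act = (α_ T T X).hom ≫ T ◁ act ≫ act
    have : IsIntegral (T ⊗ X).left := isIntegral_tensor
    have := locallyOfFiniteType_tensor (T := T) (X := X)
    have : IsIntegral (T ⊗ T ⊗ X).left := isIntegral_tensor
    have : IsIntegral ((T ⊗ T) ⊗ X).left := isIntegral_left_of_iso (α_ T T X)
    have : IsIntegral (T ⊗ T).left := isIntegral_tensor
    have := locallyOfFiniteType_tensor (T := T) (X := T)
    have : IsIntegral (T ⊗ T ⊗ T).left := isIntegral_tensor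
    have : IsIntegral ((T ⊗ T) ⊗ T).left := isIntegral_left_of_iso (α_ T T T)
    have : IsOpenImmersion ((T ⊗ T) ◁ i).left := isOpenImmersion_whiskerLeft _ i
    refine over_hom_ext ((T ⊗ T) ◁ i) ?_
    rw [whisker_exchange_assoc, h, MonObj.mul_assoc_assoc, tensor_whiskerLeft, Category.assoc,
      Category.assoc, Iso.inv_hom_id_assoc, ← whiskerLeft_comp_assoc, h, whiskerLeft_comp_assoc, h]

/-- If an integral scheme `X` containing `T` as an open subscheme is covered by monoid schemes
containing `T` as a submonoid, then the multiplication of `T` extends to `X`. -/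
theorem exists_extends {I : Type u} [Nonempty I] (U : I → Over (Spec (CommRingCat.of K)))
    [∀ p, MonObj (U p)] (c : ∀ p, U p ⟶ X) [∀ p, IsOpenImmersion (c p).left]
    (hc : ∀ x : X.left, ∃ p, x ∈ Set.range (c p).left) (r : ∀ p, T ⟶ U p) [∀ p, IsMonHom (r p)]
    (hr : ∀ p, r p ≫ c p = i) : ∃ act : T ⊗ X ⟶ X, T ◁ i ≫ act = μ ≫ i := by
  have : IsIntegral (T ⊗ X).left := isIntegral_tensor
  have : IsIntegral (T ⊗ T).left := isIntegral_tensor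
  have : ∀ p, IsOpenImmersion (T ◁ c p).left := fun p => isOpenImmersion_whiskerLeft _ _
  have : IsOpenImmersion (T ◁ i).left := isOpenImmersion_whiskerLeft _ _
  let 𝒰 : Scheme.OpenCover.{u} (T ⊗ X).left := Scheme.Cover.mkOfCovers I (fun p => (T ⊗ U p).left)
    (fun p => (T ◁ c p).left) (fun z => by
      obtain ⟨p, hp⟩ := hc (Limits.pullback.snd T.hom X.hom z)
      obtain ⟨y, hy⟩ := mem_range_whiskerLeft T (c p) z hp
      exact ⟨p, y, hy⟩)
  -- On the chart `U p` the torus acts by multiplication in `U p` through the homomorphism `r p`.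
  let a : ∀ p, T ⊗ U p ⟶ X := fun p => r p ▷ U p ≫ μ ≫ c p
  have ha : ∀ p, T ◁ r p ≫ a p = μ ≫ i := by
    intro p
    rw [← tensorHom_def'_assoc, ← IsMonHom.mul_hom_assoc, hr]
  have hfac : ∀ p, T ◁ r p ≫ T ◁ c p = T ◁ i := fun p => by rw [← whiskerLeft_comp, hr]
  -- `T ⊗ T` is a dense open part of each overlap, and both local maps restrict there to the
  -- multiplication of `T` followed by `i`. Since `X` is separated they agree.
  have hglue : ∀ p q, Limits.pullback.fst (T ◁ c p).left (T ◁ c q).left ≫ (a p).left =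
      Limits.pullback.snd (T ◁ c p).left (T ◁ c q).left ≫ (a q).left := by
    intro p q
    let W := Limits.pullback (T ◁ c p).left (T ◁ c q).left
    let w : W ⟶ (T ⊗ X).left := Limits.pullback.fst (T ◁ c p).left (T ◁ c q).left ≫ (T ◁ c p).left
    have hw : Limits.pullback.snd (T ◁ c p).left (T ◁ c q).left ≫ (T ◁ c q).left = w :=
      Limits.pullback.condition.symm
    let d : (T ⊗ T).left ⟶ W := Limits.pullback.lift (T ◁ r p).left (T ◁ r q).left (by
      rw [← Over.comp_left, ← Over.comp_left, hfac, hfac])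
    have hd : d ≫ w = (T ◁ i).left := by
      rw [← hfac p, Limits.pullback.lift_fst_assoc, Over.comp_left]
    have : IsOpenImmersion d := by
      have : IsOpenImmersion (d ≫ w) := hd ▸ inferInstance
      exact IsOpenImmersion.of_comp d w
    have : Nonempty W := ⟨d (Classical.arbitrary _)⟩
    have : IsIntegral W := isIntegral_of_isOpenImmersion w
    have : IsDominant d := ⟨d.isOpenEmbedding.isOpen_range.dense (Set.range_nonempty _)⟩
    refine ext_of_isDominant_of_isSeparated X.hom ?_ d ?_
    · rw [Category.assoc, Category.assoc, Over.w, Over.w, ← Over.w (T ◁ c p), ← Over.w (T ◁ c q),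
        ← Category.assoc, ← Category.assoc, hw]
    · rw [Limits.pullback.lift_fst_assoc, Limits.pullback.lift_snd_assoc, ← Over.comp_left,
        ← Over.comp_left, ha, ha]
  let A := 𝒰.glueMorphisms (fun p => (a p).left) hglue
  have hA : ∀ p, (T ◁ c p).left ≫ A = (a p).left := fun p => 𝒰.ι_glueMorphisms _ hglue p
  let act : T ⊗ X ⟶ X := Over.homMk A (𝒰.hom_ext _ _ fun p => by
    change (T ◁ c p).left ≫ A ≫ X.hom = (T ◁ c p).left ≫ (T ⊗ X).hom
    exact (reassoc_of% hA p) X.hom |>.trans ((Over.w _).trans (Over.w _).symm))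
  have hact : ∀ p, T ◁ c p ≫ act = a p := fun p => Over.OverMorphism.ext (hA p)
  obtain ⟨p⟩ := ‹Nonempty I›
  exact ⟨act, by rw [← hfac p, Category.assoc, hact, ha]⟩

end Action

end LSAlg

namespace LSAlg

/-! ### The affine charts of the variety of a chain -/

section Charts

open HomogeneousLocalization

variable {S : Type u} [PartialOrder S] [Finite S] {b : S → S → ℕ}
variable {K A : Type u} [Field K] [CommRing A] [Algebra K A] {𝒜 : ℕ → Submodule K A}
  [GradedAlgebra 𝒜] {j : LSPath b 1 → 𝒜 1}

theorem pathVec_mem {r : ℕ} {π : S → ℚ} (hA : IsLSAlgebra b 𝒜 j) (h : IsLSPath b r π) :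
    pathVec j π ∈ 𝒜 r := by
  rw [hA.grading]
  exact Submodule.subset_span ⟨⟨π, h⟩, rfl⟩

theorem cum_nsmul (s : Set S) (m : ℕ) (p : S → ℚ) : cum s (m • p) = m * cum s p := by
  rw [← cum_smul, Nat.cast_smul_eq_nsmul]

theorem comparableSupports_of_isChain_univ (hS : IsChain (· ≤ ·) (Set.univ : Set S))
    (p q : S → ℚ) : ComparableSupports p q :=
  ⟨Set.univ, hS, Set.subset_univ _, Set.subset_univ _⟩

theorem isUnit_single_one {G : Type*} [AddCommGroup G] (g : G) :
    IsUnit (AddMonoidAlgebra.single g (1 : K)) :=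
  .of_mul_eq_one (AddMonoidAlgebra.single (-g) 1) (by
    rw [AddMonoidAlgebra.single_mul_single, add_neg_cancel, mul_one]; rfl)

variable (hb : IsPosetWithBonds b) (hA : IsDiscreteLSAlgebra b 𝒜 j)
  (hS : IsChain (· ≤ ·) (Set.univ : Set S))

theorem chainIdeal_univ : (chainIdeal j Set.univ).toIdeal = ⊥ := by
  rw [eq_bot_iff]
  exact Ideal.span_le.2 fun _ ⟨p, hp, _⟩ => absurd (Set.subset_univ _) hp

theorem toMonomials_injective : Function.Injective (hA.toMonomials hb hS) := by
  refine (RingHom.injective_iff_ker_eq_bot (hA.toMonomials hb hS).toRingHom).2 ?_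
  exact (hA.ker_toMonomials hb hS).trans chainIdeal_univ

theorem toMonomials_pathVec_univ {r : ℕ} {π : S → ℚ} (hπ : IsLSPath b r π) :
    hA.toMonomials hb hS (pathVec j π) = AddMonoidAlgebra.single π 1 :=
  hA.toMonomials_pathVec hb hS ⟨r, hπ⟩ fun _ _ => trivial

variable {d : ℕ} {p : S → ℚ} (hp : IsLSPath b d p)

include hp in
theorem isUnit_toMonomials_pathVec : IsUnit (hA.toMonomials hb hS (pathVec j p)) := by
  rw [toMonomials_pathVec_univ hb hA hS hp]
  exact isUnit_single_one p

/-- The homomorphism `a / j(p)ⁿ ↦ φ(a) x^{-np}` on the ring of the chart `D₊(j(p))`, where `φ` is the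
embedding of `A` into an algebra of monomials. -/
noncomputable def awayToMonomials :
    Away 𝒜 (pathVec j p) →+* AddMonoidAlgebra K (S → ℚ) :=
  (IsLocalization.Away.lift (S := Localization.Away (pathVec j p)) (pathVec j p)
    (g := (hA.toMonomials hb hS).toRingHom) (isUnit_toMonomials_pathVec hb hA hS hp)).comp
    (algebraMap (Away 𝒜 (pathVec j p)) (Localization.Away (pathVec j p)))

theorem awayToMonomials_mk (n : ℕ) (a : A) (ha : a ∈ 𝒜 (n • d)) :
    awayToMonomials hb hA hS hp (Away.mk 𝒜 (pathVec_mem hA.toIsLSAlgebra hp) n a ha) =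
      hA.toMonomials hb hS a * AddMonoidAlgebra.single (-(n • p)) 1 := by
  have h1 : awayToMonomials hb hA hS hp (Away.mk 𝒜 (pathVec_mem hA.toIsLSAlgebra hp) n a ha) *
      hA.toMonomials hb hS (pathVec j p) ^ n = hA.toMonomials hb hS a := by
    have h2 : (Away.mk 𝒜 (pathVec_mem hA.toIsLSAlgebra hp) n a ha).val *
        algebraMap A (Localization.Away (pathVec j p)) (pathVec j p ^ n) = algebraMap A _ a := by
      rw [Away.val_mk, ← Localization.mk_one_eq_algebraMap, ← Localization.mk_one_eq_algebraMap,
        Localization.mk_mul, Localization.mk_eq_mk_iff, Localization.r_iff_exists]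
      exact ⟨1, by simp [mul_comm]⟩
    have h3 := congrArg (IsLocalization.Away.lift (S := Localization.Away (pathVec j p))
      (pathVec j p) (g := (hA.toMonomials hb hS).toRingHom)
      (isUnit_toMonomials_pathVec hb hA hS hp)) h2
    rw [map_mul, IsLocalization.Away.lift_eq, IsLocalization.Away.lift_eq, map_pow] at h3
    exact h3
  rw [← h1, toMonomials_pathVec_univ hb hA hS hp, AddMonoidAlgebra.single_pow, mul_assoc,
    AddMonoidAlgebra.single_mul_single, add_neg_cancel, one_pow, mul_one]
  exact (mul_one _).symm

theorem awayToMonomials_injective : Function.Injective (awayToMonomials hb hA hS hp) := by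
  refine Function.Injective.comp (g := IsLocalization.Away.lift (S := Localization.Away
    (pathVec j p)) (pathVec j p) (g := (hA.toMonomials hb hS).toRingHom)
    (isUnit_toMonomials_pathVec hb hA hS hp)) ?_ (val_injective _)
  refine (IsLocalization.lift_injective_iff _).2 fun x y => ?_
  have : Function.Injective (algebraMap A (Localization.Away (pathVec j p))) := by
    have hdom : IsDomain A := (toMonomials_injective hb hA hS).isDomain
    refine IsLocalization.injective _ (M := .powers (pathVec j p)) ?_
    refine powers_le_nonZeroDivisors_of_noZeroDivisors fun h0 => ?_
    have := isUnit_toMonomials_pathVec hb hA hS hp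
    rw [h0, map_zero] at this
    exact not_isUnit_zero this
  rw [this.eq_iff]
  exact (toMonomials_injective hb hA hS).eq_iff.symm

/-- The exponents of the monomials that are regular on the chart `D₊(j(p))`. -/
def chartMonoid {n : ℕ} (ι : (Fin n → ℤ) →+ (S → ℚ)) (p : S → ℚ) : AddSubmonoid (Fin n → ℤ) where
  carrier := {u | ∀ σ, p σ = 0 → 0 ≤ ι u σ}
  zero_mem' σ _ := by simp
  add_mem' {u v} hu hv σ h := by simpa using add_nonneg (hu σ h) (hv σ h)

variable {n : ℕ} {ι : (Fin n → ℤ) →+ (S → ℚ)} (hι : Function.Injective ι)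
  (hr : ι.range = chainLatticeZero b Set.univ)

/-- The embedding of the monoid algebra of a chart. -/
noncomputable def chartEmbedding (K : Type u) [Field K] (ι : (Fin n → ℤ) →+ (S → ℚ))
    (N : AddSubmonoid (Fin n → ℤ)) :
    AddMonoidAlgebra K N →ₐ[K] AddMonoidAlgebra K (S → ℚ) :=
  AddMonoidAlgebra.mapDomainAlgHom K K (ι.comp N.subtype)

theorem chartEmbedding_single (N : AddSubmonoid (Fin n → ℤ)) (u : N) (c : K) :
    chartEmbedding K ι N (AddMonoidAlgebra.single u c) = AddMonoidAlgebra.single (ι u) c := by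
  simp [chartEmbedding]

include hι in
theorem chartEmbedding_injective (N : AddSubmonoid (Fin n → ℤ)) :
    Function.Injective (chartEmbedding K ι N) :=
  AddMonoidAlgebra.mapDomain_injective (hι.comp Subtype.val_injective)

include hr in
-- The fraction of `π` by the `m`-th power of `p` has exponent `π - m p`, of degree zero and
-- nonnegative where `p` vanishes. Conversely, for such an exponent `u`, the vector `u + m p` is
-- nonnegative for some `m`, hence a path.
theorem range_awayToMonomials : (awayToMonomials hb hA hS hp).range =
    (chartEmbedding K ι (chartMonoid ι p)).toRingHom.range := by
  apply le_antisymm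
  · rintro _ ⟨x, rfl⟩
    obtain ⟨m, a, ha, rfl⟩ := Away.mk_surjective 𝒜 (pathVec_mem hA.toIsLSAlgebra hp) x
    rw [awayToMonomials_mk]
    let f : A →ₗ[K] AddMonoidAlgebra K (S → ℚ) :=
      (LinearMap.mulRight K (AddMonoidAlgebra.single (-(m • p)) 1)).comp
        (hA.toMonomials hb hS).toLinearMap
    have h : 𝒜 (m • d) ≤ (LinearMap.range
        (chartEmbedding K ι (chartMonoid ι p)).toLinearMap).comap f := by
      rw [hA.grading, Submodule.span_le]
      rintro _ ⟨π, rfl⟩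
      have hmem : π.1 - m • p ∈ chainLatticeZero b Set.univ := by
        refine ⟨sub_mem (π.2.mem_chainLattice hb hS fun _ _ => trivial)
          (nsmul_mem (hp.mem_chainLattice hb hS fun _ _ => trivial) m), ?_⟩
        rw [cum_sub, cum_nsmul, π.2.cum_univ, hp.cum_univ]
        simp
      rw [← hr] at hmem
      obtain ⟨u, hu⟩ := hmem
      refine ⟨AddMonoidAlgebra.single ⟨u, fun σ hσ => ?_⟩ 1, ?_⟩
      · rw [hu, Pi.sub_apply, Pi.smul_apply, hσ, smul_zero, sub_zero]
        exact π.2.nonneg σ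
      · refine (chartEmbedding_single _ _ _).trans ?_
        refine .trans ?_ (congrArg (· * AddMonoidAlgebra.single (-(m • p)) (1 : K))
          (toMonomials_pathVec_univ hb hA hS π.2)).symm
        simp only [AddMonoidAlgebra.single_mul_single, mul_one]
        rw [hu, sub_eq_add_neg]
    obtain ⟨y, hy⟩ := h ha
    exact ⟨y, hy⟩
  · rintro _ ⟨x, rfl⟩
    induction x using AddMonoidAlgebra.induction_linear with
    | zero => rw [map_zero]; exact zero_mem _
    | add x y hx hy => rw [map_add]; exact add_mem hx hy
    | single u c =>
      have hu : ι u ∈ chainLatticeZero b Set.univ := hr ▸ ⟨u, rfl⟩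
      obtain ⟨m, hm⟩ := exists_nsmul_add_nonneg hp.nonneg u.2
      have hπ : IsLSPath b (m • d) (ι u + m • p) := by
        refine isLSPath_of_mem_chainLattice hb hS (add_mem hu.1
          (nsmul_mem (hp.mem_chainLattice hb hS fun _ _ => trivial) m)) hm ?_
        rw [cum_add, cum_nsmul, hu.2, hp.cum_univ]
        simp
      refine ⟨Away.mk 𝒜 (pathVec_mem hA.toIsLSAlgebra hp) m (c • pathVec j (ι u + m • p))
        (Submodule.smul_mem _ _ (pathVec_mem hA.toIsLSAlgebra hπ)), ?_⟩
      rw [awayToMonomials_mk, map_smul, toMonomials_pathVec_univ hb hA hS hπ]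
      refine .trans ?_ (chartEmbedding_single _ _ _).symm
      rw [AddMonoidAlgebra.smul_single, AddMonoidAlgebra.single_mul_single]
      simp

theorem exists_ringEquiv_of_range_eq {R R' R'' : Type*} [CommRing R] [CommRing R'] [CommRing R'']
    {f : R →+* R''} {g : R' →+* R''} (hf : Function.Injective f) (hg : Function.Injective g)
    (h : f.range = g.range) : ∃ e : R ≃+* R', ∀ x, g (e x) = f x := by
  refine ⟨(RingEquiv.ofBijective f.rangeRestrict ⟨fun x y e => hf (congrArg Subtype.val e),
    f.rangeRestrict_surjective⟩).trans ((RingEquiv.subringCongr h).trans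
    (RingEquiv.ofBijective g.rangeRestrict ⟨fun x y e => hg (congrArg Subtype.val e),
      g.rangeRestrict_surjective⟩).symm), fun x => ?_⟩
  have := (RingEquiv.ofBijective g.rangeRestrict ⟨fun x y e => hg (congrArg Subtype.val e),
      g.rangeRestrict_surjective⟩).apply_symm_apply ((RingEquiv.subringCongr h) ⟨f x, x, rfl⟩)
  exact congrArg Subtype.val this

include hι hr in
theorem exists_chartEquiv : ∃ e : Away 𝒜 (pathVec j p) ≃+* AddMonoidAlgebra K (chartMonoid ι p),
    ∀ x, chartEmbedding K ι (chartMonoid ι p) (e x) = awayToMonomials hb hA hS hp x :=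
  exists_ringEquiv_of_range_eq (g := (chartEmbedding K ι (chartMonoid ι p)).toRingHom)
    (awayToMonomials_injective hb hA hS hp)
    (chartEmbedding_injective hι _) (range_awayToMonomials hb hA hS hp hr)

/-- The ring of the chart `D₊(j(p))` as a monoid algebra. -/
noncomputable def chartEquiv : Away 𝒜 (pathVec j p) ≃+* AddMonoidAlgebra K (chartMonoid ι p) :=
  (exists_chartEquiv hb hA hS hp hι hr).choose

theorem chartEmbedding_chartEquiv (x : Away 𝒜 (pathVec j p)) :
    chartEmbedding K ι (chartMonoid ι p) (chartEquiv hb hA hS hp hι hr x) =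
      awayToMonomials hb hA hS hp x :=
  (exists_chartEquiv hb hA hS hp hι hr).choose_spec x

end Charts

end LSAlg

namespace LSAlg

/-! ### The torus -/

section Torus

open HomogeneousLocalization

/-- `Spec K[N]` for a submonoid `N` of `ℤⁿ`. -/
noncomputable abbrev monoidSpec (K : Type u) [Field K] {n : ℕ} (N : AddSubmonoid (Fin n → ℤ)) :
    Over (Spec (CommRingCat.of K)) :=
  (Spec (CommRingCat.of (AddMonoidAlgebra K N))).asOver (Spec (CommRingCat.of K))

section

variable {K : Type u} [Field K] {n : ℕ}

/-- The morphism `𝔾ₘⁿ → Spec K[N]`. -/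
noncomputable def torusToMonoidSpec (K : Type u) [Field K] {n : ℕ} (N : AddSubmonoid (Fin n → ℤ)) :
    splitTorus K n ⟶ monoidSpec K N :=
  ((bialgSpec (CommRingCat.of K)).map (Quiver.Hom.op
    (CommBialgCat.ofHom (AddMonoidAlgebra.mapDomainBialgHom K N.subtype)))).hom

instance (N : AddSubmonoid (Fin n → ℤ)) : IsMonHom (torusToMonoidSpec K N) :=
  ((bialgSpec (CommRingCat.of K)).map (Quiver.Hom.op
    (CommBialgCat.ofHom (AddMonoidAlgebra.mapDomainBialgHom K N.subtype)))).isMonHom_hom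

theorem torusToMonoidSpec_left (N : AddSubmonoid (Fin n → ℤ)) :
    (torusToMonoidSpec K N).left = Spec.map (CommRingCat.ofHom
      (AddMonoidAlgebra.mapDomainAlgHom K K N.subtype).toRingHom) := rfl

theorem isIso_torusToMonoidSpec_left {N : AddSubmonoid (Fin n → ℤ)} (h : N = ⊤) :
    IsIso (torusToMonoidSpec K N).left := by
  subst h
  rw [torusToMonoidSpec_left]
  have : Function.Bijective (AddMonoidAlgebra.mapDomainAlgHom K K
      (⊤ : AddSubmonoid (Fin n → ℤ)).subtype).toRingHom := by
    constructor
    · exact AddMonoidAlgebra.mapDomain_injective Subtype.val_injective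
    · intro x
      induction x using AddMonoidAlgebra.induction_linear with
      | zero => exact ⟨0, map_zero _⟩
      | add x y hx hy =>
        obtain ⟨x, rfl⟩ := hx
        obtain ⟨y, rfl⟩ := hy
        exact ⟨x + y, map_add _ _ _⟩
      | single u c => exact ⟨AddMonoidAlgebra.single ⟨u, trivial⟩ c, by simp⟩
  have : IsIso (CommRingCat.ofHom (AddMonoidAlgebra.mapDomainAlgHom K K
      (⊤ : AddSubmonoid (Fin n → ℤ)).subtype).toRingHom) :=
    (ConcreteCategory.isIso_iff_bijective _).2 this
  exact inferInstanceAs (IsIso (Spec.map (CommRingCat.ofHom (AddMonoidAlgebra.mapDomainAlgHom K K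
      (⊤ : AddSubmonoid (Fin n → ℤ)).subtype).toRingHom)))

/-- The base change to a field `L` is the spectrum of the Laurent polynomial ring over `L`, a
domain. -/
instance geometricallyIntegral_splitTorus : GeometricallyIntegral (splitTorus K n).hom := by
  have : ObjectProperty.IsClosedUnderIsomorphisms (C := Scheme.{u}) IsIntegral :=
    ⟨fun {X Y} e h => by
      have : Nonempty Y := ⟨e.hom (Classical.arbitrary X)⟩
      exact isIntegral_of_isOpenImmersion e.inv⟩
  refine ⟨geometrically_iff_of_commRing_of_isClosedUnderIsomorphisms.2 fun L _ _ => ?_⟩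
  let e : Limits.pullback (splitTorus K n).hom (Spec.map (CommRingCat.ofHom (algebraMap K L))) ≅
      Spec (.of (TensorProduct K (AddMonoidAlgebra K (Fin n → ℤ)) L)) := pullbackSpecIso K _ L
  have : IsDomain (TensorProduct K (AddMonoidAlgebra K (Fin n → ℤ)) L) :=
    ((Algebra.TensorProduct.comm K (AddMonoidAlgebra K (Fin n → ℤ)) L).toRingEquiv.trans
      (AddMonoidAlgebra.scalarTensorEquiv (M := Fin n → ℤ) K L).toRingEquiv).injective.isDomain
  have : Nonempty (Limits.pullback (splitTorus K n).hom
      (Spec.map (CommRingCat.ofHom (algebraMap K L))) :) := ⟨e.inv (Classical.arbitrary _)⟩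
  exact isIntegral_of_isOpenImmersion e.hom

instance locallyOfFiniteType_splitTorus : LocallyOfFiniteType (splitTorus K n).hom := by
  change LocallyOfFiniteType (Spec.map (CommRingCat.ofHom
    (algebraMap K (AddMonoidAlgebra K (Fin n → ℤ)))))
  rw [HasRingHomProperty.Spec_iff (P := @LocallyOfFiniteType)]
  exact RingHom.finiteType_algebraMap.2 inferInstance

instance isIntegral_splitTorus : IsIntegral (splitTorus K n).left :=
  inferInstanceAs (IsIntegral (Spec (CommRingCat.of (AddMonoidAlgebra K (Fin n → ℤ)))))

end

variable {S : Type u} [PartialOrder S] [Finite S] {b : S → S → ℕ}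
variable {K A : Type u} [Field K] [CommRing A] [Algebra K A] {𝒜 : ℕ → Submodule K A}
  [GradedAlgebra 𝒜] {j : LSPath b 1 → 𝒜 1}
variable (hb : IsPosetWithBonds b) (hA : IsDiscreteLSAlgebra b 𝒜 j)
  (hS : IsChain (· ≤ ·) (Set.univ : Set S))
  {n : ℕ} {ι : (Fin n → ℤ) →+ (S → ℚ)} (hι : Function.Injective ι)
  (hr : ι.range = chainLatticeZero b Set.univ)
  {d : ℕ} {p : S → ℚ} (hp : IsLSPath b d p) (hd : 0 < d)

theorem chartEquiv_fromZeroRingHom (c : K) : chartEquiv hb hA hS hp hι hr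
    (fromZeroRingHom 𝒜 (.powers (pathVec j p)) (algebraMap K (𝒜 0) c)) = algebraMap K _ c := by
  apply chartEmbedding_injective (K := K) hι
  rw [chartEmbedding_chartEquiv, AlgHom.commutes]
  have : fromZeroRingHom 𝒜 (.powers (pathVec j p)) (algebraMap K (𝒜 0) c) =
      Away.mk 𝒜 (pathVec_mem hA.toIsLSAlgebra hp) 0 (algebraMap K A c)
        (by rw [zero_smul]; exact SetLike.algebraMap_mem_graded 𝒜 c) := by
    apply val_injective
    rw [Away.val_mk]
    change Localization.mk _ _ = _
    congr 1
    ext; simp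
  rw [this, awayToMonomials_mk]
  simp


/-- The chart `Spec K[N] → Proj A` with image `D₊(j(p))`, as a morphism of schemes. -/
noncomputable def chartHom : Spec (.of (AddMonoidAlgebra K (chartMonoid ι p))) ⟶ Proj 𝒜 :=
  Spec.map (CommRingCat.ofHom (chartEquiv hb hA hS hp hι hr).toRingHom) ≫
    Proj.awayι 𝒜 (pathVec j p) (pathVec_mem hA.toIsLSAlgebra hp) hd

instance isIso_chartEquiv :
    IsIso (CommRingCat.ofHom (chartEquiv hb hA hS hp hι hr).toRingHom) :=
  (ConcreteCategory.isIso_iff_bijective _).2 (chartEquiv hb hA hS hp hι hr).bijective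

instance isOpenImmersion_chartHom : IsOpenImmersion (chartHom hb hA hS hι hr hp hd) := by
  rw [chartHom]
  infer_instance

theorem opensRange_chartHom : (chartHom hb hA hS hι hr hp hd).opensRange =
    Proj.basicOpen 𝒜 (pathVec j p) :=
  (Scheme.Hom.opensRange_comp_of_isIso _ _).trans (Proj.opensRange_awayι _ _ _ _)

theorem chartHom_structureMap : chartHom hb hA hS hι hr hp hd ≫ structureMap 𝒜 =
    Spec.map (CommRingCat.ofHom (algebraMap K _)) := by
  rw [chartHom, Category.assoc, awayι_structureMap, ← Spec.map_comp]
  exact congrArg Spec.map (CommRingCat.hom_ext (RingHom.ext fun c =>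
    chartEquiv_fromZeroRingHom hb hA hS hι hr hp c))

/-- Charts are compared inside `K[ℚ^S]`: expanding a fraction by a power of `j(p')` does not change
its exponents. -/
theorem subtype_chartEquiv_awayMap {d' : ℕ} {p' t : S → ℚ} (hp' : IsLSPath b d' p')
    (ht : IsLSPath b (d + d') t) (h : t = p + p')
    (hx : pathVec j t = pathVec j p * pathVec j p') (x : Away 𝒜 (pathVec j p)) :
    AddMonoidAlgebra.mapDomainAlgHom K K (chartMonoid ι t).subtype
      (chartEquiv hb hA hS ht hι hr (awayMap 𝒜 (pathVec_mem hA.toIsLSAlgebra hp') hx x)) =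
    AddMonoidAlgebra.mapDomainAlgHom K K (chartMonoid ι p).subtype
      (chartEquiv hb hA hS hp hι hr x) := by
  have hinj : Function.Injective (AddMonoidAlgebra.mapDomainAlgHom K K ι) :=
    AddMonoidAlgebra.mapDomain_injective hι
  have hcomp : ∀ (N : AddSubmonoid (Fin n → ℤ)) y, AddMonoidAlgebra.mapDomainAlgHom K K ι
      (AddMonoidAlgebra.mapDomainAlgHom K K N.subtype y) = chartEmbedding K ι N y := by
    intro N y
    induction y using AddMonoidAlgebra.induction_linear with
    | zero => simp
    | add x y hx hy => rw [map_add, map_add, map_add, hx, hy]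
    | single u c => rw [chartEmbedding_single]; simp
  apply hinj
  rw [hcomp, hcomp, chartEmbedding_chartEquiv, chartEmbedding_chartEquiv]
  obtain ⟨m, a, ha, rfl⟩ := Away.mk_surjective 𝒜 (pathVec_mem hA.toIsLSAlgebra hp) x
  rw [awayMap_mk, awayToMonomials_mk, awayToMonomials_mk, map_mul, map_pow,
    toMonomials_pathVec_univ hb hA hS hp', AddMonoidAlgebra.single_pow, one_pow, mul_assoc,
    AddMonoidAlgebra.single_mul_single, one_mul, h]
  congr 3
  rw [smul_add]
  abel

theorem torusToMonoidSpec_left_chartHom {d' e : ℕ} {p' t : S → ℚ} (hp' : IsLSPath b d' p')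
    (ht : IsLSPath b e t) (he : 0 < e) (h : t = p + p') :
    (torusToMonoidSpec K _).left ≫ chartHom hb hA hS hι hr ht he =
      (torusToMonoidSpec K _).left ≫ chartHom hb hA hS hι hr hp hd := by
  obtain rfl : e = d + d' := by
    refine ht.degree_eq ?_
    rw [h]
    exact hp.add hb hp' (comparableSupports_of_isChain_univ hS _ _)
  have hx : pathVec j t = pathVec j p * pathVec j p' := by
    rw [hA.pathVec_mul hb ⟨d, hp⟩ ⟨d', hp'⟩ (comparableSupports_of_isChain_univ hS _ _), h]
  change Spec.map (CommRingCat.ofHom (AddMonoidAlgebra.mapDomainAlgHom K K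
      (chartMonoid ι t).subtype).toRingHom) ≫ Spec.map _ ≫ _ =
    Spec.map (CommRingCat.ofHom (AddMonoidAlgebra.mapDomainAlgHom K K
      (chartMonoid ι p).subtype).toRingHom) ≫ Spec.map _ ≫ _
  rw [← Proj.SpecMap_awayMap_awayι 𝒜 (pathVec_mem hA.toIsLSAlgebra hp) hd
      (pathVec_mem hA.toIsLSAlgebra hp') hx, ← Spec.map_comp_assoc, ← Spec.map_comp_assoc,
      ← Spec.map_comp_assoc]
  exact congrArg (fun f => Spec.map f ≫ _) (CommRingCat.hom_ext (RingHom.ext fun x =>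
    subtype_chartEquiv_awayMap hb hA hS hι hr hp hp' ht h hx x))

/-- The chart `Spec K[N] → Proj A` with image `D₊(j(p))`. -/
noncomputable def chart : monoidSpec K (chartMonoid ι p) ⟶ projOver 𝒜 :=
  Over.homMk (chartHom hb hA hS hι hr hp hd) (chartHom_structureMap hb hA hS hι hr hp hd)

instance isOpenImmersion_chart : IsOpenImmersion (chart hb hA hS hι hr hp hd).left :=
  isOpenImmersion_chartHom hb hA hS hι hr hp hd

theorem torusToMonoidSpec_chart_add {d' e : ℕ} {p' t : S → ℚ} (hp' : IsLSPath b d' p')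
    (ht : IsLSPath b e t) (he : 0 < e) (h : t = p + p') :
    torusToMonoidSpec K _ ≫ chart hb hA hS hι hr ht he =
      torusToMonoidSpec K _ ≫ chart hb hA hS hι hr hp hd :=
  Over.OverMorphism.ext (torusToMonoidSpec_left_chartHom hb hA hS hι hr hp hd hp' ht he h)

/-- All charts induce the same map from the torus: the charts of `p` and of `p'` are both compared
with that of `p + p'`. -/
theorem torusToMonoidSpec_chart_eq {d' : ℕ} {p' : S → ℚ} (hp' : IsLSPath b d' p') (hd' : 0 < d') :
    torusToMonoidSpec K _ ≫ chart hb hA hS hι hr hp hd =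
      torusToMonoidSpec K _ ≫ chart hb hA hS hι hr hp' hd' := by
  have ht := hp.add hb hp' (comparableSupports_of_isChain_univ hS _ _)
  rw [← torusToMonoidSpec_chart_add hb hA hS hι hr hp hd hp' ht (by omega) rfl,
    ← torusToMonoidSpec_chart_add hb hA hS hι hr hp' hd' hp ht (by omega) (add_comm _ _)]

include hb hA in
theorem iSup_basicOpen_pathVec : ⨆ p : LSPath b 1, Proj.basicOpen 𝒜 (pathVec j p.1) = ⊤ := by
  refine Proj.iSup_basicOpen_eq_top' 𝒜 _ (fun p => ⟨1, pathVec_mem hA.toIsLSAlgebra p.2⟩) ?_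
  rw [eq_top_iff]
  intro x _
  have hx : x ∈ Algebra.adjoin K (Set.range fun p : LSPath b 1 => (j p : A)) := by
    rw [hA.adjoin_range]; trivial
  induction hx using Algebra.adjoin_induction with
  | mem x h =>
    obtain ⟨p, rfl⟩ := h
    exact Algebra.subset_adjoin ⟨p, pathVec_coe j p⟩
  | algebraMap c => exact Subalgebra.algebraMap_mem _ (algebraMap K (𝒜 0) c)
  | add x y _ _ hx hy => exact add_mem (hx trivial) (hy trivial)
  | mul x y _ _ hx hy => exact mul_mem (hx trivial) (hy trivial)

theorem exists_mem_range_chartHom (x : Proj 𝒜) :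
    ∃ p : LSPath b 1, x ∈ Set.range (chartHom hb hA hS hι hr p.2 one_pos) := by
  have hx : x ∈ (⊤ : (Proj 𝒜).Opens) := trivial
  rw [← iSup_basicOpen_pathVec hb hA, TopologicalSpace.Opens.mem_iSup] at hx
  obtain ⟨p, hp⟩ := hx
  rw [← opensRange_chartHom hb hA hS hι hr p.2 one_pos] at hp
  exact ⟨p, hp⟩

theorem isDomain_monoidAlgebra (K : Type u) [Field K] (N : AddSubmonoid (Fin n → ℤ)) :
    IsDomain (AddMonoidAlgebra K N) :=
  (show Function.Injective (AddMonoidAlgebra.mapDomainAlgHom K K N.subtype) from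
    AddMonoidAlgebra.mapDomain_injective Subtype.val_injective).isDomain

include hb hA hS in
theorem irreducibleSpace_projOver [Nonempty S] : IrreducibleSpace (projOver 𝒜).left := by
  have h := range_chainι_eq_closure hb hA hS Set.univ_nonempty
  have h1 : Set.range (chainι j (Set.univ : Set S)) = Set.univ := by
    rw [range_chainι]
    ext x
    refine ⟨fun _ => trivial, fun _ a ha => ?_⟩
    have ha : a ∈ (chainIdeal j Set.univ).toIdeal := ha
    rw [chainIdeal_univ, Ideal.mem_bot] at ha
    rw [ha]
    exact zero_mem _
  have h2 : IsIrreducible (Set.univ : Set (projOver 𝒜).left) := by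
    rw [← h1, h]
    exact isIrreducible_singleton.closure
  exact (irreducibleSpace_def _).2 h2

include hb hA hS in
theorem isIntegral_projOver [Nonempty S] : IsIntegral (projOver 𝒜).left := by
  obtain ⟨n, ι, hι, hr⟩ := exists_lattice_param hb hS
  rw [isIntegral_iff_irreducibleSpace_and_isReduced]
  refine ⟨irreducibleSpace_projOver hb hA hS, ?_⟩
  let 𝒰 : (Proj 𝒜).OpenCover := Scheme.Cover.mkOfCovers (LSPath b 1)
    (fun p => Spec (.of (AddMonoidAlgebra K (chartMonoid ι p.1))))
    (fun p => chartHom hb hA hS hι hr p.2 one_pos) (fun x => by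
      obtain ⟨p, y, hy⟩ := exists_mem_range_chartHom hb hA hS hι hr x
      exact ⟨p, y, hy⟩)
  have : ∀ i, IsReduced (𝒰.X i) := fun p => by
    have := isDomain_monoidAlgebra K (chartMonoid ι p.1)
    exact inferInstanceAs (IsReduced (Spec (.of (AddMonoidAlgebra K (chartMonoid ι p.1)))))
  exact IsReduced.of_openCover _ 𝒰

open MonoidalCategory in
include hb hA hS in
theorem isToricVariety_projOver [Nonempty S] : IsToricVariety (projOver 𝒜) := by
  obtain ⟨n, ι, hι, hr⟩ := exists_lattice_param hb hS
  obtain ⟨d, q, hd, hq, hsupp⟩ := exists_isLSPath_support_eq hb hS Set.univ_nonempty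
  have := finite_lsPath hb 1
  have : Nonempty (LSPath b 1) := ⟨extremalPath b (Classical.arbitrary S)⟩
  have hX := isIntegral_projOver hb hA hS
  obtain ⟨h1, h2, h3⟩ := finiteType_projOver (fun p : LSPath b 1 => (j p).2) hA.adjoin_range
  -- As `q` vanishes nowhere, no inequality is imposed, and its chart is the torus itself.
  have hN : chartMonoid ι q = ⊤ := by
    ext u
    exact ⟨fun _ => trivial, fun _ σ hσ => absurd hσ ((hsupp σ).2 trivial)⟩
  have := isIso_torusToMonoidSpec_left (K := K) hN
  let i := torusToMonoidSpec K _ ≫ chart hb hA hS hι hr hq hd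
  have hi : IsOpenImmersion i.left := by
    change IsOpenImmersion ((torusToMonoidSpec K _).left ≫ (chart hb hA hS hι hr hq hd).left)
    infer_instance
  obtain ⟨act, hact⟩ := exists_extends (i := i) (I := LSPath b 1)
    (fun p => monoidSpec K (chartMonoid ι p.1)) (fun p => chart hb hA hS hι hr p.2 one_pos)
    (exists_mem_range_chartHom hb hA hS hι hr) (fun p => torusToMonoidSpec K _)
    (fun p => torusToMonoidSpec_chart_eq hb hA hS hι hr p.2 one_pos hq hd)
  exact ⟨hX, h1, h2, h3, n, i, modObjOfExtends act hact, hi, hact⟩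

end Torus

end LSAlg

namespace LSAlg

/-! ### Normality -/

section Normal

variable {K : Type u} [Field K] {n : ℕ}

/-- The Laurent polynomial ring is the localization of the polynomial ring, which is integrally
closed, at the monomials. -/
theorem isIntegrallyClosed_torus (K : Type u) [Field K] (n : ℕ) :
    IsIntegrallyClosed (AddMonoidAlgebra K (Fin n → ℤ)) := by
  let κ : (Fin n →₀ ℕ) →+ (Fin n → ℤ) :=
    { toFun := fun u i => u i
      map_zero' := by ext; simp
      map_add' := fun u v => by ext; simp }
  have hκ : Function.Injective κ := fun u v h => by
    ext i
    exact Nat.cast_injective (R := ℤ) (congrFun h i)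
  have : IsIntegrallyClosed (AddMonoidAlgebra K (Fin n →₀ ℕ)) :=
    inferInstanceAs (IsIntegrallyClosed (MvPolynomial (Fin n) K))
  have : IsDomain (AddMonoidAlgebra K (Fin n →₀ ℕ)) :=
    inferInstanceAs (IsDomain (MvPolynomial (Fin n) K))
  let f := AddMonoidAlgebra.mapDomainAlgHom K K κ
  have hf : Function.Injective f := AddMonoidAlgebra.mapDomain_injective hκ
  let M : Submonoid (AddMonoidAlgebra K (Fin n →₀ ℕ)) :=
    { carrier := Set.range fun u => AddMonoidAlgebra.single u 1
      one_mem' := ⟨0, rfl⟩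
      mul_mem' := by
        rintro _ _ ⟨u, rfl⟩ ⟨v, rfl⟩
        exact ⟨u + v, by simp [AddMonoidAlgebra.single_mul_single]⟩ }
  let _ : Algebra (AddMonoidAlgebra K (Fin n →₀ ℕ)) (AddMonoidAlgebra K (Fin n → ℤ)) :=
    f.toRingHom.toAlgebra
  have hmap : ∀ x, algebraMap (AddMonoidAlgebra K (Fin n →₀ ℕ))
    (AddMonoidAlgebra K (Fin n → ℤ)) x = f x := fun _ => rfl
  have : IsLocalization M (AddMonoidAlgebra K (Fin n → ℤ)) :=
    { map_units := by
        rintro ⟨_, u, rfl⟩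
        rw [hmap]
        simp only [f, AddMonoidAlgebra.mapDomainAlgHom_apply, AddMonoidAlgebra.mapDomain_single]
        exact isUnit_single_one _
      surj := by
        intro z
        induction z using AddMonoidAlgebra.induction_linear with
        | zero => exact ⟨(0, 1), by simp⟩
        | add x y hx hy =>
          obtain ⟨⟨a, s⟩, hx⟩ := hx
          obtain ⟨⟨c, t⟩, hy⟩ := hy
          refine ⟨(a * t + c * s, s * t), ?_⟩
          simp only [Submonoid.coe_mul, map_mul, map_add] at hx hy ⊢
          rw [← hx, ← hy]
          ring
        | single u c =>
          -- The exponent `u` is split into its positive and negative parts.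
          refine ⟨(AddMonoidAlgebra.single (Finsupp.equivFunOnFinite.symm fun i => (u i).toNat) c,
            ⟨_, Finsupp.equivFunOnFinite.symm fun i => (-u i).toNat, rfl⟩), ?_⟩
          simp only [hmap, f, AddMonoidAlgebra.mapDomainAlgHom_apply,
            AddMonoidAlgebra.mapDomain_single, AddMonoidAlgebra.single_mul_single, mul_one]
          congr 1
          ext i
          simp [κ]
          omega
      exists_of_eq := fun {x y} h => ⟨1, by rw [hf h]⟩ }
  refine isIntegrallyClosed_of_isLocalization _ M (le_nonZeroDivisors_of_noZeroDivisors ?_)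
  rintro ⟨u, hu⟩
  simp at hu

/-- The Hahn series obtained by grading the Laurent polynomials by an additive function. -/
noncomputable def gradedHahn (K : Type u) [Field K] (w : (Fin n → ℤ) →+ ℚ) :
    AddMonoidAlgebra K (Fin n → ℤ) →+* HahnSeries ℚ (AddMonoidAlgebra K (Fin n → ℤ)) :=
  AddMonoidAlgebra.liftNCRingHom (HahnSeries.C.comp (algebraMap K _))
    { toFun := fun u => HahnSeries.single (w u.toAdd) (AddMonoidAlgebra.single u.toAdd 1)
      map_one' := by simp; rfl
      map_mul' := fun u v => by simp [HahnSeries.single_mul_single] }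
    fun _ _ => Commute.all _ _

theorem gradedHahn_single (w : (Fin n → ℤ) →+ ℚ) (u : Fin n → ℤ) (c : K) :
    gradedHahn K w (AddMonoidAlgebra.single u c) =
      HahnSeries.single (w u) (AddMonoidAlgebra.single u c) := by
  refine (AddMonoidAlgebra.liftNC_single _ _ _ _).trans ?_
  simp [HahnSeries.C_apply, HahnSeries.single_mul_single]

open Classical in
theorem coeff_gradedHahn (w : (Fin n → ℤ) →+ ℚ) (x : AddMonoidAlgebra K (Fin n → ℤ))
    (u : Fin n → ℤ) : ((gradedHahn K w x).coeff (w u)).coeff u = x.coeff u := by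
  induction x using AddMonoidAlgebra.induction_linear with
  | zero => simp
  | add x y hx hy => simp [hx, hy]
  | single v c =>
    rw [gradedHahn_single, HahnSeries.coeff_single]
    split_ifs with h
    · simp
    · have : v ≠ u := by rintro rfl; exact h rfl
      simp [this]

/-- The Laurent polynomials all of whose exponents have nonnegative weight, as the integers of a
valuation. -/
noncomputable def weightValuation (K : Type u) [Field K] (w : (Fin n → ℤ) →+ ℚ) :
    Valuation (AddMonoidAlgebra K (Fin n → ℤ)) (Multiplicative (WithTop ℚ)ᵒᵈ) :=
  ((HahnSeries.addVal ℚ (AddMonoidAlgebra K (Fin n → ℤ))).toValuation).comap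
    (gradedHahn K w)

/-- The coefficients of the Hahn series retain the monomials, so terms of equal weight cannot cancel
and the order is the least weight of an exponent. -/
theorem mem_integer_weightValuation (w : (Fin n → ℤ) →+ ℚ) (x : AddMonoidAlgebra K (Fin n → ℤ)) :
    x ∈ (weightValuation K w).integer ↔ ∀ u, x.coeff u ≠ 0 → 0 ≤ w u := by
  have h : ∀ x, x ∈ (weightValuation K w).integer ↔ 0 ≤ (gradedHahn K w x).orderTop := fun x =>
    Iff.rfl
  constructor
  · intro hx u hu
    rw [h] at hx
    have h1 : (gradedHahn K w x).coeff (w u) ≠ 0 := fun h0 => hu (by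
      rw [← coeff_gradedHahn w, h0]; rfl)
    exact WithTop.coe_nonneg.1 (hx.trans (HahnSeries.orderTop_le_of_coeff_ne_zero h1))
  · intro hx
    rw [← AddMonoidAlgebra.sum_coeff_single x]
    refine Subring.sum_mem _ fun u hu => (h _).2 ?_
    rw [gradedHahn_single]
    exact (WithTop.coe_nonneg.2 (hx u (Finsupp.mem_support_iff.1 hu))).trans
      HahnSeries.orderTop_single_le

/-- The algebra of a submonoid of `ℤⁿ` defined by linear inequalities is integrally closed. -/
theorem isIntegrallyClosed_monoidAlgebra {I : Type*} (w : I → (Fin n → ℤ) →+ ℚ)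
    {N : AddSubmonoid (Fin n → ℤ)} (hN : ∀ u, u ∈ N ↔ ∀ i, 0 ≤ w i u) :
    IsIntegrallyClosed (AddMonoidAlgebra K N) := by
  let f := AddMonoidAlgebra.mapDomainAlgHom K K N.subtype
  have hf : Function.Injective f := AddMonoidAlgebra.mapDomain_injective Subtype.val_injective
  have := isIntegrallyClosed_torus K n
  have hrange : ∀ x : AddMonoidAlgebra K (Fin n → ℤ), (∀ u, x.coeff u ≠ 0 → u ∈ N) →
      ∃ y, f y = x := by
    intro x hx
    rw [← AddMonoidAlgebra.sum_coeff_single x]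
    refine AlgHom.mem_range f |>.1 (Subalgebra.sum_mem _ fun u hu => ?_)
    exact ⟨AddMonoidAlgebra.single ⟨u, hx u (Finsupp.mem_support_iff.1 hu)⟩ (x.coeff u), by simp [f]⟩
  have hcoeff : ∀ y u, (f y).coeff u ≠ 0 → u ∈ N := by
    intro y u
    induction y using AddMonoidAlgebra.induction_linear with
    | zero => simp
    | add x y hx hy =>
      intro h
      by_contra hu
      refine h ?_
      rw [map_add, AddMonoidAlgebra.coeff_add, Finsupp.add_apply, not_not.1 (mt hx hu),
        not_not.1 (mt hy hu), add_zero]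
    | single v c =>
      intro h
      by_contra hu
      have : (v : Fin n → ℤ) ≠ u := by rintro rfl; exact hu v.2
      exact h (by simp [f, this])
  let _ : Algebra (AddMonoidAlgebra K N) (AddMonoidAlgebra K (Fin n → ℤ)) := f.toRingHom.toAlgebra
  have : FaithfulSMul (AddMonoidAlgebra K N) (AddMonoidAlgebra K (Fin n → ℤ)) :=
    (faithfulSMul_iff_algebraMap_injective _ _).2 hf
  have : IsIntegrallyClosedIn (AddMonoidAlgebra K N) (AddMonoidAlgebra K (Fin n → ℤ)) := by
    -- For each weight `w i`, `K[N]` lies in the integers of its valuation, and these contain every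
    -- element integral over them. So an integral `x` has all its exponents in `N`.
    refine isIntegrallyClosedIn_iff.2 ⟨hf, fun {x} hx => hrange x fun u hu => (hN u).2 fun i => ?_⟩
    refine (mem_integer_weightValuation (w i) x).1 ?_ u hu
    obtain ⟨P, hP, hx⟩ := hx
    let g : AddMonoidAlgebra K N →+* (weightValuation K (w i)).integer :=
      f.toRingHom.codRestrict _ fun y => (mem_integer_weightValuation (w i) _).2
        fun u hu => (hN u).1 (hcoeff y u hu) i
    refine Valuation.Integers.mem_of_integral (Valuation.integer.integers _)
      ⟨P.map g, hP.map g, ?_⟩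
    rw [Polynomial.eval₂_map]
    exact hx
  exact IsIntegrallyClosed.of_isIntegrallyClosed_of_isIntegrallyClosedIn _
    (AddMonoidAlgebra K (Fin n → ℤ))

theorem isIntegrallyClosed_stalk (R : Type u) [CommRing R] [IsDomain R] [IsIntegrallyClosed R]
    (p : PrimeSpectrum R) :
    IsDomain ((Spec.structureSheaf R).presheaf.stalk p) ∧
      IsIntegrallyClosed ((Spec.structureSheaf R).presheaf.stalk p) := by
  have hloc : IsLocalization.AtPrime ((Spec.structureSheaf R).presheaf.stalk p) p.asIdeal :=
    StructureSheaf.IsLocalization.to_stalk R p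
  have := IsLocalization.isDomain_of_atPrime ((Spec.structureSheaf R).presheaf.stalk p) p.asIdeal
  exact ⟨this, isIntegrallyClosed_of_isLocalization _ p.asIdeal.primeCompl
      p.asIdeal.primeCompl_le_nonZeroDivisors⟩

theorem isNormalScheme_of_cover {X : Scheme.{u}} {I : Type*} (R : I → CommRingCat.{u})
    (c : ∀ i, Spec (R i) ⟶ X) [∀ i, IsOpenImmersion (c i)] [∀ i, IsDomain (R i)]
    [∀ i, IsIntegrallyClosed (R i)] (hc : ∀ x, ∃ i, x ∈ Set.range (c i)) : IsNormalScheme X := by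
  intro x
  obtain ⟨i, y, rfl⟩ := hc x
  let e := (asIso ((c i).stalkMap y)).commRingCatIsoToRingEquiv
  obtain ⟨h1, h2⟩ : IsDomain ((Spec (R i)).presheaf.stalk y) ∧
    IsIntegrallyClosed ((Spec (R i)).presheaf.stalk y) := isIntegrallyClosed_stalk (R i) y
  exact ⟨e.injective.isDomain, .of_equiv e.symm⟩

end Normal

/-! ### Normality and toric structure of the varieties of chains -/

section LSAlgebra

variable {S : Type u} [PartialOrder S] [Finite S] {b : S → S → ℕ}
variable {K A : Type u} [Field K] [CommRing A] [Algebra K A] {𝒜 : ℕ → Submodule K A}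
  [GradedAlgebra 𝒜] {j : LSPath b 1 → 𝒜 1}
variable (hb : IsPosetWithBonds b) (hA : IsDiscreteLSAlgebra b 𝒜 j)

include hb hA in
theorem isNormalScheme_projOver (hS : IsChain (· ≤ ·) (Set.univ : Set S)) :
    IsNormalScheme (projOver 𝒜).left := by
  obtain ⟨n, ι, hι, hr⟩ := exists_lattice_param hb hS
  have h1 : ∀ p : LSPath b 1,
      IsDomain (CommRingCat.of (AddMonoidAlgebra K (chartMonoid ι p.1))) := fun p =>
    isDomain_monoidAlgebra K (chartMonoid ι p.1)
  have h2 : ∀ p : LSPath b 1,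
      IsIntegrallyClosed (CommRingCat.of (AddMonoidAlgebra K (chartMonoid ι p.1))) := fun p =>
    isIntegrallyClosed_monoidAlgebra (I := {σ // p.1 σ = 0})
      (fun σ => (Pi.evalAddMonoidHom (fun _ : S => ℚ) σ.1).comp ι)
      fun u => ⟨fun h σ => h σ.1 σ.2, fun h σ hσ => h ⟨σ, hσ⟩⟩
  have h3 : ∀ p : LSPath b 1, IsOpenImmersion (chartHom hb hA hS hι hr p.2 one_pos) := fun p =>
    isOpenImmersion_chartHom hb hA hS hι hr p.2 one_pos
  exact isNormalScheme_of_cover (X := Proj 𝒜)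
    (fun p : LSPath b 1 => .of (AddMonoidAlgebra K (chartMonoid ι p.1)))
    (fun p => chartHom hb hA hS hι hr p.2 one_pos) (exists_mem_range_chartHom hb hA hS hι hr)

include hb hA in
theorem IsDiscreteLSAlgebra.isToricVariety_chainVariety {C : Set S} (hC : IsChain (· ≤ ·) C)
    (hne : C.Nonempty) :
    IsNormalScheme (chainVariety j C).left ∧ IsToricVariety (chainVariety j C) := by
  -- `A_C` is a discrete LS algebra over a poset that is itself a chain, to which the charts apply.
  obtain ⟨jC, -, h⟩ := hA.chain hb hC
  have := hne.to_subtype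
  have hC' : IsChain (· ≤ ·) (Set.univ : Set C) := fun x _ y _ hxy =>
    hC x.2 y.2 fun e => hxy (Subtype.ext e)
  exact ⟨isNormalScheme_projOver (hb.restrictBond hC) h hC',
    isToricVariety_projOver (hb.restrictBond hC) h hC'⟩

end LSAlgebra

end LSAlg

/-! ### The theorem -/

open LSAlg in
theorem mainTheorem4 {S K : Type u} [PartialOrder S] [BoundedOrder S] [Finite S] [Field K]
    (b : S → S → ℕ) (hb : IsPosetWithBonds b) :
    -- the discrete LS algebra over `(S, ≤, b)` exists
    (∃ (A : Type u) (_ : CommRing A) (_ : Algebra K A) (𝒜 : ℕ → Submodule K A)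
      (_ : GradedAlgebra 𝒜) (j : LSPath b 1 → 𝒜 1), IsDiscreteLSAlgebra b 𝒜 j) ∧
    ∀ (A : Type u) [CommRing A] [Algebra K A] (𝒜 : ℕ → Submodule K A) [GradedAlgebra 𝒜]
      (j : LSPath b 1 → 𝒜 1), IsDiscreteLSAlgebra b 𝒜 j →
      -- `A_C` is the discrete LS algebra over the chain `C`, with the induced path basis
      (∀ C : Set S, IsChain (· ≤ ·) C →
        ∃ jC : LSPath (restrictBond b C) 1 → chainGrading j C 1,
          (∀ π : LSPath (restrictBond b C) 1, ∃ π' : LSPath b 1,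
            π'.1 = Function.extend Subtype.val π.1 0 ∧
              (jC π).1 = Ideal.Quotient.mk (chainIdeal j C).toIdeal (j π' : A)) ∧
          IsDiscreteLSAlgebra (restrictBond b C) (chainGrading j C) jC) ∧
      -- `X_C` is a closed subscheme of `X` over `K`
      (∀ C : Set S, IsChain (· ≤ ·) C →
        IsClosedImmersion (chainι j C) ∧
          chainι j C ≫ (projOver 𝒜).hom = (chainVariety j C).hom) ∧
      -- the `X_C`, for `C` a maximal chain, are the irreducible components of `X`, without repetition
      Set.BijOn (fun C : Set S => Set.range (chainι j C))
        {C : Set S | IsMaxChain (· ≤ ·) C} (irreducibleComponents (projOver 𝒜).left) ∧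
      -- the `X_C` are projective normal toric varieties
      (∀ C : Set S, IsChain (· ≤ ·) C → C.Nonempty →
        IsProjectiveOver (chainVariety j C) ∧ IsNormalScheme (chainVariety j C).left ∧
          IsToricVariety (chainVariety j C)) ∧
      -- in particular this applies to maximal chains and to their pairwise intersections
      (∀ C₁ C₂ : Set S, IsMaxChain (· ≤ ·) C₁ → IsMaxChain (· ≤ ·) C₂ → (C₁ ∩ C₂).Nonempty) ∧
      -- the scheme-theoretic intersection of `X_{C₁}` and `X_{C₂}` is `X_{C₁ ∩ C₂}`
      (∀ C₁ C₂ : Set S, IsChain (· ≤ ·) C₁ → IsChain (· ≤ ·) C₂ →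
        ∃ (f : (chainVariety j (C₁ ∩ C₂)).left ⟶ (chainVariety j C₁).left)
          (g : (chainVariety j (C₁ ∩ C₂)).left ⟶ (chainVariety j C₂).left),
          f ≫ chainι j C₁ = chainι j (C₁ ∩ C₂) ∧
            IsPullback f g (chainι j C₁) (chainι j C₂)) := by
  refine ⟨exists_isDiscreteLSAlgebra K hb, fun A _ _ 𝒜 _ j hA => ⟨fun C hC => hA.chain hb hC,
    fun C _ => ⟨isClosedImmersion_chainι C, chainι_hom C⟩, bijOn_irreducibleComponents hb hA,
    fun C hC hne => ⟨hA.isProjectiveOver_chainVariety hb hC hne,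
      hA.isToricVariety_chainVariety hb hC hne⟩,
    fun C₁ C₂ h₁ h₂ => ⟨⊥, h₁.bot_mem, h₂.bot_mem⟩,
    fun C₁ C₂ _ _ => exists_isPullback_chainι C₁ C₂⟩⟩
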